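/- **Theorem 1 (MF-Search).** The following search problem is FPSPACE-complete: given a closed quantified Boolean formula $\Phi$ in prenex conjunctive normal form (QCNF), output a minimal false (MF) clausal weakening of $\Phi$ if $\Phi$ is FALSE, and answer `no' if $\Phi$ is TRUE. *Formulas.* A QCNF is a formula $Q_1x_1\cdots Q_nx_n\,(C_1\wedge\dots\wedge C_m)$ with $Q_i\in\{\forall,\exists\}$, different variables $x_1,\dots,x_n$, and pairwise different clauses $C_j$, a clause being a nonempty disjunction of literals; some of the conjuncts may also be the constant TRUE. It is closed if all variables of the clauses are among $x_1,\dots,x_n$. A basic clausal weakening replaces one conjunct $C_j$ by TRUE; the weakenings of $\Phi$ are the QCNFs obtained from $\Phi$ by finitely many (possibly zero) basic clausal weakenings. A closed QCNF $\Psi$ is MF if $\Psi$ is FALSE and the only FALSE weakening of $\Psi$ is $\Psi$ itself; an MF weakening of $\Phi$ is a weakening of $\Phi$ that is MF. Formulas are written as words over a fixed finite alphabet in a standard way, variables having binary words as names; words that do not encode a closed QCNF get the answer `no'. *Complexity.* Functions on words are computed by always halting deterministic Turing machines with a two-way read-only input tape, one two-way read/write work tape and a one-way write-only output tape. A search problem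 is a relation $R(x,y)$ between words over finite alphabets. It is in FPSPACE if there is a polynomial $P$ such that $R(x,y)$ implies $|y|\le P(|x|)$, and there is a computable function $f$ with $R(x,f(x))$ for all $x$, computed by a machine which on every input $x$ uses at most $P(|x|)$ cells of its work and output tapes together. A function is logspace if it is computed by a machine using $O(\log|x|)$ cells of its work tape (the output tape is not restricted). $R_1$ is logspace reducible to $R_2$ if there are logspace functions $f$ and $h$ such that $R_2(f(x),z)$ implies $R_1(x,h(z,x))$ for all $x,z$, where some computable function $g$ satisfies $R_2(u,g(u))$ for all $u$. $R$ is FPSPACE-complete if it is in FPSPACE and every FPSPACE search problem is logspace reducible to it. -/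

import Mathlib

namespace MFSearch

/-! ### Turing machines with an input tape, a work tape and an output tape -/

/-- Head movements. -/
inductive Move where
  | left
  | stay
  | right

/-- Contents of a cell of the input tape: the word is enclosed by two end markers. -/
inductive InSym (A : Type) where
  | leftEnd
  | sym (a : A)
  | rightEnd

/-- What a machine does in one step: next state, movement of the input head, symbol written on the
work tape, movement of the work head, and possibly one symbol appended to the output tape. -/
structure Action (Q Γ B : Type) where
  next : Q
  moveIn : Move
  write : Γ
  moveWork : Move
  emit : Option B

/-- A deterministic Turing machine with three tapes: a two-way read-only input tape over `A`,
a two-way read/write work tape over `Γ`, and a one-way write-only output tape over `B`.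
The machine halts (and accepts) when no action is prescribed. -/
structure Machine (A B : Type) where
  /-- states -/
  Q : Type
  /-- work alphabet -/
  Γ : Type
  finQ : Finite Q
  finΓ : Finite Γ
  start : Q
  blank : Γ
  δ : Q → InSym A → Γ → Option (Action Q Γ B)

/-- The symbol in cell `i` of the input tape holding `x`: cell `0` holds the left end marker, cells
`1, …, |x|` hold the letters of `x`, and then comes the right end marker. -/
def inputSymbol {A : Type} (x : List A) : ℕ → InSym A
  | 0 => .leftEnd
  | i + 1 => match x[i]? with
    | some a => .sym a
    | none => .rightEnd

/-- Movement of the input head, which never leaves the cells `0, …, n + 1`. -/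
def Move.onInput (n : ℕ) : Move → ℕ → ℕ
  | .left, i => i - 1
  | .stay, i => i
  | .right, i => min (i + 1) (n + 1)

/-- Movement of the work head; the work tape has the cells `0, 1, 2, …`, and a left move
in cell `0` has no effect. -/
def Move.onWork : Move → ℕ → ℕ
  | .left, i => i - 1
  | .stay, i => i
  | .right, i => i + 1

namespace Machine

variable {A B : Type}

/-- A configuration of a machine (the input word being fixed). -/
structure Cfg (M : Machine A B) where
  state : M.Q
  inHead : ℕ
  tape : ℕ → M.Γ
  workHead : ℕ
  out : List B

/-- The initial configuration: blank work tape, empty output tape. -/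
def init (M : Machine A B) : M.Cfg where
  state := M.start
  inHead := 0
  tape := fun _ => M.blank
  workHead := 0
  out := []

/-- One step on input `x`; `none` if the machine has halted. -/
def step (M : Machine A B) (x : List A) (c : M.Cfg) : Option M.Cfg :=
  (M.δ c.state (inputSymbol x c.inHead) (c.tape c.workHead)).map fun a =>
    { state := a.next
      inHead := a.moveIn.onInput x.length c.inHead
      tape := Function.update c.tape c.workHead a.write
      workHead := a.moveWork.onWork c.workHead
      out := c.out ++ a.emit.toList }

/-- `c` is reached from the initial configuration on input `x`. -/
def Reached (M : Machine A B) (x : List A) (c : M.Cfg) : Prop :=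
  Relation.ReflTransGen (fun c₁ c₂ => M.step x c₁ = some c₂) M.init c

/-- On every input `x` the machine halts with `f x` on its output tape. -/
def Computes (M : Machine A B) (f : List A → List B) : Prop :=
  ∀ x, ∃ c, M.Reached x c ∧ M.step x c = none ∧ c.out = f x

/-- On input `x` the machine visits at most the first `s` cells of its work tape. -/
def WorkSpaceLE (M : Machine A B) (x : List A) (s : ℕ) : Prop :=
  ∀ c, M.Reached x c → c.workHead + 1 ≤ s

end Machine

/-! ### Search problems, logspace reductions, completeness -/

/-- Total functions on words computed by a machine. -/
def IsComputable {A B : Type} (f : List A → List B) : Prop :=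
  ∃ M : Machine A B, M.Computes f

/-- Logspace functions: `O(log |x|)` cells of the work tape, no restriction on the output tape. -/
def IsLogspace {A B : Type} (f : List A → List B) : Prop :=
  ∃ M : Machine A B, M.Computes f ∧
    ∃ k : ℕ, ∀ x, M.WorkSpaceLE x (k * (Nat.log 2 x.length + 1))

/-- `R` is an FPSPACE search problem: the length of all solutions is polynomially bounded, and some
machine computes a solution of every input `x`, using at most polynomially many cells on its work
tape and its output tape together. -/
def IsFPSPACE {A B : Type} (R : List A → List B → Prop) : Prop :=
  ∃ P : Polynomial ℕ,
    (∀ x y, R x y → y.length ≤ P.eval x.length) ∧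
    ∃ (f : List A → List B) (M : Machine A B), M.Computes f ∧ (∀ x, R x (f x)) ∧
      ∀ x, ∃ s, M.WorkSpaceLE x s ∧ s + (f x).length ≤ P.eval x.length

/-- The pair `(z, x)` as one word over the disjoint union of the two alphabets. -/
def pairWord {A B : Type} (z : List B) (x : List A) : List (B ⊕ A) :=
  z.map Sum.inl ++ x.map Sum.inr

/-- Logspace reducibility of the search problem `R₁` to the search problem `R₂`: there are logspace
functions `f` and `h` such that `h (z, x)` is a solution of `x` for `R₁` whenever `z` is a solution
of `f x` for `R₂` (and `R₂` is solved by some computable function, so that such `z` are found). -/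
def LogspaceReducible {A₁ B₁ A₂ B₂ : Type} (R₁ : List A₁ → List B₁ → Prop)
    (R₂ : List A₂ → List B₂ → Prop) : Prop :=
  ∃ (f : List A₁ → List A₂) (h : List (B₂ ⊕ A₁) → List B₁),
    IsLogspace f ∧ IsLogspace h ∧
    (∃ g : List A₂ → List B₂, IsComputable g ∧ ∀ u, R₂ u (g u)) ∧
    ∀ x z, R₂ (f x) z → R₁ x (h (pairWord z x))

/-- FPSPACE-completeness: `R` is an FPSPACE search problem, and every FPSPACE search problem, over
any finite alphabets, is logspace reducible to it. -/
def IsFPSPACEComplete {A B : Type} (R : List A → List B → Prop) : Prop :=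
  IsFPSPACE R ∧
    ∀ (A₁ B₁ : Type) [Finite A₁] [Finite B₁] (R₁ : List A₁ → List B₁ → Prop),
      IsFPSPACE R₁ → LogspaceReducible R₁ R

/-! ### Quantified Boolean formulas in prenex conjunctive normal form -/

/-- Propositional variables; a variable is given by its name, a binary word. -/
abbrev Var := List Bool

inductive Quantifier where
  | all
  | ex

/-- The literal `v` if `positive = true`, and `¬ v` otherwise. -/
structure Literal where
  positive : Bool
  var : Var

/-- A conjunct of the matrix: the constant TRUE (which is what weakening puts in place of a clause)
or a clause, the disjunction of the listed literals. -/
inductive Conjunct where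
  | top
  | clause (C : List Literal)

/-- A QCNF `Q₁ x₁ … Qₙ xₙ (C₁ ∧ … ∧ Cₘ)`: the quantified variables are different, each `Cⱼ` is
TRUE or a nonempty clause, and the clauses are pairwise different. -/
@[ext]
structure QCNF where
  quants : List (Quantifier × Var)
  matrix : List Conjunct
  nodup_vars : (quants.map Prod.snd).Nodup
  nonempty_clauses : ∀ C, Conjunct.clause C ∈ matrix → C ≠ []
  different_clauses : matrix.Pairwise fun c d => c = d → c = Conjunct.top

abbrev Valuation := Var → Bool

def Literal.Holds (l : Literal) (σ : Valuation) : Prop := σ l.var = l.positive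

def Conjunct.Holds : Conjunct → Valuation → Prop
  | .top, _ => True
  | .clause C, σ => ∃ l ∈ C, l.Holds σ

/-- Semantics of a quantifier prefix in front of a Boolean condition. -/
def quantify : List (Quantifier × Var) → (Valuation → Prop) → Valuation → Prop
  | [], φ, σ => φ σ
  | (.all, v) :: q, φ, σ => ∀ b, quantify q φ (Function.update σ v b)
  | (.ex, v) :: q, φ, σ => ∃ b, quantify q φ (Function.update σ v b)

namespace QCNF

/-- `Φ` holds under the valuation `σ` (of its free variables). -/
def Holds (Φ : QCNF) (σ : Valuation) : Prop :=
  quantify Φ.quants (fun τ => ∀ c ∈ Φ.matrix, c.Holds τ) σ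

/-- Every variable occurring in the matrix is quantified. -/
def Closed (Φ : QCNF) : Prop :=
  ∀ C, Conjunct.clause C ∈ Φ.matrix → ∀ l ∈ C, l.var ∈ Φ.quants.map Prod.snd

/-- Unsatisfiability, which for closed formulas means being FALSE. -/
def IsFalse (Φ : QCNF) : Prop := ∀ σ, ¬ Φ.Holds σ

/-- `Ψ` is a basic clausal weakening of `Φ`: one conjunct of `Φ` is replaced by TRUE. -/
def BasicWeakening (Φ Ψ : QCNF) : Prop :=
  Ψ.quants = Φ.quants ∧ ∃ j < Φ.matrix.length, Ψ.matrix = Φ.matrix.set j Conjunct.top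

/-- The clausal weakenings of `Φ`: reflexive transitive closure of basic weakening. -/
def weakenings (Φ : QCNF) : Set QCNF :=
  {Ψ | Relation.ReflTransGen BasicWeakening Φ Ψ}

/-- `Ψ` is minimal false: it is false, and its only false weakening is itself. -/
def IsMF (Ψ : QCNF) : Prop :=
  Ψ.IsFalse ∧ ∀ Ψ' ∈ Ψ.weakenings, Ψ'.IsFalse → Ψ' = Ψ

/-- The minimal false weakenings of `Φ`. -/
def MF (Φ : QCNF) : Set QCNF := {Ψ | Ψ.IsMF ∧ Ψ ∈ Φ.weakenings}

end QCNF

/-! ### The search problem -/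

/-- The alphabet in which formulas and answers are written. -/
inductive Token where
  | all
  | ex
  | bit (b : Bool)
  | lit (positive : Bool)
  | clause
  | top
  | no

def Quantifier.token : Quantifier → Token
  | .all => .all
  | .ex => .ex

def Var.encode (v : Var) : List Token := v.map Token.bit

def Literal.encode (l : Literal) : List Token := Token.lit l.positive :: Var.encode l.var

def Conjunct.encode : Conjunct → List Token
  | .top => [.top]
  | .clause C => .clause :: C.flatMap Literal.encode

/-- A formula as a word: every quantifier is followed by the name of its variable, then come the
conjuncts; a clause is a marker followed by its literals, a literal is its sign followed by the
name of its variable. -/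
def QCNF.encode (Φ : QCNF) : List Token :=
  Φ.quants.flatMap (fun p => p.1.token :: Var.encode p.2) ++ Φ.matrix.flatMap Conjunct.encode

/-- The MF search problem: on (the word of) a closed QCNF `Φ`, a solution is any minimal false
weakening of `Φ` if `Φ` is false, and the answer `no` otherwise.
Words that are not closed QCNFs get the answer `no`. -/
def mfSearch (x y : List Token) : Prop :=
  (∃ Φ : QCNF, Φ.Closed ∧ Φ.encode = x ∧ Φ.IsFalse ∧ ∃ Ψ ∈ Φ.MF, y = Ψ.encode) ∨
  ((¬ ∃ Φ : QCNF, Φ.Closed ∧ Φ.encode = x ∧ Φ.IsFalse) ∧ y = [Token.no])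

end MFSearch

namespace MFSearch

/-! ### A structured register language -/

/-! Membership. Weakening preserves truth. A greedy scan that drops each clause whose removal keeps
the formula false therefore ends in a minimal false weakening: a clause kept at stage `p` made the
formula true when it was dropped, and it still does after more clauses have gone (`isMF_greedy`).
The scan needs only the truth values of weakenings. These are found by backtracking through all
assignments, where the current assignment, one number below `2 ^ |x|`, is the only memory: the
quantifier at which to resume is determined by that assignment and by the value of the matrix
(`exists_backtrack`, `iterate_backtrack`). Everything is phrased in positions of the input word, so
that it becomes bounded quantification and bounded recursion over numbers.

Machines. Both halves need explicit machines, and they are obtained from one calculus. Programs with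
finitely many registers are compiled to machines that keep the registers in binary, one tape cell
per binary place; if the registers stay below `g`, about `log g` cells suffice (`compile_run`). The
predicates `Cm`, `CmP`, `CmF` and `Em` collect the functions, properties, finite-valued functions
and output words programmable with registers bounded polynomially (giving logarithmic space) or by
`2` to a polynomial (giving polynomial space). They are closed under bounded recursion and
substitution, so the remaining machine constructions are compositions of closure lemmas.

Hardness. Let `M` solve a search problem in polynomial space. A configuration is coded by `W` bits,
and `e j` is the code after `j` steps. An alternating game halves time intervals: the existential
player names the ends and the middle of an interval, the universal player picks a half, and after
`K` rounds the ends must be successive configurations. If all these constraints hold, the upper end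
of the first interval must be `e (2 ^ K)` (`Play.upper_eq`), and honest play achieves this
(`Play.of_honest`). With `W ≤ K` the computation has halted by then (`Computation.e_eq`).

To make minimal false weakenings spell out the result, the existential player first selects some
indices of result bits, at least one, and the universal player then chooses a bit `β`. A clause for
each pair `(k, β)` demands that, if `k` is selected and `β` chosen, bit `k` of the result is `β`.
The full formula is false, since the universal player chooses the wrong value of a selected bit
(`not_wins`). Dropping the clause of a wrong pair makes it true: select only that `k` and play
honestly (`mem_of_not_wins`). The clause of a right pair is redundant (`wins_of_wins`). So a minimal
false weakening contains the clause `(k, β)` exactly when `β` is not bit `k`, and a finite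
transducer reads the output of `M` off it. Which constraints of the computation survive in the
weakening does not matter. -/

/-- Tests of the register language: comparison of two registers, or a property of the symbol under
the input head. -/
inductive RTest (A : Type) where
  | lt (r s : ℕ)
  | sym (S : InSym A → Bool)

/-- Programs of the register language. -/
inductive Stmt (A B : Type) where
  | skip
  | zero (r : ℕ)
  | succ (r : ℕ)
  | move (m : Move)
  | emit (b : B)
  | seq (p q : Stmt A B)
  | ite (t : RTest A) (p q : Stmt A B)
  | loop (t : RTest A) (p : Stmt A B)

/-- Stores of the register language. -/
structure Store (B : Type) where
  regs : ℕ → ℕ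
  head : ℕ
  out : List B

variable {A B : Type}

def RTest.eval (x : List A) (st : Store B) : RTest A → Bool
  | .lt r s => decide (st.regs r < st.regs s)
  | .sym S => S (inputSymbol x st.head)

/-- One step of a program, given as a stack of statements. -/
def rstep (x : List A) : List (Stmt A B) × Store B → Option (List (Stmt A B) × Store B)
  | ([], _) => none
  | (.skip :: k, st) => some (k, st)
  | (.zero r :: k, st) => some (k, { st with regs := Function.update st.regs r 0 })
  | (.succ r :: k, st) => some (k, { st with regs := Function.update st.regs r (st.regs r + 1) })
  | (.move m :: k, st) => some (k, { st with head := m.onInput x.length st.head })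
  | (.emit b :: k, st) => some (k, { st with out := st.out ++ [b] })
  | (.seq p q :: k, st) => some (p :: q :: k, st)
  | (.ite t p q :: k, st) => some ((if t.eval x st then p else q) :: k, st)
  | (.loop t p :: k, st) => some (if t.eval x st then p :: .loop t p :: k else k, st)

/-- A run all of whose stores, but possibly the first one, have registers bounded by `g`. -/
def RRun (x : List A) (g : ℕ) : List (Stmt A B) × Store B → List (Stmt A B) × Store B → Prop :=
  Relation.ReflTransGen fun c c' => rstep x c = some c' ∧ ∀ r, c'.2.regs r ≤ g

/-- `p` transforms `st` into `st'`, with registers bounded by `g`. -/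
def Does (x : List A) (g : ℕ) (p : Stmt A B) (st st' : Store B) : Prop :=
  ∀ k, RRun x g (p :: k, st) (k, st')

namespace Does

variable {x : List A} {g : ℕ} {p q : Stmt A B} {st st' st'' : Store B}

theorem of_step (h : ∀ k, rstep x (p :: k, st) = some (k, st')) (hb : ∀ r, st'.regs r ≤ g) :
    Does x g p st st' := fun k => .single ⟨h k, hb⟩

theorem seq (hb : ∀ r, st.regs r ≤ g) (hp : Does x g p st st') (hq : Does x g q st' st'') :
    Does x g (.seq p q) st st'' := fun k =>
  (Relation.ReflTransGen.single ⟨rfl, hb⟩).trans ((hp _).trans (hq k))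

theorem ite_true {t : RTest A} (hb : ∀ r, st.regs r ≤ g) (ht : t.eval x st = true)
    (hp : Does x g p st st') : Does x g (.ite t p q) st st' := fun k =>
  (Relation.ReflTransGen.single ⟨by simp [rstep, ht], hb⟩).trans (hp k)

theorem ite_false {t : RTest A} (hb : ∀ r, st.regs r ≤ g) (ht : t.eval x st = false)
    (hq : Does x g q st st') : Does x g (.ite t p q) st st' := fun k =>
  (Relation.ReflTransGen.single ⟨by simp [rstep, ht], hb⟩).trans (hq k)

theorem loop_true {t : RTest A} (hb : ∀ r, st.regs r ≤ g) (ht : t.eval x st = true)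
    (hp : Does x g p st st') (hl : Does x g (.loop t p) st' st'') :
    Does x g (.loop t p) st st'' := fun k =>
  (Relation.ReflTransGen.single ⟨by simp [rstep, ht], hb⟩).trans ((hp _).trans (hl k))

theorem loop_false {t : RTest A} (hb : ∀ r, st.regs r ≤ g) (ht : t.eval x st = false) :
    Does x g (.loop t p) st st := fun k =>
  .single ⟨by simp [rstep, ht], hb⟩

end Does

/-! ### Compilation of register programs to machines -/

/-- The stacksOf that occur in the execution of `p` on top of `k`. -/
def stacksOf : Stmt A B → List (Stmt A B) → Set (List (Stmt A B))
  | .seq p q, k => insert (.seq p q :: k) (stacksOf p (q :: k) ∪ stacksOf q k)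
  | .ite t p q, k => insert (.ite t p q :: k) (stacksOf p k ∪ stacksOf q k)
  | .loop t p, k => insert (.loop t p :: k) (stacksOf p (.loop t p :: k))
  | p, k => {p :: k}

theorem finite_stacksOf (p : Stmt A B) (k : List (Stmt A B)) : (stacksOf p k).Finite := by
  induction p generalizing k <;> simp_all [stacksOf]

theorem self_mem_stacksOf (p : Stmt A B) (k : List (Stmt A B)) : p :: k ∈ stacksOf p k := by
  cases p <;> simp [stacksOf]

/-- Execution only pushes parts of `p` on top of `k`, until `k` itself is exposed. Together with
`finite_stacksOf` this lets the stack serve as the finite control of a machine. -/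
theorem stacksOf_closed (x : List A) (p : Stmt A B) (k : List (Stmt A B)) {l l' : List (Stmt A B)}
    {st st' : Store B} (hl : l ∈ stacksOf p k) (h : rstep x (l, st) = some (l', st')) :
    l' ∈ insert k (stacksOf p k) := by
  induction p generalizing k l with
  | seq p q ihp ihq =>
    simp only [stacksOf, Set.mem_insert_iff, Set.mem_union] at hl ⊢
    rcases hl with rfl | hl | hl
    · simp only [rstep, Option.some.injEq, Prod.mk.injEq] at h
      exact Or.inr (Or.inr (Or.inl (h.1 ▸ self_mem_stacksOf _ _)))
    · rcases ihp _ hl h with rfl | h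
      · exact Or.inr (Or.inr (Or.inr (self_mem_stacksOf _ _)))
      · exact Or.inr (Or.inr (Or.inl h))
    · rcases ihq _ hl h with rfl | h
      · exact Or.inl rfl
      · exact Or.inr (Or.inr (Or.inr h))
  | ite t p q ihp ihq =>
    simp only [stacksOf, Set.mem_insert_iff, Set.mem_union] at hl ⊢
    rcases hl with rfl | hl | hl
    · simp only [rstep, Option.some.injEq, Prod.mk.injEq] at h
      rw [← h.1]
      split_ifs
      · exact Or.inr (Or.inr (Or.inl (self_mem_stacksOf _ _)))
      · exact Or.inr (Or.inr (Or.inr (self_mem_stacksOf _ _)))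
    · rcases ihp _ hl h with rfl | h
      · exact Or.inl rfl
      · exact Or.inr (Or.inr (Or.inl h))
    · rcases ihq _ hl h with rfl | h
      · exact Or.inl rfl
      · exact Or.inr (Or.inr (Or.inr h))
  | loop t p ihp =>
    simp only [stacksOf, Set.mem_insert_iff] at hl ⊢
    rcases hl with rfl | hl
    · simp only [rstep, Option.some.injEq, Prod.mk.injEq] at h
      rw [← h.1]
      split_ifs
      · exact Or.inr (Or.inr (self_mem_stacksOf _ _))
      · exact Or.inl rfl
    · rcases ihp _ hl h with rfl | h
      · exact Or.inr (Or.inl rfl)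
      · exact Or.inr (Or.inr h)
  | _ =>
    simp only [stacksOf, Set.mem_singleton_iff] at hl
    subst hl
    simp only [rstep, Option.some.injEq, Prod.mk.injEq] at h
    exact Or.inl h.1.symm

/-- All registers mentioned in the program are below `n`. -/
def Stmt.RegsBelow (n : ℕ) : Stmt A B → Prop
  | .zero r => r < n
  | .succ r => r < n
  | .seq p q => p.RegsBelow n ∧ q.RegsBelow n
  | .ite (.lt r s) p q => (r < n ∧ s < n) ∧ p.RegsBelow n ∧ q.RegsBelow n
  | .ite (.sym _) p q => p.RegsBelow n ∧ q.RegsBelow n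
  | .loop (.lt r s) p => (r < n ∧ s < n) ∧ p.RegsBelow n
  | .loop (.sym _) p => p.RegsBelow n
  | _ => True

theorem Stmt.RegsBelow.mono {m n : ℕ} (hmn : m ≤ n) {p : Stmt A B} (h : p.RegsBelow m) :
    p.RegsBelow n := by
  induction p with
  | zero r => exact lt_of_lt_of_le (show r < m from h) hmn
  | succ r => exact lt_of_lt_of_le (show r < m from h) hmn
  | seq p q ihp ihq => exact ⟨ihp h.1, ihq h.2⟩
  | ite t p q ihp ihq =>
    cases t with
    | lt r s => exact ⟨⟨h.1.1.trans_le hmn, h.1.2.trans_le hmn⟩, ihp h.2.1, ihq h.2.2⟩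
    | sym S => exact ⟨ihp h.1, ihq h.2⟩
  | loop t p ihp =>
    cases t with
    | lt r s => exact ⟨⟨h.1.1.trans_le hmn, h.1.2.trans_le hmn⟩, ihp h.2⟩
    | sym S => exact ihp h
  | _ => trivial

theorem Stmt.exists_regsBelow (p : Stmt A B) : ∃ n, p.RegsBelow n := by
  induction p with
  | zero r => exact ⟨r + 1, Nat.lt_succ_self r⟩
  | succ r => exact ⟨r + 1, Nat.lt_succ_self r⟩
  | seq p q ihp ihq =>
    obtain ⟨m, hm⟩ := ihp
    obtain ⟨n, hn⟩ := ihq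
    exact ⟨m + n, hm.mono (by omega), hn.mono (by omega)⟩
  | ite t p q ihp ihq =>
    obtain ⟨m, hm⟩ := ihp
    obtain ⟨n, hn⟩ := ihq
    cases t with
    | lt r s =>
      exact ⟨m + n + r + s + 1, ⟨by omega, by omega⟩, hm.mono (by omega), hn.mono (by omega)⟩
    | sym S => exact ⟨m + n, hm.mono (by omega), hn.mono (by omega)⟩
  | loop t p ihp =>
    obtain ⟨m, hm⟩ := ihp
    cases t with
    | lt r s => exact ⟨m + r + s + 1, ⟨by omega, by omega⟩, hm.mono (by omega)⟩
    | sym S => exact ⟨m, hm⟩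
  | _ => exact ⟨0, trivial⟩

theorem regsBelow_of_mem_stacksOf {n : ℕ} {p : Stmt A B} {k l : List (Stmt A B)}
    (hp : p.RegsBelow n) (hk : ∀ q ∈ k, q.RegsBelow n) (hl : l ∈ stacksOf p k) :
    ∀ q ∈ l, q.RegsBelow n := by
  induction p generalizing k with
  | seq p q ihp ihq =>
    simp only [stacksOf, Set.mem_insert_iff, Set.mem_union] at hl
    rcases hl with rfl | hl | hl
    · simpa [hp] using hk
    · exact ihp hp.1 (by simpa [hp.2] using hk) hl
    · exact ihq hp.2 hk hl
  | ite t p q ihp ihq =>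
    have h2 : p.RegsBelow n ∧ q.RegsBelow n := by
      cases t with
      | lt r s => exact hp.2
      | sym S => exact hp
    simp only [stacksOf, Set.mem_insert_iff, Set.mem_union] at hl
    rcases hl with rfl | hl | hl
    · simpa [hp] using hk
    · exact ihp h2.1 hk hl
    · exact ihq h2.2 hk hl
  | loop t p ihp =>
    have h2 : p.RegsBelow n := by
      cases t with
      | lt r s => exact hp.2
      | sym S => exact hp
    simp only [stacksOf, Set.mem_insert_iff] at hl
    rcases hl with rfl | hl
    · simpa [hp] using hk
    · exact ihp h2 (by simpa [hp] using hk) hl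
  | _ =>
    simp only [stacksOf, Set.mem_singleton_iff] at hl
    subst hl
    simpa [hp] using hk

/-- Control phases of the compiled machine. -/
inductive Phase where
  | start
  | ready
  | right (f : Bool)
  | left (f : Bool)

instance : Finite Phase := by
  have : Function.Injective (fun p : Phase => match p with
    | .start => ((0 : Fin 4), false)
    | .ready => (1, false)
    | .right f => (2, f)
    | .left f => (3, f)) := by
    intro p q h
    cases p <;> cases q <;> simp_all
  exact Finite.of_injective _ this

/-- Symbols of the compiled machine: a mark for cell `0`, and one bit for every register. -/
abbrev Column (n : ℕ) := Option (Bool × (Fin n → Bool))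

/-- An operation on the registers performed by one sweep over the tape with a Boolean flag. -/
structure Sweep (n : ℕ) where
  init : Bool
  flag : Bool → (Fin n → Bool) → Bool
  write : Bool → (Fin n → Bool) → (Fin n → Bool)
  extend : Bool → Option (Fin n → Bool)

/-- The bits of a register, or `0` if there is no such register. -/
def colBit {n : ℕ} (c : Fin n → Bool) (r : ℕ) : Bool :=
  if h : r < n then c ⟨r, h⟩ else false

def Sweep.zero (n r : ℕ) : Sweep n where
  init := false
  flag f _ := f
  write _ c := fun i => if i.1 = r then false else c i
  extend _ := none

/-- Cells are met from the least significant place on. The flag is the carry; a carry that survives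
all cells is written into a new column, in which the other registers have the digit `0`. -/
def Sweep.succ (n r : ℕ) : Sweep n where
  init := true
  flag f c := f && colBit c r
  write f c := fun i => if i.1 = r then xor f (c i) else c i
  extend f := if f then some (fun i => decide (i.1 = r)) else none

/-- After `j` cells the flag tells how the lowest `j` digits compare; a difference at a more
significant place overrides it. -/
def Sweep.lt (n r s : ℕ) : Sweep n where
  init := false
  flag f c := if colBit c r = colBit c s then f else colBit c s
  write _ c := c
  extend _ := none

/-- Instructions of the compiled machine. -/
inductive Instr (A B : Type) (n : ℕ) where
  | halt
  | quick (m : Move) (e : Option B) (next : InSym A → List (Stmt A B))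
  | sweep (s : Sweep n) (next : Bool → List (Stmt A B))

def instr (n : ℕ) : List (Stmt A B) → Instr A B n
  | [] => .halt
  | .skip :: k => .quick .stay none fun _ => k
  | .zero r :: k => .sweep (.zero n r) fun _ => k
  | .succ r :: k => .sweep (.succ n r) fun _ => k
  | .move m :: k => .quick m none fun _ => k
  | .emit b :: k => .quick .stay (some b) fun _ => k
  | .seq p q :: k => .quick .stay none fun _ => p :: q :: k
  | .ite (.lt r s) p q :: k => .sweep (.lt n r s) fun f => (if f then p else q) :: k
  | .ite (.sym S) p q :: k => .quick .stay none fun a => (if S a then p else q) :: k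
  | .loop (.lt r s) p :: k =>
    .sweep (.lt n r s) fun f => if f then p :: .loop (.lt r s) p :: k else k
  | .loop (.sym S) p :: k =>
    .quick .stay none fun a => if S a then p :: .loop (.sym S) p :: k else k

/-- The stacksOf of a program. -/
def control (p : Stmt A B) : Set (List (Stmt A B)) := insert [] (stacksOf p [])

open Classical in
/-- A stack as a control state; stacksOf that cannot occur are replaced by the empty one. -/
noncomputable def toControl (p : Stmt A B) (l : List (Stmt A B)) : control p :=
  if h : l ∈ control p then ⟨l, h⟩ else ⟨[], Or.inl rfl⟩

theorem toControl_val {p : Stmt A B} {l : List (Stmt A B)} (h : l ∈ control p) :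
    (toControl p l).1 = l := by
  simp [toControl, h]

/-- The machine that executes the program `p`, with registers below `n`. -/
noncomputable def compile (n : ℕ) (p : Stmt A B) : Machine A B where
  Q := control p × Phase
  Γ := Column n
  finQ := by
    have : Finite (control p) := ((finite_stacksOf p []).insert []).to_subtype
    infer_instance
  finΓ := inferInstance
  start := (toControl p [p], .start)
  blank := none
  δ := fun q a γ =>
    match q.2, instr n q.1.1 with
    | .start, _ => some ⟨(q.1, .ready), .stay, some (true, fun _ => false), .stay, none⟩
    | .ready, .halt => none
    | .ready, .quick m e next => some ⟨(toControl p (next a), .ready), m, γ, .stay, e⟩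
    | .ready, .sweep s _ => some ⟨(q.1, .right s.init), .stay, γ, .stay, none⟩
    | .right f, .sweep s _ =>
      match γ with
      | some (mk, c) => some ⟨(q.1, .right (s.flag f c)), .stay,
          some (mk, s.write f c), .right, none⟩
      -- The first blank cell marks the end of the registers: a column may be added there, and the
      -- head turns back towards the marked cell `0`.
      | none => some ⟨(q.1, .left f), .stay, (s.extend f).map fun c => (false, c), .left, none⟩
    | .left f, .sweep _ next =>
      match γ with
      | some (true, _) => some ⟨(toControl p (next f), .ready), .stay, γ, .stay, none⟩
      | _ => some ⟨(q.1, .left f), .stay, γ, .left, none⟩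
    | _, _ => none

/-- The tape holding the registers `R` in `w` binary digits. -/
def regTape (n w : ℕ) (R : ℕ → ℕ) : ℕ → Column n := fun j =>
  if j < w then some (decide (j = 0), fun i => (R i).testBit j) else none

/-- A run of a machine during which the work head stays below `s`. -/
def Machine.RunLE (M : Machine A B) (x : List A) (s : ℕ) : M.Cfg → M.Cfg → Prop :=
  Relation.ReflTransGen fun c c' => (M.step x c = some c' ∧ c.workHead < s) ∧ c'.workHead < s

end MFSearch
-- Correctness and space consumption of the compiled machines.
namespace MFSearch
variable {A B : Type}

/-- By determinism, every reachable configuration lies on the one run that leads to the halting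
configuration. -/
theorem Machine.RunLE.workSpaceLE {M : Machine A B} {x : List A} {s : ℕ} {c : M.Cfg} (hs : 0 < s)
    (h : M.RunLE x s M.init c) (hc : M.step x c = none) : M.WorkSpaceLE x s := by
  have key : ∀ a, M.RunLE x s a c → a.workHead < s →
      ∀ b, Relation.ReflTransGen (fun c₁ c₂ => M.step x c₁ = some c₂) a b → b.workHead < s := by
    intro a ha
    induction ha using Relation.ReflTransGen.head_induction_on with
    | refl =>
      intro hw b hb
      rcases hb.cases_head with rfl | ⟨d, hd, -⟩
      · exact hw
      · rw [hc] at hd; exact absurd hd (by simp)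
    | head h1 _ ih =>
      intro hw b hb
      rcases hb.cases_head with rfl | ⟨d, hd, hb⟩
      · exact hw
      · rw [h1.1.1] at hd
        cases hd
        exact ih h1.2 b hb
  exact fun b hb => key _ h hs b hb

theorem Machine.RunLE.reached {M : Machine A B} {x : List A} {s : ℕ} {c : M.Cfg}
    (h : M.RunLE x s M.init c) : M.Reached x c :=
  Relation.ReflTransGen.mono (fun _ _ h => h.1.1) _ _ h

/-- The inequality says that the lowest `j` digits are all `1`, that is, that a carry arrives at
place `j`. With `carry_succ` this is the column-wise description of addition of one used by
`Sweep.succ`. -/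
theorem testBit_add_one (n j : ℕ) :
    (n + 1).testBit j = xor (decide (2 ^ j ≤ n % 2 ^ j + 1)) (n.testBit j) := by
  have hp : 0 < 2 ^ j := by positivity
  have h1 := Nat.div_add_mod n (2 ^ j)
  have h2 := Nat.mod_lt n hp
  rw [Nat.testBit_eq_decide_div_mod_eq, Nat.testBit_eq_decide_div_mod_eq]
  by_cases h : 2 ^ j ≤ n % 2 ^ j + 1
  · have h3 : (n + 1) / 2 ^ j = n / 2 ^ j + 1 := by
      have h4 : n + 1 = 2 ^ j * (n / 2 ^ j + 1) := by rw [mul_add]; omega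
      conv_lhs => rw [h4]
      exact Nat.mul_div_cancel_left _ hp
    rw [h3]
    simp only [h, decide_true, Bool.true_xor]
    rcases Nat.mod_two_eq_zero_or_one (n / 2 ^ j) with h4 | h4 <;> simp [Nat.add_mod, h4]
  · have h3 : (n + 1) / 2 ^ j = n / 2 ^ j := by
      have h4 : n + 1 = 2 ^ j * (n / 2 ^ j) + (n % 2 ^ j + 1) := by omega
      conv_lhs => rw [h4]
      rw [Nat.mul_add_div hp, Nat.div_eq_of_lt (not_le.mp h), add_zero]
    simp [h3, h]

theorem mod_two_pow_add_one (n j : ℕ) :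
    n % 2 ^ (j + 1) = n % 2 ^ j + 2 ^ j * (n.testBit j).toNat := by
  rw [Nat.toNat_testBit, Nat.mod_pow_succ]

theorem carry_succ (n j : ℕ) :
    decide (2 ^ (j + 1) ≤ n % 2 ^ (j + 1) + 1) =
      (decide (2 ^ j ≤ n % 2 ^ j + 1) && n.testBit j) := by
  rw [mod_two_pow_add_one, pow_succ]
  have h2 := Nat.mod_lt n (show 0 < 2 ^ j by positivity)
  cases n.testBit j <;> simp <;> omega

/-- The recursion behind the flag of `Sweep.lt`: the most significant place decides unless the
digits there agree. -/
theorem mod_lt_mod_succ (n m j : ℕ) :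
    decide (n % 2 ^ (j + 1) < m % 2 ^ (j + 1)) =
      if n.testBit j = m.testBit j then decide (n % 2 ^ j < m % 2 ^ j) else m.testBit j := by
  rw [mod_two_pow_add_one, mod_two_pow_add_one]
  have h1 := Nat.mod_lt n (show 0 < 2 ^ j by positivity)
  have h2 := Nat.mod_lt m (show 0 < 2 ^ j by positivity)
  cases n.testBit j <;> cases m.testBit j <;> simp <;> omega

/-- The `j`-th binary digits of the registers. -/
def digits (n : ℕ) (R : ℕ → ℕ) (j : ℕ) : Fin n → Bool := fun i => (R i).testBit j

theorem regTape_lt {n w j : ℕ} (R : ℕ → ℕ) (h : j < w) :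
    regTape n w R j = some (decide (j = 0), digits n R j) := if_pos h

theorem regTape_ge {n w j : ℕ} (R : ℕ → ℕ) (h : w ≤ j) : regTape n w R j = none :=
  if_neg (by omega)

/-- The configuration of the compiled machine for a stack and a store. -/
noncomputable def cfgOf (n : ℕ) (p : Stmt A B) (l : List (Stmt A B)) (st : Store B) (w : ℕ) :
    (compile n p).Cfg where
  state := (toControl p l, .ready)
  inHead := st.head
  tape := regTape n w st.regs
  workHead := 0
  out := st.out

/-- `f j` is the flag on arrival at cell `j`, and `w'` is the width afterwards. The run consists of
a pass to the right, the turn at the blank cell `w`, and the way back to cell `0`. The hypotheses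
reduce each register operation to identities for single columns. -/
theorem sweep_run {n : ℕ} {p : Stmt A B} {x : List A} {l : List (Stmt A B)} {s : Sweep n}
    {next : Bool → List (Stmt A B)} {R R' : ℕ → ℕ} {h : ℕ} {o : List B} {w w' sp : ℕ} (f : ℕ → Bool)
    (hl : l ∈ control p) (hi : instr n l = .sweep s next) (hw : 1 ≤ w) (hsp : w < sp)
    (h0 : f 0 = s.init) (hflag : ∀ j < w, f (j + 1) = s.flag (f j) (digits n R j))
    (hwrite : ∀ j < w, s.write (f j) (digits n R j) = digits n R' j)
    (hext : (s.extend (f w) = none ∧ w' = w) ∨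
      (s.extend (f w) = some (digits n R' w) ∧ w' = w + 1)) :
    (compile n p).RunLE x sp (cfgOf n p l ⟨R, h, o⟩ w) (cfgOf n p (next (f w)) ⟨R', h, o⟩ w') := by
  have hc := toControl_val hl
  -- The tape when the head moving right has reached cell `j`: the cells before it already hold the
  -- new digits.
  let mix : ℕ → ℕ → Column n := fun j i => if i < j then regTape n w R' i else regTape n w R i
  have right : ∀ j ≤ w, (compile n p).RunLE x sp (cfgOf n p l ⟨R, h, o⟩ w)
      ⟨(toControl p l, .right (f j)), h, mix j, j, o⟩ := by
    intro j
    induction j with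
    | zero =>
      intro _
      refine .single ⟨⟨?_, by simp only [cfgOf]; omega⟩, by simp only; omega⟩
      simp [Machine.step, cfgOf, compile, hc, hi, Move.onInput, Move.onWork, h0, mix]
    | succ j ih =>
      intro hj
      refine (ih (by omega)).tail ⟨⟨?_, by simp only; omega⟩, by simp only; omega⟩
      have hm : mix j j = some (decide (j = 0), digits n R j) := by
        simp only [mix, lt_irrefl, if_false]
        exact regTape_lt R hj
      simp only [Machine.step, compile, hc, hi, hm, Option.map_some, Option.some.injEq]
      simp only [Move.onInput, Move.onWork, hflag j hj, hwrite j hj, Option.toList_none,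
        List.append_nil, Machine.Cfg.mk.injEq, true_and, and_true]
      funext i
      by_cases hij : i = j
      · subst hij
        simp [mix, regTape_lt R' hj]
      · rw [Function.update_of_ne hij]
        simp only [mix]
        by_cases h' : i < j
        · rw [if_pos h', if_pos (by omega)]
        · rw [if_neg h', if_neg (by omega)]
  have turn : (compile n p).RunLE x sp (cfgOf n p l ⟨R, h, o⟩ w)
      ⟨(toControl p l, .left (f w)), h, regTape n w' R', w - 1, o⟩ := by
    refine (right w le_rfl).tail ⟨⟨?_, by simp only; omega⟩, by simp only; omega⟩
    have hm : mix w w = none := by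
      simp only [mix, lt_irrefl, if_false]
      exact regTape_ge R le_rfl
    simp only [Machine.step, compile, hc, hi, hm, Option.map_some, Option.some.injEq]
    simp only [Move.onInput, Move.onWork, Option.toList_none,
        List.append_nil, Machine.Cfg.mk.injEq, true_and, and_true]
    funext i
    by_cases hij : i = w
    · subst hij
      rw [Function.update_self]
      rcases hext with ⟨he, rfl⟩ | ⟨he, rfl⟩
      · rw [he, regTape_ge R' le_rfl]; rfl
      · rw [he, regTape_lt R' (Nat.lt_succ_self i)]
        simp [show i ≠ 0 by omega]
    · rw [Function.update_of_ne hij]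
      simp only [mix]
      by_cases h' : i < w
      · rw [if_pos h', regTape_lt _ h', regTape_lt]
        omega
      · rw [if_neg h', regTape_ge _ (by omega), regTape_ge]
        omega
  have left : ∀ j, j < w → (compile n p).RunLE x sp
      ⟨(toControl p l, .left (f w)), h, regTape n w' R', j, o⟩
      (cfgOf n p (next (f w)) ⟨R', h, o⟩ w') := by
    intro j
    induction j with
    | zero =>
      intro _
      refine .single ⟨⟨?_, by simp only; omega⟩, by simp only [cfgOf]; omega⟩
      simp [Machine.step, cfgOf, compile, hc, hi, Move.onInput, Move.onWork,
        regTape_lt R' (show 0 < w' by omega)]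
    | succ j ih =>
      intro hj
      refine Relation.ReflTransGen.head ⟨⟨?_, by simp only; omega⟩, ?_⟩ (ih (by omega))
      · have : regTape n w' R' (j + 1) = some (false, digits n R' (j + 1)) := by
          rw [regTape_lt R' (show j + 1 < w' by omega)]; simp
        simp only [Machine.step, compile, hc, hi, this, Option.map_some, Option.some.injEq]
        simp only [Move.onInput, Move.onWork, Option.toList_none,
          List.append_nil, Machine.Cfg.mk.injEq, true_and, and_true, Nat.add_sub_cancel]
        rw [← this, Function.update_eq_self]
      · simp only; omega
  exact turn.trans (left (w - 1) (by omega))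

/-- The digits of the registers below `n` fit into `w` cells. -/
def Fits (g w : ℕ) (R : ℕ → ℕ) : Prop := 1 ≤ w ∧ w ≤ Nat.log 2 g + 1 ∧ ∀ r, R r < 2 ^ w

theorem quick_run {n g : ℕ} {p : Stmt A B} {x : List A} {l : List (Stmt A B)} {m : Move}
    {e : Option B} {next : InSym A → List (Stmt A B)} {st : Store B} {w : ℕ} (hl : l ∈ control p)
    (hi : instr n l = .quick m e next) :
    (compile n p).RunLE x (Nat.log 2 g + 2) (cfgOf n p l st w)
      (cfgOf n p (next (inputSymbol x st.head))
        ⟨st.regs, m.onInput x.length st.head, st.out ++ e.toList⟩ w) := by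
  refine .single ⟨⟨?_, by simp [cfgOf]⟩, by simp [cfgOf]⟩
  simp [Machine.step, cfgOf, compile, toControl_val hl, hi, Move.onWork]

theorem colBit_digits {n r j : ℕ} {R : ℕ → ℕ} (h : r < n) :
    colBit (digits n R j) r = (R r).testBit j := by
  simp [colBit, h, digits]

/-- The flag sequence compares remainders modulo `2 ^ j`; at `j = w` these are the registers
themselves, as they fit into `w` digits. -/
theorem lt_run {n g : ℕ} {p : Stmt A B} {x : List A} {l : List (Stmt A B)} {r s : ℕ}
    {next : Bool → List (Stmt A B)} {st : Store B} {w : ℕ} (hl : l ∈ control p)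
    (hi : instr n l = .sweep (.lt n r s) next) (hr : r < n) (hs : s < n) (hw : Fits g w st.regs) :
    (compile n p).RunLE x (Nat.log 2 g + 2) (cfgOf n p l st w)
      (cfgOf n p (next (decide (st.regs r < st.regs s))) st w) := by
  have := sweep_run (x := x) (h := st.head) (o := st.out) (R := st.regs) (R' := st.regs) (w' := w)
    (sp := Nat.log 2 g + 2) (fun j => decide (st.regs r % 2 ^ j < st.regs s % 2 ^ j)) hl hi hw.1
    (by have := hw.2.1; omega) (by simp [Sweep.lt, Nat.mod_one])
    (fun j _ => by
      simp only [Sweep.lt, colBit_digits hr, colBit_digits hs]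
      exact mod_lt_mod_succ _ _ _)
    (fun _ _ => rfl) (Or.inl ⟨rfl, rfl⟩)
  simpa only [Nat.mod_eq_of_lt (hw.2.2 _)] using this

theorem zero_run {n g : ℕ} {p : Stmt A B} {x : List A} {l k : List (Stmt A B)} {r : ℕ}
    {st : Store B} {w : ℕ} (hl : l ∈ control p)
    (hi : instr n l = .sweep (.zero n r) fun _ => k) (hw : Fits g w st.regs) :
    (compile n p).RunLE x (Nat.log 2 g + 2) (cfgOf n p l st w)
      (cfgOf n p k { st with regs := Function.update st.regs r 0 } w) := by
  refine sweep_run (x := x) (h := st.head) (o := st.out) (R := st.regs) (w' := w)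
    (sp := Nat.log 2 g + 2) (fun _ => false) hl hi hw.1
    (by have := hw.2.1; omega) rfl (fun _ _ => rfl) (fun j _ => ?_) (Or.inl ⟨rfl, rfl⟩)
  funext i
  by_cases hir : i.1 = r <;> simp [Sweep.zero, digits, hir]

theorem succ_run {n g : ℕ} {p : Stmt A B} {x : List A} {l k : List (Stmt A B)} {r : ℕ}
    {st : Store B} {w : ℕ} (hl : l ∈ control p)
    (hi : instr n l = .sweep (.succ n r) fun _ => k) (hr : r < n) (hw : Fits g w st.regs)
    (hg : st.regs r + 1 ≤ g) :
    ∃ w', Fits g w' (Function.update st.regs r (st.regs r + 1)) ∧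
    (compile n p).RunLE x (Nat.log 2 g + 2) (cfgOf n p l st w)
      (cfgOf n p k { st with regs := Function.update st.regs r (st.regs r + 1) } w') := by
  have run := fun w' => sweep_run (x := x) (h := st.head) (o := st.out) (R := st.regs)
    (R' := Function.update st.regs r (st.regs r + 1)) (w' := w')
    (sp := Nat.log 2 g + 2) (fun j => decide (2 ^ j ≤ st.regs r % 2 ^ j + 1)) hl hi hw.1
    (by have := hw.2.1; omega) (by simp [Sweep.succ, Nat.mod_one])
    (fun j _ => by
      simp only [Sweep.succ, colBit_digits hr]
      exact carry_succ _ _)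
    (fun j _ => by
      funext i
      by_cases hir : i.1 = r
      · simp only [Sweep.succ, digits, hir, if_true, Function.update_self]
        exact (testBit_add_one _ _).symm
      · simp [Sweep.succ, digits, hir])
  have hmod : st.regs r % 2 ^ w = st.regs r := Nat.mod_eq_of_lt (hw.2.2 _)
  have hlt := hw.2.2 r
  by_cases hc : 2 ^ w ≤ st.regs r + 1
  · have he : st.regs r + 1 = 2 ^ w := by omega
    refine ⟨w + 1, ⟨by omega, ?_, fun i => ?_⟩, run _ (Or.inr ⟨?_, rfl⟩)⟩
    · have : w ≤ Nat.log 2 g := Nat.le_log_of_pow_le (by norm_num) (by omega)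
      omega
    · have := hw.2.2 i
      rw [pow_succ]
      by_cases hir : i = r
      · subst hir; rw [Function.update_self]; omega
      · rw [Function.update_of_ne hir]; omega
    · simp only [Sweep.succ, hmod, hc, decide_true, if_true, Option.some.injEq]
      funext i
      by_cases hir : i.1 = r
      · simp [hir, digits, he, Nat.testBit_two_pow_self]
      · simp [hir, digits, Nat.testBit_lt_two_pow (hw.2.2 i)]
  · refine ⟨w, ⟨hw.1, hw.2.1, fun i => ?_⟩, run _ (Or.inl ⟨?_, rfl⟩)⟩
    · by_cases hir : i = r
      · subst hir; rw [Function.update_self]; omega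
      · rw [Function.update_of_ne hir]; exact hw.2.2 i
    · simp [Sweep.succ, hmod]; omega

/-- The simulation invariant: the stack is a control state, and the tape holds the registers in some
fitting width. Only the registers after the step need to be bounded by `g`, since the fitting width
takes care of those before it. -/
theorem step_run {n g : ℕ} {p : Stmt A B} (hp : p.RegsBelow n) {x : List A}
    {l l' : List (Stmt A B)} {st st' : Store B} {w : ℕ} (hl : l ∈ control p)
    (h : rstep x (l, st) = some (l', st')) (hg : ∀ r, st'.regs r ≤ g) (hw : Fits g w st.regs) :
    l' ∈ control p ∧ ∃ w', Fits g w' st'.regs ∧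
      (compile n p).RunLE x (Nat.log 2 g + 2) (cfgOf n p l st w) (cfgOf n p l' st' w') := by
  have hb : ∀ q ∈ l, q.RegsBelow n := by
    rcases hl with rfl | hl
    · simp
    · exact regsBelow_of_mem_stacksOf hp (by simp) hl
  refine ⟨?_, ?_⟩
  · rcases hl with rfl | hl
    · simp [rstep] at h
    · exact stacksOf_closed x p [] hl h
  have quick : ∀ m e next, instr n l = .quick m e next → l' = next (inputSymbol x st.head) →
      st' = ⟨st.regs, m.onInput x.length st.head, st.out ++ e.toList⟩ → ∃ w', Fits g w' st'.regs ∧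
      (compile n p).RunLE x (Nat.log 2 g + 2) (cfgOf n p l st w) (cfgOf n p l' st' w') := by
    rintro m e next hi rfl rfl
    exact ⟨w, hw, quick_run hl hi⟩
  match l, h with
  | .skip :: k, h =>
    simp only [rstep, Option.some.injEq, Prod.mk.injEq] at h
    exact quick _ _ _ rfl h.1.symm (by rw [← h.2]; simp [Move.onInput])
  | .zero r :: k, h =>
    simp only [rstep, Option.some.injEq, Prod.mk.injEq] at h
    obtain ⟨rfl, rfl⟩ := h
    refine ⟨w, ⟨hw.1, hw.2.1, fun i => ?_⟩, zero_run hl rfl hw⟩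
    by_cases hir : i = r
    · simp [hir]
    · simpa [Function.update_of_ne hir] using hw.2.2 i
  | .succ r :: k, h =>
    simp only [rstep, Option.some.injEq, Prod.mk.injEq] at h
    obtain ⟨rfl, rfl⟩ := h
    exact succ_run hl rfl (hb (.succ r) (by simp)) hw (by simpa using hg r)
  | .move m :: k, h =>
    simp only [rstep, Option.some.injEq, Prod.mk.injEq] at h
    exact quick _ _ _ rfl h.1.symm (by rw [← h.2]; simp)
  | .emit b :: k, h =>
    simp only [rstep, Option.some.injEq, Prod.mk.injEq] at h
    exact quick _ _ _ rfl h.1.symm (by rw [← h.2]; simp [Move.onInput])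
  | .seq p q :: k, h =>
    simp only [rstep, Option.some.injEq, Prod.mk.injEq] at h
    exact quick _ _ _ rfl h.1.symm (by rw [← h.2]; simp [Move.onInput])
  | .ite (.sym S) p q :: k, h =>
    simp only [rstep, Option.some.injEq, Prod.mk.injEq] at h
    exact quick _ _ _ rfl h.1.symm (by rw [← h.2]; simp [Move.onInput])
  | .loop (.sym S) p :: k, h =>
    simp only [rstep, Option.some.injEq, Prod.mk.injEq] at h
    exact quick _ _ _ rfl h.1.symm (by rw [← h.2]; simp [Move.onInput])
  | .ite (.lt r s) p q :: k, h =>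
    simp only [rstep, Option.some.injEq, Prod.mk.injEq] at h
    obtain ⟨rfl, rfl⟩ := h
    have := (hb _ List.mem_cons_self).1
    exact ⟨w, hw, lt_run hl rfl this.1 this.2 hw⟩
  | .loop (.lt r s) p :: k, h =>
    simp only [rstep, Option.some.injEq, Prod.mk.injEq] at h
    obtain ⟨rfl, rfl⟩ := h
    have := (hb _ List.mem_cons_self).1
    exact ⟨w, hw, lt_run hl rfl this.1 this.2 hw⟩

/-- The store with which programs are started. -/
def Store.initial : Store B := ⟨fun _ => 0, 0, []⟩

theorem compile_run {n g : ℕ} {p : Stmt A B} (hp : p.RegsBelow n) {x : List A} {st : Store B}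
    (h : Does x g p .initial st) :
    ∃ c, (compile n p).RunLE x (Nat.log 2 g + 2) (compile n p).init c ∧
      (compile n p).step x c = none ∧ c.out = st.out := by
  have key : ∀ c, RRun x g ([p], .initial) c → c.1 ∈ control p ∧ ∃ w, Fits g w c.2.regs ∧
      (compile n p).RunLE x (Nat.log 2 g + 2) (compile n p).init (cfgOf n p c.1 c.2 w) := by
    intro c hc
    induction hc with
    | refl =>
      refine ⟨Or.inr (self_mem_stacksOf _ _), 1, ⟨le_rfl, by omega, by simp [Store.initial]⟩, ?_⟩
      -- The `start` phase writes the mark into cell `0`; the tape then represents registers that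
      -- are all zero, in width `1`.
      refine .single ⟨⟨?_, by simp [Machine.init]⟩, by simp [cfgOf]⟩
      simp only [Machine.step, compile, Machine.init, cfgOf, Store.initial, Option.map_some,
        Option.some.injEq, Machine.Cfg.mk.injEq, Move.onInput, Move.onWork, Option.toList_none,
        List.append_nil, true_and, and_true]
      funext j
      by_cases hj : j = 0
      · subst hj; simp [regTape]
      · rw [Function.update_of_ne hj, regTape_ge _ (by omega)]
    | tail _ h2 ih =>
      obtain ⟨hl, w, hw, hr⟩ := ih
      obtain ⟨hl', w', hw', hr'⟩ := step_run hp hl h2.1 h2.2 hw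
      exact ⟨hl', w', hw', hr.trans hr'⟩
  obtain ⟨-, w, -, hr⟩ := key _ (h [])
  refine ⟨_, hr, ?_, rfl⟩
  simp [Machine.step, cfgOf, compile, toControl_val (show [] ∈ control p from Or.inl rfl), instr]

end MFSearch
namespace MFSearch

/-! ### Functions computed within a space bound -/

/-- Bounds on the values of registers: polynomials in the length of the input for logarithmic
space (`b = false`), and their exponentials for polynomial space (`b = true`). -/
def bd : Bool → ℕ → ℕ → ℕ
  | false, c, n => (n + 2) ^ c
  | true, c, n => 2 ^ (n + 2) ^ c

theorem bd_mono (b : Bool) (n : ℕ) {c c' : ℕ} (h : c ≤ c') : bd b c n ≤ bd b c' n := by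
  have h1 : (n + 2) ^ c ≤ (n + 2) ^ c' := Nat.pow_le_pow_right (by omega) h
  cases b
  · exact h1
  · exact Nat.pow_le_pow_right (by omega) h1

/-- In the exponential case the exponents are added, and the sum of two powers of `n + 2 ≥ 2` is
absorbed by one more factor `n + 2`; hence the `+ 1`. -/
theorem bd_mul_le (b : Bool) (c c' n : ℕ) : bd b c n * bd b c' n ≤ bd b (c + c' + 1) n := by
  cases b
  · simp only [bd, ← pow_add]
    exact Nat.pow_le_pow_right (by omega) (by omega)
  · simp only [bd, ← pow_add]
    refine Nat.pow_le_pow_right (by omega) ?_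
    have h1 : (n + 2) ^ c ≤ (n + 2) ^ (c + c') := Nat.pow_le_pow_right (by omega) (by omega)
    have h2 : (n + 2) ^ c' ≤ (n + 2) ^ (c + c') := Nat.pow_le_pow_right (by omega) (by omega)
    rw [pow_succ]
    have h3 : 0 ≤ (n + 2) ^ (c + c') * n := Nat.zero_le _
    linarith [mul_add ((n + 2) ^ (c + c')) n 2]

theorem le_bd (b : Bool) (k n : ℕ) : k ≤ bd b k n := by
  have h1 : k ≤ (n + 2) ^ k := (Nat.lt_pow_self (by omega)).le
  cases b
  · exact h1
  · exact h1.trans (Nat.lt_pow_self (by omega)).le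

theorem length_le_bd (b : Bool) (n : ℕ) : n + 2 ≤ bd b 1 n := by
  cases b
  · simp [bd]
  · simpa [bd] using (Nat.lt_pow_self (a := 2) (n := n + 2) (by omega)).le

theorem bd_add_le (b : Bool) (c c' n : ℕ) : bd b c n + bd b c' n ≤ bd b (c + c' + 4) n := by
  have h1 := bd_mul_le b (c + c') 2 n
  have h2 := bd_mono b n (show c ≤ c + c' by omega)
  have h3 := bd_mono b n (show c' ≤ c + c' by omega)
  have h4 := bd_mono b n (show c + c' + 2 + 1 ≤ c + c' + 4 by omega)
  have h5 := le_bd b 2 n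
  nlinarith

/-! ### Contexts, size bounds, and what it means to be programmable within them. -/

/-- Contexts: an input word and finitely many numbers. -/
class Ctx (A : outParam Type) (σ : Type) where
  inp : σ → List A
  dim : ℕ
  val : σ → ℕ → ℕ

instance (A : Type) : Ctx A (List A) where
  inp x := x
  dim := 0
  val _ _ := 0

/-- The additional number is a loop counter, an accumulator or a bound variable: bodies of loops and
of bounded quantifiers are treated as functions on an enlarged context. -/
instance (A σ : Type) [Ctx A σ] : Ctx A (σ × ℕ) where
  inp s := Ctx.inp s.1
  dim := Ctx.dim σ + 1
  val s i := if i < Ctx.dim σ then Ctx.val s.1 i else s.2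

section
variable {A : Type} {σ τ : Type} [Ctx A σ] [Ctx A τ] {b : Bool}
open Ctx

/-- All numbers of the context are within the bound. -/
def Small (b : Bool) (c : ℕ) (s : σ) : Prop := ∀ i < dim σ, val s i ≤ bd b c (inp s).length

variable (σ) in
/-- Properties of contexts and register bounds that hold for small contexts and large bounds. -/
def lim (b : Bool) (c : ℕ) : Filter (σ × ℕ) where
  -- The exponent `c'` of the register bound may depend on `c`, but not on the context. Bundling
  -- this as a filter lets `filter_upwards` merge the bounds of several subprograms.
  sets := {S | ∃ c', ∀ s, Small b c s → ∀ g ≥ bd b c' (inp s).length, (s, g) ∈ S}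
  univ_sets := ⟨0, fun _ _ _ _ => trivial⟩
  sets_of_superset := fun ⟨c', h⟩ hST => ⟨c', fun s hs g hg => hST (h s hs g hg)⟩
  inter_sets := fun ⟨c₁, h₁⟩ ⟨c₂, h₂⟩ => ⟨max c₁ c₂, fun s hs g hg =>
    ⟨h₁ s hs g ((bd_mono b _ (le_max_left _ _)).trans hg),
      h₂ s hs g ((bd_mono b _ (le_max_right _ _)).trans hg)⟩⟩

/-- Functions whose values are within the bounds. -/
def Bdd (b : Bool) (F : σ → ℕ) : Prop :=
  ∀ c, ∃ c', ∀ s, Small b c s → F s ≤ bd b c' (inp s).length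

theorem Bdd.eventually {F : σ → ℕ} (h : Bdd b F) (c : ℕ) : ∀ᶠ q in lim σ b c, F q.1 ≤ q.2 := by
  obtain ⟨c', h⟩ := h c
  exact ⟨c', fun s hs g hg => (h s hs).trans hg⟩

theorem Bdd.mono {F G : σ → ℕ} (h : Bdd b G) (hFG : ∀ s, F s ≤ G s) : Bdd b F := fun c => by
  obtain ⟨c', h⟩ := h c
  exact ⟨c', fun s hs => (hFG s).trans (h s hs)⟩

theorem Bdd.add {F G : σ → ℕ} (hF : Bdd b F) (hG : Bdd b G) : Bdd b fun s => F s + G s :=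
  fun c => by
  obtain ⟨c₁, hF⟩ := hF c
  obtain ⟨c₂, hG⟩ := hG c
  exact ⟨_, fun s hs => (add_le_add (hF s hs) (hG s hs)).trans (bd_add_le _ _ _ _)⟩

theorem Bdd.mul {F G : σ → ℕ} (hF : Bdd b F) (hG : Bdd b G) : Bdd b fun s => F s * G s :=
  fun c => by
  obtain ⟨c₁, hF⟩ := hF c
  obtain ⟨c₂, hG⟩ := hG c
  exact ⟨_, fun s hs => (Nat.mul_le_mul (hF s hs) (hG s hs)).trans (bd_mul_le _ _ _ _)⟩

theorem Bdd.const (k : ℕ) : Bdd b fun _ : σ => k := fun _ => ⟨k, fun _ _ => le_bd _ _ _⟩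

theorem Bdd.length : Bdd b fun s : σ => (inp s).length :=
  fun _ => ⟨1, fun _ _ => (Nat.le_add_right _ 2).trans (length_le_bd _ _)⟩

theorem Bdd.two_pow_length : Bdd true fun s : σ => 2 ^ (inp s).length :=
  fun _ => ⟨1, fun _ _ => Nat.pow_le_pow_right (by omega) (by rw [pow_one]; omega)⟩

/-- The store holds the numbers of the context at the places `loc`, and registers are bounded. -/
def Ready {B : Type} (loc : ℕ → ℕ) (q : σ × ℕ) (st : Store B) : Prop :=
  (∀ i < dim σ, st.regs (loc i) = val q.1 i) ∧ ∀ r, st.regs r ≤ q.2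

/-- The change from `st` to `st'` does not concern registers below `e`, and outputs `o`. -/
structure Eff {B : Type} (e g : ℕ) (o : List B) (st st' : Store B) : Prop where
  keep : ∀ r < e, st'.regs r = st.regs r
  out : st'.out = st.out ++ o
  le : ∀ r, st'.regs r ≤ g

theorem Eff.trans {B : Type} {e e' g : ℕ} {o o' : List B} {st st' st'' : Store B}
    (h : Eff e g o st st') (h' : Eff e' g o' st' st'') (hle : e ≤ e') :
    Eff e g (o ++ o') st st'' where
  keep r hr := (h'.keep r (by omega)).trans (h.keep r hr)
  out := by rw [h'.out, h.out, List.append_assoc]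
  le := h'.le

theorem Eff.trans_nil {B : Type} {e e' g : ℕ} {st st' st'' : Store B}
    (h : Eff e g [] st st') (h' : Eff e' g [] st' st'') (hle : e ≤ e') :
    Eff e g [] st st'' := h.trans h' hle

theorem Eff.ready {B : Type} {loc : ℕ → ℕ} {e : ℕ} {q : σ × ℕ} {o : List B} {st st' : Store B}
    (hr : Ready loc q st) (hloc : ∀ i < dim σ, loc i < e) (h : Eff e q.2 o st st') :
    Ready loc q st' :=
  ⟨fun i hi => (h.keep _ (hloc i hi)).trans (hr.1 i hi), h.le⟩

theorem Eff.update {B : Type} {e g r v : ℕ} {st : Store B} (hg : ∀ r, st.regs r ≤ g) (hr : e ≤ r)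
    (hv : v ≤ g) : Eff e g [] st { st with regs := Function.update st.regs r v } where
  keep i hi := by simp [Function.update_of_ne (show i ≠ r by omega)]
  out := by simp
  le i := by
    by_cases hi : i = r
    · subst hi; simpa using hv
    · simpa [Function.update_of_ne hi] using hg i

/-- Functions of the context computed by a register program that respects the bounds. -/
def Cm (b : Bool) (F : σ → ℕ) : Prop :=
  ∀ (B : Type) (loc : ℕ → ℕ) (e : ℕ), (∀ i < dim σ, loc i < e) → ∃ p : Stmt A B, ∀ c,
    ∀ᶠ q in lim σ b c, ∀ st, Ready loc q st →
      ∃ st', Does (inp q.1) q.2 p st st' ∧ st'.regs e = F q.1 ∧ Eff e q.2 [] st st'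

/-- Words depending on the context that are output by a register program that respects the
bounds. -/
def Em {B : Type} (b : Bool) (F : σ → List B) : Prop :=
  ∀ (loc : ℕ → ℕ) (e : ℕ), (∀ i < dim σ, loc i < e) → ∃ p : Stmt A B, ∀ c,
    ∀ᶠ q in lim σ b c, ∀ st, Ready loc q st →
      ∃ st', Does (inp q.1) q.2 p st st' ∧ Eff e q.2 (F q.1) st st'

/-- The value appears in a register and registers never exceed `g`, so running the program with the
smallest admissible `g` bounds the value. -/
theorem Cm.bdd {F : σ → ℕ} (h : Cm b F) : Bdd b F := fun c => by
  obtain ⟨p, h⟩ := h Empty id (dim σ) (fun i hi => hi)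
  obtain ⟨c', h⟩ := h c
  refine ⟨max c c', fun s hs => ?_⟩
  -- The maximum with `c` makes room for the numbers of the context themselves, which occupy
  -- registers at the start.
  obtain ⟨st', -, h1, h2⟩ := h s hs _ (bd_mono b _ (le_max_right c c'))
    ⟨fun i => if i < dim σ then val s i else 0, 0, []⟩
    ⟨fun i hi => by simp [hi], fun i => by
      by_cases hi : i < dim σ
      · simpa [hi] using (hs i hi).trans (bd_mono b _ (le_max_left c c'))
      · simp [hi]⟩
  exact h1 ▸ h2.le _

/-- A single register bound serves for all values of the additional number up to a fixed bound; this
is what running through a loop requires. -/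
theorem eventually_prod {c : ℕ} (c₁ : ℕ) {P : (σ × ℕ) × ℕ → Prop}
    (h : ∀ᶠ q in lim (σ × ℕ) b (max c c₁), P q) :
    ∀ᶠ q in lim σ b c, ∀ k ≤ bd b c₁ (inp q.1).length, P ((q.1, k), q.2) := by
  obtain ⟨c', h⟩ := h
  refine ⟨c', fun s hs g hg k hk => h (s, k) (fun i hi => ?_) g hg⟩
  change (if i < dim σ then val s i else k) ≤ _
  split_ifs with hi'
  · exact (hs i hi').trans (bd_mono b _ (le_max_left c c₁))
  · exact hk.trans (bd_mono b _ (le_max_right c c₁))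

theorem Ready.prod {B : Type} {loc : ℕ → ℕ} {s : σ} {g k e : ℕ} {st : Store B}
    (h : Ready loc (s, g) st) (hk : st.regs e = k) :
    Ready (fun i => if i < dim σ then loc i else e) ((s, k), g) st := by
  refine ⟨fun i _ => ?_, h.2⟩
  change _ = if i < dim σ then val s i else k
  by_cases hi' : i < dim σ
  · simpa [hi'] using h.1 i hi'
  · simpa [hi'] using hk

section prim
variable {B : Type} {x : List A} {g : ℕ} {R : ℕ → ℕ} {h : ℕ} {o : List B}

theorem update_le {r v : ℕ} (hg : ∀ r, R r ≤ g) (hv : v ≤ g) :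
    ∀ i, Function.update R r v i ≤ g := fun i => by
  by_cases hi : i = r
  · subst hi; simpa using hv
  · simpa [Function.update_of_ne hi] using hg i

theorem does_zero (hg : ∀ r, R r ≤ g) (r : ℕ) :
    Does x g (.zero r) ⟨R, h, o⟩ ⟨Function.update R r 0, h, o⟩ :=
  .of_step (fun _ => rfl) (update_le hg (Nat.zero_le g))

theorem does_succ (hg : ∀ r, R r ≤ g) (r : ℕ) (hr : R r + 1 ≤ g) :
    Does x g (.succ r) ⟨R, h, o⟩ ⟨Function.update R r (R r + 1), h, o⟩ :=
  .of_step (fun _ => rfl) (update_le hg hr)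

theorem does_skip (hg : ∀ r, R r ≤ g) : Does x g (.skip : Stmt A B) ⟨R, h, o⟩ ⟨R, h, o⟩ :=
  .of_step (fun _ => rfl) hg

/-- Copying a register. -/
def copyStmt (A B : Type) (r s : ℕ) : Stmt A B := .seq (.zero r) (.loop (.lt r s) (.succ r))

theorem does_copy (hg : ∀ r, R r ≤ g) {r s : ℕ} (hrs : r ≠ s) :
    Does x g (copyStmt A B r s) ⟨R, h, o⟩ ⟨Function.update R r (R s), h, o⟩ := by
  have key : ∀ k v, v + k = R s → Does x g (.loop (.lt r s) (.succ r) : Stmt A B)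
      ⟨Function.update R r v, h, o⟩ ⟨Function.update R r (R s), h, o⟩ := by
    intro k
    have h1 := hg s
    induction k with
    | zero =>
      rintro v rfl
      refine Does.loop_false (update_le hg h1) ?_
      simp [RTest.eval, Function.update_of_ne hrs.symm]
    | succ k ih =>
      intro v hv
      have hb := update_le (r := r) (v := v) hg (by omega)
      refine Does.loop_true hb ?_ (does_succ hb r (by simp; omega)) ?_
      · simp [RTest.eval, Function.update_of_ne hrs.symm]; omega
      · simpa using ih (v + 1) (by omega)
  exact Does.seq hg (does_zero hg r) (key _ 0 (Nat.zero_add _))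

end prim

/-! ### Program constructions: constants, tests, access to the input, recursion, substitution. -/

theorem Cm.zero : Cm b fun _ : σ => 0 := fun B loc e _ => ⟨.zero e, fun c => by
  filter_upwards with q st hr
  exact ⟨_, does_zero hr.2 e, by simp, .update hr.2 le_rfl (Nat.zero_le _)⟩⟩

theorem Cm.val (i : ℕ) (hi : i < dim σ) : Cm b fun s : σ => val s i :=
  fun B loc e he => ⟨copyStmt A B e (loc i), fun c => by
  filter_upwards with q st hr
  exact ⟨_, does_copy hr.2 (he i hi).ne', by simpa using hr.1 i hi, .update hr.2 le_rfl (hr.2 _)⟩⟩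

theorem Cm.succ {F : σ → ℕ} (hF : Cm b F) : Cm b fun s => F s + 1 := by
  intro B loc e he
  obtain ⟨p, hp⟩ := hF B loc e he
  refine ⟨.seq p (.succ e), fun c => ?_⟩
  filter_upwards [hp c, (hF.bdd.add (Bdd.const 1)).eventually c] with q hq hb st hr
  obtain ⟨st', h1, h2, h3⟩ := hq st hr
  have hle : st'.regs e + 1 ≤ q.2 := h2 ▸ hb
  exact ⟨_, Does.seq hr.2 h1 (does_succ h3.le e hle), by simp [h2],
    h3.trans_nil (.update h3.le le_rfl hle) le_rfl⟩

theorem Cm.iteLt {F G H K : σ → ℕ} (hF : Cm b F) (hG : Cm b G) (hH : Cm b H) (hK : Cm b K) :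
    Cm b fun s => if F s < G s then H s else K s := by
  intro B loc e he
  have he' : ∀ i < dim σ, loc i < e + 1 := fun i hi => (he i hi).trans (Nat.lt_succ_self e)
  obtain ⟨p, hp⟩ := hF B loc e he
  obtain ⟨p', hp'⟩ := hG B loc (e + 1) he'
  obtain ⟨p₁, hp₁⟩ := hH B loc e he
  obtain ⟨p₂, hp₂⟩ := hK B loc e he
  refine ⟨.seq p (.seq p' (.ite (.lt e (e + 1)) p₁ p₂)), fun c => ?_⟩
  filter_upwards [hp c, hp' c, hp₁ c, hp₂ c] with q hq hq' hq₁ hq₂ st hr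
  obtain ⟨st', h1, h2, h3⟩ := hq st hr
  obtain ⟨st'', h1', h2', h3'⟩ := hq' st' (h3.ready hr he)
  have h4 := h3.trans_nil h3' (Nat.le_succ e)
  have hr'' := h4.ready hr he
  have hlt : (RTest.lt e (e + 1) : RTest A).eval (inp q.1) st'' = decide (F q.1 < G q.1) := by
    simp [RTest.eval, h2', h3'.keep e (Nat.lt_succ_self e), h2]
  by_cases h : F q.1 < G q.1
  · obtain ⟨st₁, h5, h6, h7⟩ := hq₁ st'' hr''
    refine ⟨st₁, h1.seq hr.2 (h1'.seq h3.le (h5.ite_true h3'.le ?_)), by simp [h6, h],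
      h4.trans_nil h7 le_rfl⟩
    simp [hlt, h]
  · obtain ⟨st₁, h5, h6, h7⟩ := hq₂ st'' hr''
    refine ⟨st₁, h1.seq hr.2 (h1'.seq h3.le (h5.ite_false h3'.le ?_)), by simp [h6, h],
      h4.trans_nil h7 le_rfl⟩
    simpa [hlt] using h

theorem Eff.head {B : Type} {e g h : ℕ} {st : Store B} (hg : ∀ r, st.regs r ≤ g) :
    Eff e g [] st { st with head := h } where
  keep _ _ := rfl
  out := by simp
  le := hg

/-- Moving the input head to the left end marker. -/
def rewindStmt (A B : Type) : Stmt A B :=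
  .loop (.sym fun a => match a with | .leftEnd => false | _ => true) (.move .left)

theorem does_rewind {B : Type} {x : List A} {g h : ℕ} {R : ℕ → ℕ} {o : List B}
    (hg : ∀ r, R r ≤ g) : Does x g (rewindStmt A B) ⟨R, h, o⟩ ⟨R, 0, o⟩ := by
  induction h with
  | zero => exact Does.loop_false hg rfl
  | succ h ih =>
    refine Does.loop_true (st' := ⟨R, h, o⟩) hg ?_ (.of_step (fun _ => rfl) hg) ih
    simp only [RTest.eval, inputSymbol]
    cases x[h]? <;> rfl

/-- Moving the input head to the cell given by register `r`, with an auxiliary register `t`. -/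
def seekStmt (A B : Type) (r t : ℕ) : Stmt A B :=
  .seq (rewindStmt A B) (.seq (.zero t) (.loop (.lt t r) (.seq (.move .right) (.succ t))))

theorem inputSymbol_min (x : List A) (i : ℕ) :
    inputSymbol x (min i (x.length + 1)) = inputSymbol x i := by
  rcases le_total i (x.length + 1) with h | h
  · rw [min_eq_left h]
  · rw [min_eq_right h]
    obtain ⟨j, rfl⟩ : ∃ j, i = j + 1 := ⟨i - 1, by omega⟩
    simp [inputSymbol, List.getElem?_eq_none (show x.length ≤ j by omega)]

/-- The head is rewound and then moved right as often as the register says. It stops at the right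
end marker, hence the `min`; by `inputSymbol_min` the symbol that is read does not depend on this
cut-off. -/
theorem does_seek {B : Type} {x : List A} {g h : ℕ} {R : ℕ → ℕ} {o : List B}
    (hg : ∀ r, R r ≤ g) {r t : ℕ} (hrt : t ≠ r) : Does x g (seekStmt A B r t) ⟨R, h, o⟩
      ⟨Function.update R t (R r), min (R r) (x.length + 1), o⟩ := by
  have key : ∀ k v, v + k = R r →
      Does x g (.loop (.lt t r) (.seq (.move .right) (.succ t)) : Stmt A B)
      ⟨Function.update R t v, min v (x.length + 1), o⟩
      ⟨Function.update R t (R r), min (R r) (x.length + 1), o⟩ := by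
    intro k
    have h1 := hg r
    induction k with
    | zero =>
      rintro v rfl
      refine Does.loop_false (update_le hg h1) ?_
      simp [RTest.eval, Function.update_of_ne hrt.symm]
    | succ k ih =>
      intro v hv
      have hb := update_le (r := t) (v := v) hg (by omega)
      have hmin : min (min v (x.length + 1) + 1) (x.length + 1) = min (v + 1) (x.length + 1) := by
        omega
      have hmove : Does x g (.move .right : Stmt A B)
          ⟨Function.update R t v, min v (x.length + 1), o⟩
          ⟨Function.update R t v, min (v + 1) (x.length + 1), o⟩ :=
        .of_step (fun k => by simp [rstep, Move.onInput, hmin]) hb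
      refine Does.loop_true hb ?_ (Does.seq hb hmove (does_succ hb t (by simp; omega))) ?_
      · simp [RTest.eval, Function.update_of_ne hrt.symm]; omega
      · simpa using ih (v + 1) (by omega)
  exact Does.seq hg (does_rewind hg) (Does.seq hg (does_zero hg t)
    (by simpa using key _ 0 (Nat.zero_add _)))

theorem Cm.iteSym (S : InSym A → Bool) {F H K : σ → ℕ} (hF : Cm b F) (hH : Cm b H)
    (hK : Cm b K) :
    Cm b fun s => if S (inputSymbol (inp s) (F s)) then H s else K s := by
  intro B loc e he
  obtain ⟨p, hp⟩ := hF B loc e he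
  obtain ⟨p₁, hp₁⟩ := hH B loc e he
  obtain ⟨p₂, hp₂⟩ := hK B loc e he
  refine ⟨.seq p (.seq (seekStmt A B e (e + 1)) (.ite (.sym S) p₁ p₂)), fun c => ?_⟩
  filter_upwards [hp c, hp₁ c, hp₂ c] with q hq hq₁ hq₂ st hr
  obtain ⟨st', h1, h2, h3⟩ := hq st hr
  have h1' := does_seek (x := inp q.1) (h := st'.head) (o := st'.out) h3.le (Nat.succ_ne_self e)
  have h3' : Eff e q.2 [] st'
      ⟨Function.update st'.regs (e + 1) (st'.regs e), min (st'.regs e) ((inp q.1).length + 1),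
        st'.out⟩ :=
    Eff.trans_nil (.update h3.le (Nat.le_succ e) (h3.le _)) (.head
      (Eff.update h3.le (Nat.le_succ e) (h3.le _)).le) le_rfl
  have h4 := h3.trans_nil h3' le_rfl
  have hr'' := h4.ready hr he
  have hs : (RTest.sym S).eval (inp q.1) (⟨Function.update st'.regs (e + 1) (st'.regs e),
      min (st'.regs e) ((inp q.1).length + 1), st'.out⟩ : Store B)
      = S (inputSymbol (inp q.1) (F q.1)) := by
    simp [RTest.eval, inputSymbol_min, h2]
  by_cases h : S (inputSymbol (inp q.1) (F q.1)) = true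
  · obtain ⟨st₁, h5, h6, h7⟩ := hq₁ _ hr''
    exact ⟨st₁, h1.seq hr.2 (h1'.seq h3.le (h5.ite_true h3'.le (hs.trans h))), by simp [h6, h],
      h4.trans_nil h7 le_rfl⟩
  · obtain ⟨st₁, h5, h6, h7⟩ := hq₂ _ hr''
    exact ⟨st₁, h1.seq hr.2 (h1'.seq h3.le (h5.ite_false h3'.le
      (hs.trans (Bool.eq_false_iff.mpr h)))), by simp [h6, h], h4.trans_nil h7 le_rfl⟩

theorem Cm.length : Cm b fun s : σ => (inp s).length := by
  intro B loc e he
  let S : InSym A → Bool := fun a => match a with | .rightEnd => false | _ => true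
  refine ⟨.seq (rewindStmt A B) (.seq (.zero e) (.seq (.move .right)
    (.loop (.sym S) (.seq (.move .right) (.succ e))))), fun c => ?_⟩
  filter_upwards [(Bdd.length (b := b)).eventually c] with q hlen st hr
  set n := (inp q.1).length with hn
  have hb : ∀ v ≤ n, ∀ r, Function.update st.regs e v r ≤ q.2 := fun v hv =>
    (Eff.update (e := 0) hr.2 (Nat.zero_le e) (hv.trans hlen)).le
  have key : ∀ k v, v + k = n → Does (inp q.1) q.2
      (.loop (.sym S) (.seq (.move .right) (.succ e)) : Stmt A B)
      ⟨Function.update st.regs e v, v + 1, st.out⟩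
      ⟨Function.update st.regs e n, n + 1, st.out⟩ := by
    intro k
    induction k with
    | zero =>
      rintro v rfl
      refine Does.loop_false (hb _ le_rfl) ?_
      simp [RTest.eval, inputSymbol, S, ← hn]
    | succ k ih =>
      intro v hv
      have h1 := hb v (by omega)
      have hmove : Does (inp q.1) q.2 (.move .right : Stmt A B)
          ⟨Function.update st.regs e v, v + 1, st.out⟩
          ⟨Function.update st.regs e v, v + 1 + 1, st.out⟩ :=
        .of_step (fun k => by
          simp only [rstep, Move.onInput, Option.some.injEq, Prod.mk.injEq, Store.mk.injEq,
            true_and, and_true]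
          omega) h1
      refine Does.loop_true h1 ?_ (Does.seq h1 hmove (does_succ h1 e (by simp; omega))) ?_
      · simp [RTest.eval, inputSymbol, S,
          List.getElem?_eq_getElem (show v < (inp q.1).length by omega)]
      · simpa using ih (v + 1) (by omega)
  have hmove : Does (inp q.1) q.2 (.move .right : Stmt A B)
      ⟨Function.update st.regs e 0, 0, st.out⟩ ⟨Function.update st.regs e 0, 0 + 1, st.out⟩ :=
    .of_step (fun k => by simp [rstep, Move.onInput]) (hb 0 (Nat.zero_le _))
  refine ⟨_, Does.seq hr.2 (does_rewind hr.2) (Does.seq hr.2 (does_zero hr.2 e)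
    (Does.seq (hb 0 (Nat.zero_le _)) hmove (key n 0 (by omega)))), by simp [hn], ?_⟩
  exact Eff.trans_nil (.update hr.2 le_rfl hlen) (.head (hb n le_rfl)) le_rfl

/-- Bounded recursion. -/
theorem Cm.iter {N I : σ → ℕ} {G : σ → ℕ → ℕ → ℕ} {M : σ → ℕ} (hN : Cm b N) (hI : Cm b I)
    (hG : Cm b fun q : (σ × ℕ) × ℕ => G q.1.1 q.1.2 q.2) (hM : Bdd b M)
    (hle : ∀ s, ∀ i ≤ N s, Nat.rec (I s) (G s) i ≤ M s) :
    Cm b fun s => (Nat.rec (I s) (G s) (N s) : ℕ) := by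
  intro B loc e he
  have he1 : ∀ i < dim σ, loc i < e + 1 := fun i hi => (he i hi).trans (by omega)
  -- Layout of the registers: the accumulator in `e`, the number of rounds in `e + 1`, the round
  -- counter in `e + 2`; the program for `G` works from `e + 3` on.
  let loc1 : ℕ → ℕ := fun i => if i < dim σ then loc i else e + 2
  let loc2 : ℕ → ℕ := fun i => if i < dim (σ × ℕ) then loc1 i else e
  have he3 : ∀ i < dim ((σ × ℕ) × ℕ), loc2 i < e + 3 := by
    intro i hi
    simp only [loc2, loc1]
    split_ifs with h1 h2
    · exact (he i h2).trans (by omega)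
    · omega
    · omega
  obtain ⟨p₀, hp₀⟩ := hI B loc e he
  obtain ⟨p₁, hp₁⟩ := hN B loc (e + 1) he1
  obtain ⟨p₂, hp₂⟩ := hG B loc2 (e + 3) he3
  refine ⟨.seq p₀ (.seq p₁ (.seq (.zero (e + 2)) (.loop (.lt (e + 2) (e + 1)) (.seq p₂
    (.seq (copyStmt A B e (e + 3)) (.succ (e + 2))))))), fun c => ?_⟩
  obtain ⟨cN, hcN⟩ := hN.bdd c
  obtain ⟨cM, hcM⟩ := hM c
  have hsmall : ∀ᶠ q in lim σ b c, N q.1 ≤ bd b cN (inp q.1).length ∧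
      M q.1 ≤ bd b cM (inp q.1).length := ⟨0, fun s hs _ _ => ⟨hcN s hs, hcM s hs⟩⟩
  filter_upwards [hp₀ c, hp₁ c, eventually_prod cN (eventually_prod cM (hp₂ _)),
    hN.bdd.eventually c, hsmall] with q hq₀ hq₁ hq₂ hNg hsm st hr
  obtain ⟨st₀, d₀, v₀, f₀⟩ := hq₀ st hr
  obtain ⟨st₁, d₁, v₁, f₁⟩ := hq₁ st₀ (f₀.ready hr he)
  have f01 := f₀.trans_nil f₁ (Nat.le_succ e)
  have key : ∀ k v, v + k = N q.1 → ∀ st', Eff e q.2 [] st st' → st'.regs (e + 2) = v →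
      st'.regs (e + 1) = N q.1 → st'.regs e = Nat.rec (I q.1) (G q.1) v →
      ∃ st'', Does (inp q.1) q.2 (.loop (.lt (e + 2) (e + 1)) (.seq p₂
        (.seq (copyStmt A B e (e + 3)) (.succ (e + 2))))) st' st'' ∧
        st''.regs e = Nat.rec (I q.1) (G q.1) (N q.1) ∧ Eff e q.2 [] st st'' := by
    intro k
    induction k with
    | zero =>
      rintro v hv st' f h2 h1 h0
      obtain rfl : v = N q.1 := by omega
      exact ⟨st', Does.loop_false f.le (by simp [RTest.eval, h2, h1]), h0, f⟩
    | succ k ih =>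
      intro v hv st' f h2 h1 h0
      have hrdy := ((f.ready hr he).prod h2).prod h0
      -- The bound `M` on the intermediate values is used here: the program for `G` is only known to
      -- work on contexts within given bounds.
      obtain ⟨st2, d2, v2, f2⟩ := hq₂ v (by omega) _ ((hle _ v (by omega)).trans hsm.2) st' hrdy
      have d3 := does_copy (x := inp q.1) (h := st2.head) (o := st2.out) f2.le
        (show e ≠ e + 3 by omega)
      have f3 := Eff.update f2.le (le_refl e) (f2.le (e + 3))
      have hv2 : Function.update st2.regs e (st2.regs (e + 3)) (e + 2) = v := by
        rw [Function.update_of_ne (by omega), f2.keep _ (by omega), h2]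
      have hg4 : Function.update st2.regs e (st2.regs (e + 3)) (e + 2) + 1 ≤ q.2 := by
        rw [hv2]; omega
      have d4 := does_succ (x := inp q.1) (h := st2.head) (o := st2.out) f3.le (e + 2) hg4
      have f4 := Eff.update (e := e) f3.le (show e ≤ e + 2 by omega) hg4
      obtain ⟨st'', d5, v5, f5⟩ := ih (v + 1) (by omega) _
        (((f.trans_nil f2 (by omega)).trans_nil f3 le_rfl).trans_nil f4 le_rfl)
        (by simp only [Function.update_self]; rw [hv2])
        (by
          simp only
          rw [Function.update_of_ne (by omega), Function.update_of_ne (by omega),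
            f2.keep _ (by omega), h1])
        (by
          simp only
          rw [Function.update_of_ne (by omega), Function.update_self, v2])
      exact ⟨st'', Does.loop_true f.le (by simp [RTest.eval, h2, h1]; omega)
        (d2.seq f.le (d3.seq f2.le d4)) d5, v5, f5⟩
  have d2 := does_zero (x := inp q.1) (h := st₁.head) (o := st₁.out) f₁.le (e + 2)
  have f2 := Eff.update (e := e) f₁.le (show e ≤ e + 2 by omega) (Nat.zero_le _)
  obtain ⟨st'', d3, v3, f3⟩ := key (N q.1) 0 (by omega) _ (f01.trans_nil f2 le_rfl) (by simp)
    (by simp only; rw [Function.update_of_ne (by omega), v₁])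
    (by
      change _ = I q.1
      simp only
      rw [Function.update_of_ne (by omega), f₁.keep e (by omega), v₀])
  exact ⟨st'', d₀.seq hr.2 (d₁.seq f₀.le (d2.seq f₁.le d3)), v3, f3⟩

/-- Substitution. -/
theorem Cm.comp {F : σ → ℕ} (hF : Cm b F) {π : τ → σ} (hinp : ∀ t, inp (π t) = inp t)
    (hπ : ∀ i < dim σ, Cm b fun t => Ctx.val (π t) i) : Cm b fun t => F (π t) := by
  intro B loc e he
  -- The numbers of the context `π t` are computed one after the other into the registers `e`, `e +
  -- 1`, and so on, where `F` will look for them.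
  have pre : ∀ j ≤ dim σ, ∃ p : Stmt A B, ∀ c, ∀ᶠ q in lim τ b c, ∀ st, Ready loc q st →
      ∃ st', Does (inp q.1) q.2 p st st' ∧ (∀ i < j, st'.regs (e + i) = Ctx.val (π q.1) i) ∧
        Eff e q.2 [] st st' := by
    intro j
    induction j with
    | zero =>
      refine fun _ => ⟨.skip, fun c => ?_⟩
      filter_upwards with q st hr
      exact ⟨st, does_skip hr.2, by simp, fun _ _ => rfl, by simp, hr.2⟩
    | succ j ih =>
      intro hj
      obtain ⟨p, hp⟩ := ih (by omega)
      obtain ⟨p', hp'⟩ := hπ j (by omega) B loc (e + j) (fun i hi => (he i hi).trans_le (by omega))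
      refine ⟨.seq p p', fun c => ?_⟩
      filter_upwards [hp c, hp' c] with q hq hq' st hr
      obtain ⟨st', h1, h2, h3⟩ := hq st hr
      obtain ⟨st'', h1', h2', h3'⟩ := hq' st' (h3.ready hr he)
      refine ⟨st'', h1.seq hr.2 h1', fun i hi => ?_, h3.trans_nil h3' (by omega)⟩
      rcases Nat.lt_succ_iff_lt_or_eq.mp hi with hi | rfl
      · rw [h3'.keep _ (by omega), h2 i hi]
      · exact h2'
  obtain ⟨p, hp⟩ := pre (dim σ) le_rfl
  obtain ⟨p', hp'⟩ := hF B (fun i => e + i) (e + dim σ) (fun i hi => by omega)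
  -- The result arises in register `e + dim σ`. If there are no numbers, this already is register
  -- `e`, and `does_copy` does not cover copying a register to itself.
  refine ⟨.seq p (.seq p' (if dim σ = 0 then .skip else copyStmt A B e (e + dim σ))),
    fun c => ?_⟩
  have hB : ∀ j ≤ dim σ, ∃ c', ∀ t, Small b c t → ∀ i < j,
      Ctx.val (π t) i ≤ bd b c' (inp t).length := by
    intro j
    induction j with
    | zero => exact fun _ => ⟨0, by simp⟩
    | succ j ih =>
      intro hj
      obtain ⟨c₁, h₁⟩ := ih (by omega)
      obtain ⟨c₂, h₂⟩ := (hπ j (by omega)).bdd c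
      refine ⟨max c₁ c₂, fun t ht i hi => ?_⟩
      rcases Nat.lt_succ_iff_lt_or_eq.mp hi with hi | rfl
      · exact (h₁ t ht i hi).trans (bd_mono b _ (le_max_left _ _))
      · exact (h₂ t ht).trans (bd_mono b _ (le_max_right _ _))
  obtain ⟨c', hc'⟩ := hB (dim σ) le_rfl
  have hq' : ∀ᶠ q in lim τ b c, ∀ st, Ready (fun i => e + i) (π q.1, q.2) st →
      ∃ st', Does (inp (π q.1)) q.2 p' st st' ∧ st'.regs (e + dim σ) = F (π q.1) ∧
        Eff (e + dim σ) q.2 [] st st' := by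
    obtain ⟨c'', h⟩ := hp' c'
    refine ⟨c'', fun t ht g hg => ?_⟩
    rw [← hinp t] at hg
    exact h (π t) (fun i hi => by rw [hinp t]; exact hc' t ht i hi) g hg
  filter_upwards [hp c, hq'] with q hq hq' st hr
  obtain ⟨st', d1, v1, f1⟩ := hq st hr
  obtain ⟨st'', d2, v2, f2⟩ := hq' st' ⟨v1, f1.le⟩
  rw [hinp] at d2
  by_cases hd : dim σ = 0
  · exact ⟨st'', d1.seq hr.2 (d2.seq f1.le (by rw [if_pos hd]; exact does_skip f2.le)),
      by simpa [hd] using v2,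
      f1.trans_nil f2 (by omega)⟩
  · exact ⟨_, d1.seq hr.2 (d2.seq f1.le (by
        rw [if_neg hd]; exact does_copy f2.le (by omega))), by simpa using v2,
      (f1.trans_nil f2 (by omega)).trans_nil (.update f2.le le_rfl (f2.le _)) le_rfl⟩

end
end MFSearch
-- Closure properties: arithmetic, bounded quantifiers, finite case distinctions, output.
namespace MFSearch

section
variable {A : Type} {σ τ : Type} [Ctx A σ] [Ctx A τ] {b : Bool}
open Ctx

theorem Cm.congr {F G : σ → ℕ} (h : Cm b F) (hFG : ∀ s, G s = F s) : Cm b G := by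
  rwa [show G = F from funext hFG]

theorem Cm.snd : Cm b fun s : σ × ℕ => s.2 :=
  (Cm.val (σ := σ × ℕ) (dim σ) (Nat.lt_succ_self _)).congr fun s => by
    simp [Ctx.val]

theorem Cm.fst {F : σ → ℕ} (hF : Cm b F) : Cm b fun s : σ × ℕ => F s.1 :=
  hF.comp (π := Prod.fst) (fun _ => rfl) fun i hi =>
    (Cm.val (σ := σ × ℕ) i (Nat.lt_succ_of_lt hi)).congr fun s => by
      simp [Ctx.val, hi]

theorem Cm.const (k : ℕ) : Cm b fun _ : σ => k := by
  induction k with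
  | zero => exact Cm.zero
  | succ k ih => exact ih.succ

theorem Cm.add {F G : σ → ℕ} (hF : Cm b F) (hG : Cm b G) : Cm b fun s => F s + G s := by
  have h : ∀ s i, (Nat.rec (F s) (fun _ a => a + 1) i : ℕ) = F s + i := by
    intro s i
    induction i with
    | zero => rfl
    | succ i ih => simp only [ih]; rfl
  exact (Cm.iter (G := fun _ _ a => a + 1) hG hF Cm.snd.succ (hF.bdd.add hG.bdd) fun s i hi => by
    rw [h]; omega).congr fun s => (h s _).symm

theorem Cm.mul {F G : σ → ℕ} (hF : Cm b F) (hG : Cm b G) : Cm b fun s => F s * G s := by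
  have h : ∀ s i, (Nat.rec 0 (fun _ a => a + F s) i : ℕ) = F s * i := by
    intro s i
    induction i with
    | zero => rfl
    | succ i ih => simp only [ih]; rfl
  exact (Cm.iter (G := fun s _ a => a + F s) hG Cm.zero (Cm.snd.add hF.fst.fst)
    (hF.bdd.mul hG.bdd) fun s i hi => by
      rw [h]; exact Nat.mul_le_mul_left _ hi).congr fun s => (h s _).symm

/-- The recursion forgets its accumulator and returns its index, which in the last round is the
predecessor. -/
theorem Cm.pred {F : σ → ℕ} (hF : Cm b F) : Cm b fun s => F s - 1 := by
  have h : ∀ i, (Nat.rec 0 (fun j _ => j) i : ℕ) = i - 1 := by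
    intro i; cases i <;> rfl
  exact (Cm.iter (G := fun _ j _ => j) hF Cm.zero Cm.snd.fst hF.bdd fun s i hi => by
    rw [h]; omega).congr fun s => (h _).symm

theorem Cm.sub {F G : σ → ℕ} (hF : Cm b F) (hG : Cm b G) : Cm b fun s => F s - G s := by
  have h : ∀ s i, (Nat.rec (F s) (fun _ a => a - 1) i : ℕ) = F s - i := by
    intro s i
    induction i with
    | zero => rfl
    | succ i ih => simp only [ih]; rfl
  exact (Cm.iter (G := fun _ _ a => a - 1) hG hF Cm.snd.pred hF.bdd fun s i hi => by
    rw [h]; omega).congr fun s => (h s _).symm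

theorem Cm.pow_const {F : σ → ℕ} (hF : Cm b F) (k : ℕ) : Cm b fun s => F s ^ k := by
  induction k with
  | zero => exact Cm.const 1
  | succ k ih => exact ih.mul hF

open Classical in
/-- The truth value of a proposition as a number. -/
noncomputable def ind (p : Prop) : ℕ := if p then 1 else 0

/-- Properties of the context decided by a register program that respects the bounds. -/
def CmP (b : Bool) (P : σ → Prop) : Prop := Cm b fun s => ind (P s)

theorem ind_le (p : Prop) : ind p ≤ 1 := by
  unfold ind; split_ifs <;> omega

theorem CmP.congr {P Q : σ → Prop} (h : CmP b P) (hPQ : ∀ s, Q s ↔ P s) : CmP b Q := by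
  rwa [show Q = P from funext fun s => propext (hPQ s)]

theorem Cm.ite {P : σ → Prop} [∀ s, Decidable (P s)] (hP : CmP b P) {F G : σ → ℕ} (hF : Cm b F)
    (hG : Cm b G) : Cm b fun s => if P s then F s else G s :=
  (Cm.iteLt Cm.zero hP hF hG).congr fun s => by
    by_cases h : P s <;> simp [ind, h]

theorem CmP.of_lt {F G : σ → ℕ} (hF : Cm b F) (hG : Cm b G) : CmP b fun s => F s < G s :=
  (Cm.iteLt hF hG (Cm.const 1) (Cm.const 0)).congr fun s => by
    simp [ind]

theorem CmP.ite {P Q R : σ → Prop} (hP : CmP b P) (hQ : CmP b Q) (hR : CmP b R) :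
    CmP b fun s => (P s → Q s) ∧ (¬ P s → R s) := by
  classical
  exact (Cm.ite hP hQ hR).congr fun s => by by_cases h : P s <;> simp [h]

theorem CmP.const (p : Prop) : CmP b fun _ : σ => p := Cm.const _

theorem CmP.not {P : σ → Prop} (hP : CmP b P) : CmP b fun s => ¬ P s :=
  (CmP.ite hP (.const False) (.const True)).congr fun s => by tauto

theorem CmP.and {P Q : σ → Prop} (hP : CmP b P) (hQ : CmP b Q) : CmP b fun s => P s ∧ Q s :=
  (CmP.ite hP hQ (.const False)).congr fun s => by tauto

theorem CmP.or {P Q : σ → Prop} (hP : CmP b P) (hQ : CmP b Q) : CmP b fun s => P s ∨ Q s :=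
  (CmP.ite hP (.const True) hQ).congr fun s => by tauto

theorem CmP.imp {P Q : σ → Prop} (hP : CmP b P) (hQ : CmP b Q) : CmP b fun s => P s → Q s :=
  (CmP.ite hP hQ (.const True)).congr fun s => by tauto

theorem CmP.iff {P Q : σ → Prop} (hP : CmP b P) (hQ : CmP b Q) : CmP b fun s => P s ↔ Q s :=
  (CmP.ite hP hQ hQ.not).congr fun s => by tauto

theorem CmP.of_le {F G : σ → ℕ} (hF : Cm b F) (hG : Cm b G) : CmP b fun s => F s ≤ G s :=
  (CmP.of_lt hG hF).not.congr fun s => by simp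

theorem CmP.of_eq {F G : σ → ℕ} (hF : Cm b F) (hG : Cm b G) : CmP b fun s => F s = G s :=
  ((CmP.of_le hF hG).and (CmP.of_le hG hF)).congr fun s => by omega

theorem CmP.fst {P : σ → Prop} (hP : CmP b P) : CmP b fun s : σ × ℕ => P s.1 :=
  Cm.fst (F := fun s => ind (P s)) hP

theorem CmP.ball {N : σ → ℕ} {P : σ → ℕ → Prop} (hN : Cm b N)
    (hP : CmP b fun q : σ × ℕ => P q.1 q.2) : CmP b fun s => ∀ i < N s, P s i := by
  classical
  have h : ∀ s n, (Nat.rec 1 (fun i a => if P s i then a else 0) n : ℕ) =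
      ind (∀ i < n, P s i) := by
    intro s n
    induction n with
    | zero => simp [ind]
    | succ n ih =>
      simp only [ih, ind, Nat.lt_succ_iff_lt_or_eq, or_imp, forall_and, forall_eq]
      by_cases h1 : P s n <;> simp [h1]
  exact (Cm.iter (G := fun s i a => if P s i then a else 0) hN (Cm.const 1)
    (Cm.ite (P := fun q : (σ × ℕ) × ℕ => P q.1.1 q.1.2) (CmP.fst hP) Cm.snd Cm.zero) (Bdd.const 1)
    fun s i hi => by
      rw [h]; exact ind_le _).congr fun s => (h s _).symm

theorem CmP.bex {N : σ → ℕ} {P : σ → ℕ → Prop} (hN : Cm b N)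
    (hP : CmP b fun q : σ × ℕ => P q.1 q.2) : CmP b fun s => ∃ i < N s, P s i :=
  (CmP.ball (P := fun s i => ¬ P s i) hN hP.not).not.congr fun s => by simp

theorem Cm.findGreatest {N : σ → ℕ} {P : σ → ℕ → Prop} [∀ s, DecidablePred (P s)] (hN : Cm b N)
    (hP : CmP b fun q : σ × ℕ => P q.1 q.2) : Cm b fun s => Nat.findGreatest (P s) (N s) := by
  have h : ∀ s n, (Nat.rec 0 (fun i a => if P s (i + 1) then i + 1 else a) n : ℕ) =
      Nat.findGreatest (P s) n := by
    intro s n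
    induction n with
    | zero => rfl
    | succ n ih => simp only [ih, Nat.findGreatest]
  have hP' : CmP b fun q : (σ × ℕ) × ℕ => P q.1.1 (q.1.2 + 1) :=
    Cm.comp (π := fun q : (σ × ℕ) × ℕ => (q.1.1, q.1.2 + 1)) hP (fun _ => rfl) fun i hi => by
      rcases Nat.lt_succ_iff_lt_or_eq.mp hi with h | rfl
      · exact (Cm.val (σ := σ) i h).fst.fst.congr fun s => by simp [Ctx.val, h]
      · exact Cm.snd.fst.succ.congr fun s => by simp [Ctx.val]
  exact (Cm.iter (G := fun s i a => if P s (i + 1) then i + 1 else a) hN Cm.zero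
    (Cm.ite hP' Cm.snd.fst.succ Cm.snd) hN.bdd fun s i hi => by
      rw [h]; exact (Nat.findGreatest_le _).trans hi).congr fun s => (h s _).symm

theorem Cm.div {F G : σ → ℕ} (hF : Cm b F) (hG : Cm b G) : Cm b fun s => F s / G s := by
  classical
  refine (Cm.ite (CmP.of_eq hG Cm.zero) Cm.zero (Cm.findGreatest
    (P := fun s k => k * G s ≤ F s) hF (.of_le (Cm.snd.mul hG.fst) hF.fst))).congr fun s => ?_
  split_ifs with h
  · simp [h]
  · have hpos : 0 < G s := Nat.pos_of_ne_zero h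
    symm
    rw [Nat.findGreatest_eq_iff]
    refine ⟨Nat.div_le_self _ _, fun _ => Nat.div_mul_le_self _ _, fun k hk _ => ?_⟩
    rw [Nat.div_lt_iff_lt_mul hpos] at hk
    omega

theorem Cm.mod {F G : σ → ℕ} (hF : Cm b F) (hG : Cm b G) : Cm b fun s => F s % G s :=
  (hF.sub (hG.mul (hF.div hG))).congr fun _ => Nat.mod_eq_sub _ _

theorem Cm.shiftRight {F G : σ → ℕ} (hF : Cm b F) (hG : Cm b G) :
    Cm b fun s => F s / 2 ^ G s := by
  have h : ∀ s n, (Nat.rec (F s) (fun _ a => a / 2) n : ℕ) = F s / 2 ^ n := by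
    intro s n
    induction n with
    | zero => simp
    | succ n ih => simp only [ih, pow_succ, Nat.div_div_eq_div_mul]
  exact (Cm.iter (G := fun _ _ a => a / 2) hG hF (Cm.snd.div (Cm.const 2)) hF.bdd
    fun s i hi => by rw [h]; exact Nat.div_le_self _ _).congr fun s => (h s _).symm

theorem CmP.testBit {F G : σ → ℕ} (hF : Cm b F) (hG : Cm b G) :
    CmP b fun s => (F s).testBit (G s) = true :=
  (CmP.of_eq ((hF.shiftRight hG).mod (Cm.const 2)) (Cm.const 1)).congr fun s => by
    simp [Nat.testBit_eq_decide_div_mod_eq]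

theorem Cm.min {F G : σ → ℕ} (hF : Cm b F) (hG : Cm b G) : Cm b fun s => min (F s) (G s) :=
  (Cm.ite (CmP.of_lt hF hG) hF hG).congr fun s => by
    split_ifs <;> omega

/-- The exponent is cut off at the length of the input, because a power with an arbitrary number of
the context as exponent could leave even the exponential bounds. -/
theorem Cm.two_pow {F : σ → ℕ} (hF : Cm true F) :
    Cm true fun s => 2 ^ Min.min (F s) (Ctx.inp s).length := by
  have h : ∀ n, (Nat.rec 1 (fun _ a => a + a) n : ℕ) = 2 ^ n := by
    intro n
    induction n with
    | zero => rfl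
    | succ n ih => simp only [ih]; omega
  exact (Cm.iter (G := fun _ _ a => a + a) (hF.min Cm.length) (Cm.const 1) (Cm.snd.add Cm.snd)
    Bdd.two_pow_length fun s i hi => by
      rw [h]; exact Nat.pow_le_pow_right (by omega) (by omega)).congr fun s => (h _).symm

/-- Functions with values in a finite type that are computed by register programs. -/
def CmF {α : Type} (b : Bool) (F : σ → α) : Prop := ∀ a, CmP b fun s => F s = a

/-- The program is a chain of tests through the finitely many possible values. -/
theorem CmF.cases {α : Type} [Finite α] {F : σ → α} (hF : CmF b F) {G : α → σ → ℕ}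
    (hG : ∀ a, Cm b (G a)) : Cm b fun s => G (F s) s := by
  classical
  have := Fintype.ofFinite α
  have key : ∀ l : List α, Cm b fun s => if F s ∈ l then G (F s) s else 0 := by
    intro l
    induction l with
    | nil => simpa using Cm.zero
    | cons a l ih =>
      refine (Cm.ite (hF a) (hG a) ih).congr fun s => ?_
      by_cases h : F s = a
      · subst h; simp
      · simp [h]
  exact (key Finset.univ.toList).congr fun s => by simp

theorem CmP.cases {α : Type} [Finite α] {F : σ → α} (hF : CmF b F) {P : α → σ → Prop}
    (hP : ∀ a, CmP b (P a)) : CmP b fun s => P (F s) s :=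
  CmF.cases (G := fun a s => ind (P a s)) hF hP

theorem CmF.map {α β : Type} [Finite α] {F : σ → α} (hF : CmF b F) (f : α → β) :
    CmF b fun s => f (F s) := fun c => CmP.cases (P := fun a _ => f a = c) hF fun _ => .const _

theorem CmF.pair {α β : Type} {F : σ → α} {G : σ → β} (hF : CmF b F) (hG : CmF b G) :
    CmF b fun s => (F s, G s) := fun c => ((hF c.1).and (hG c.2)).congr fun s => by
  rw [Prod.ext_iff]

theorem CmF.const {α : Type} (a : α) : CmF b fun _ : σ => a := fun _ => .const _

theorem CmF.ite {α : Type} {P : σ → Prop} [∀ s, Decidable (P s)] (hP : CmP b P) {F G : σ → α}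
    (hF : CmF b F) (hG : CmF b G) : CmF b fun s => if P s then F s else G s := fun a =>
  (CmP.ite hP (hF a) (hG a)).congr fun s => by by_cases h : P s <;> simp [h]

theorem CmF.symbol {F : σ → ℕ} (hF : Cm b F) : CmF b fun s => inputSymbol (Ctx.inp s) (F s) := by
  classical
  exact fun a => (Cm.iteSym (fun a' => decide (a' = a)) hF (Cm.const 1) (Cm.const 0)).congr
    fun s => by simp [ind]

theorem CmF.getElem? {F : σ → ℕ} (hF : Cm b F) : CmF b fun s => (Ctx.inp s)[F s]? := by
  intro a
  have h := CmF.symbol (b := b) hF.succ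
  cases a with
  | none =>
    refine (h .rightEnd).congr fun s => ?_
    cases h : (Ctx.inp s)[F s]? <;> simp [inputSymbol, h]
  | some a =>
    refine (h (.sym a)).congr fun s => ?_
    cases h : (Ctx.inp s)[F s]? <;> simp [inputSymbol, h]

instance [Finite A] : Finite (InSym A) := by
  have : Function.Injective (fun p : InSym A => match p with
    | .leftEnd => (false, none)
    | .sym a => (true, some a)
    | .rightEnd => (true, none)) := by
    intro p q h
    cases p <;> cases q <;> simp_all
  exact Finite.of_injective _ this

/-- The element of a finite type with a given number, and `d` if there is none. -/
noncomputable def decodeFin {α : Type} [Finite α] (d : α) (n : ℕ) : α :=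
  if h : n < Nat.card α then (Finite.equivFin α).symm ⟨n, h⟩ else d

noncomputable def encodeFin {α : Type} [Finite α] (a : α) : ℕ := Finite.equivFin α a

theorem encodeFin_lt {α : Type} [Finite α] (a : α) : encodeFin a < Nat.card α :=
  (Finite.equivFin α a).2

theorem decodeFin_encodeFin {α : Type} [Finite α] (d a : α) : decodeFin d (encodeFin a) = a := by
  simp [decodeFin, encodeFin]

theorem encodeFin_injective {α : Type} [Finite α] : Function.Injective (encodeFin (α := α)) :=
  fun a b h => by rw [← decodeFin_encodeFin a a, h, decodeFin_encodeFin]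

theorem CmF.decode {α : Type} [Finite α] (d : α) {F : σ → ℕ} (hF : Cm b F) :
    CmF b fun s => decodeFin d (F s) := fun a => by
  refine (CmP.ite (.of_lt hF (.const (Nat.card α))) (.of_eq hF (.const (encodeFin a)))
    (.const (d = a))).congr fun s => ?_
  by_cases h : F s < Nat.card α
  · simp only [h, forall_true_left, not_true_eq_false, false_imp_iff, and_true]
    constructor
    · rintro rfl
      simp [decodeFin, h, encodeFin]
    · intro h'
      rw [h', decodeFin_encodeFin]
  · simp [h, decodeFin]

theorem CmF.encode {α : Type} [Finite α] {F : σ → α} (hF : CmF b F) :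
    Cm b fun s => encodeFin (F s) := CmF.cases (G := fun a _ => encodeFin a) hF fun _ => .const _

/-- The state of a finite automaton after a prefix of the input. -/
theorem CmF.foldl {S : Type} [Finite A] [Finite S] (δ : S → A → S) (q₀ : S) {F : σ → ℕ}
    (hF : Cm b F) : CmF b fun s => ((Ctx.inp s).take (F s)).foldl δ q₀ := by
  let next : S → InSym A → S := fun q a => match a with | .sym a => δ q a | _ => q
  have h : ∀ (s : σ) n, (Nat.rec (encodeFin q₀)
      (fun i a => encodeFin (next (decodeFin q₀ a) (inputSymbol (Ctx.inp s) (i + 1)))) n : ℕ)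
      = encodeFin (((Ctx.inp s).take n).foldl δ q₀) := by
    intro s n
    induction n with
    | zero => rfl
    | succ n ih =>
      simp only [ih, decodeFin_encodeFin]
      congr 1
      rw [List.take_add_one, List.foldl_append]
      cases h : (Ctx.inp s)[n]? <;> simp [inputSymbol, h, next]
  have hc : Cm b fun s => encodeFin (((Ctx.inp s).take (F s)).foldl δ q₀) :=
    (Cm.iter (G := fun s i a =>
        encodeFin (next (decodeFin q₀ a) (inputSymbol (Ctx.inp s) (i + 1)))) hF
      (Cm.const (encodeFin q₀))
      (CmF.encode (CmF.map ((CmF.decode q₀ Cm.snd).pair (CmF.symbol Cm.snd.fst.succ))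
        fun p => next p.1 p.2))
      (Bdd.const (Nat.card S)) fun s i hi => by rw [h]; exact (encodeFin_lt _).le).congr
      fun s => (h s _).symm
  intro a
  exact (CmP.of_eq hc (Cm.const (encodeFin a))).congr fun s =>
    ⟨fun h => congrArg encodeFin h, fun h => encodeFin_injective h⟩

/-! ### Output -/

variable {B : Type}

theorem Em.congr {F G : σ → List B} (h : Em b F) (hFG : ∀ s, G s = F s) : Em b G := by
  rwa [show G = F from funext hFG]

theorem Em.nil : Em b fun _ : σ => ([] : List B) := fun _ _ _ => ⟨.skip, fun c => by
  filter_upwards with q st hr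
  exact ⟨st, does_skip hr.2, fun _ _ => rfl, by simp, hr.2⟩⟩

theorem Em.single (a : B) : Em b fun _ : σ => [a] := fun _ _ _ => ⟨.emit a, fun c => by
  filter_upwards with q st hr
  exact ⟨_, .of_step (fun _ => rfl) (by exact hr.2), fun _ _ => rfl, rfl, hr.2⟩⟩

theorem Em.append {F G : σ → List B} (hF : Em b F) (hG : Em b G) : Em b fun s => F s ++ G s := by
  intro loc e he
  obtain ⟨p, hp⟩ := hF loc e he
  obtain ⟨p', hp'⟩ := hG loc e he
  refine ⟨.seq p p', fun c => ?_⟩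
  filter_upwards [hp c, hp' c] with q hq hq' st hr
  obtain ⟨st', d, f⟩ := hq st hr
  obtain ⟨st'', d', f'⟩ := hq' st' (f.ready hr he)
  exact ⟨st'', d.seq hr.2 d', f.trans f' le_rfl⟩

theorem Em.cons (a : B) {F : σ → List B} (hF : Em b F) : Em b fun s => a :: F s :=
  (Em.single a).append hF

theorem Em.const (l : List B) : Em b fun _ : σ => l := by
  induction l with
  | nil => exact Em.nil
  | cons a l ih => exact ih.cons a

theorem Em.ite {P : σ → Prop} [∀ s, Decidable (P s)] (hP : CmP b P) {F G : σ → List B}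
    (hF : Em b F) (hG : Em b G) : Em b fun s => if P s then F s else G s := by
  intro loc e he
  obtain ⟨p, hp⟩ := hP B loc e he
  obtain ⟨p₀, hp₀⟩ := Cm.zero (b := b) (σ := σ) B loc (e + 1)
    (fun i hi => (he i hi).trans (Nat.lt_succ_self e))
  obtain ⟨p₁, hp₁⟩ := hF loc e he
  obtain ⟨p₂, hp₂⟩ := hG loc e he
  refine ⟨.seq p (.seq p₀ (.ite (.lt (e + 1) e) p₁ p₂)), fun c => ?_⟩
  filter_upwards [hp c, hp₀ c, hp₁ c, hp₂ c] with q hq hq₀ hq₁ hq₂ st hr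
  obtain ⟨st', d, v, f⟩ := hq st hr
  obtain ⟨st₀, d₀, v₀, f₀⟩ := hq₀ st' (f.ready hr he)
  have f' := f.trans_nil f₀ (Nat.le_succ e)
  have hrdy := f'.ready hr he
  have hlt : (RTest.lt (e + 1) e : RTest A).eval (Ctx.inp q.1) st₀ = decide (P q.1) := by
    by_cases h : P q.1 <;>
      simp [RTest.eval, v₀, f₀.keep e (Nat.lt_succ_self e), v, ind, h]
  by_cases h : P q.1
  · obtain ⟨st₁, d₁, f₁⟩ := hq₁ st₀ hrdy
    exact ⟨st₁, d.seq hr.2 (d₀.seq f.le (d₁.ite_true f₀.le (by simpa [hlt] using h))),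
      by simpa [h] using f'.trans f₁ le_rfl⟩
  · obtain ⟨st₁, d₁, f₁⟩ := hq₂ st₀ hrdy
    exact ⟨st₁, d.seq hr.2 (d₀.seq f.le (d₁.ite_false f₀.le (by simpa [hlt] using h))),
      by simpa [h] using f'.trans f₁ le_rfl⟩

theorem Em.cases {α : Type} [Finite α] {F : σ → α} (hF : CmF b F) {G : α → σ → List B}
    (hG : ∀ a, Em b (G a)) : Em b fun s => G (F s) s := by
  classical
  have := Fintype.ofFinite α
  have key : ∀ l : List α, Em b fun s => if F s ∈ l then G (F s) s else [] := by
    intro l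
    induction l with
    | nil => simpa using Em.nil
    | cons a l ih =>
      refine (Em.ite (hF a) (hG a) ih).congr fun s => ?_
      by_cases h : F s = a
      · subst h; simp
      · simp [h]
  exact (key Finset.univ.toList).congr fun s => by simp

/-- Output of the words `G s 0, …, G s (N s - 1)`. -/
theorem Em.flatMap_range {N : σ → ℕ} {G : σ → ℕ → List B} (hN : Cm b N)
    (hG : Em b fun q : σ × ℕ => G q.1 q.2) :
    Em b fun s => (List.range (N s)).flatMap (G s) := by
  intro loc e he
  let loc1 : ℕ → ℕ := fun i => if i < dim σ then loc i else e + 1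
  have he2 : ∀ i < dim (σ × ℕ), loc1 i < e + 2 := by
    intro i hi
    simp only [loc1]
    split_ifs with h
    · exact (he i h).trans (by omega)
    · omega
  obtain ⟨p₁, hp₁⟩ := hN B loc e he
  obtain ⟨p₂, hp₂⟩ := hG loc1 (e + 2) he2
  refine ⟨.seq p₁ (.seq (.zero (e + 1)) (.loop (.lt (e + 1) e) (.seq p₂ (.succ (e + 1))))),
    fun c => ?_⟩
  obtain ⟨cN, hcN⟩ := hN.bdd c
  have hsmall : ∀ᶠ q in lim σ b c, N q.1 ≤ bd b cN (Ctx.inp q.1).length :=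
    ⟨0, fun s hs _ _ => hcN s hs⟩
  filter_upwards [hp₁ c, eventually_prod cN (hp₂ _), hN.bdd.eventually c, hsmall]
    with q hq₁ hq₂ hNg hsm st hr
  obtain ⟨st₁, d₁, v₁, f₁⟩ := hq₁ st hr
  have key : ∀ k v, v + k = N q.1 → ∀ st', Eff e q.2 ((List.range v).flatMap (G q.1)) st st' →
      st'.regs (e + 1) = v → st'.regs e = N q.1 →
      ∃ st'', Does (Ctx.inp q.1) q.2 (.loop (.lt (e + 1) e) (.seq p₂ (.succ (e + 1)))) st' st'' ∧
        Eff e q.2 ((List.range (N q.1)).flatMap (G q.1)) st st'' := by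
    intro k
    induction k with
    | zero =>
      rintro v hv st' f h1 h0
      obtain rfl : v = N q.1 := by omega
      exact ⟨st', Does.loop_false f.le (by simp [RTest.eval, h1, h0]), f⟩
    | succ k ih =>
      intro v hv st' f h1 h0
      obtain ⟨st2, d2, f2⟩ := hq₂ v (by omega) st' ((f.ready hr he).prod h1)
      have hv2 : st2.regs (e + 1) = v := by rw [f2.keep _ (by omega), h1]
      have hg4 : st2.regs (e + 1) + 1 ≤ q.2 := by
        rw [hv2]; omega
      have d4 := does_succ (x := Ctx.inp q.1) (h := st2.head) (o := st2.out) f2.le (e + 1) hg4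
      have f4 := Eff.update (e := e) f2.le (show e ≤ e + 1 by omega) hg4
      have f5 := (f.trans f2 (by omega)).trans f4 le_rfl
      rw [List.append_nil] at f5
      obtain ⟨st'', d6, f6⟩ := ih (v + 1) (by omega) _
        (by rw [List.range_succ, List.flatMap_append]; simpa using f5)
        (by simp only [Function.update_self]; rw [hv2])
        (by
          simp only
          rw [Function.update_of_ne (by omega), f2.keep _ (by omega), h0])
      exact ⟨st'', Does.loop_true f.le (by simp [RTest.eval, h1, h0]; omega)
        (d2.seq f.le d4) d6, f6⟩
  have d2 := does_zero (x := Ctx.inp q.1) (h := st₁.head) (o := st₁.out) f₁.le (e + 1)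
  have f2 := Eff.update (e := e) f₁.le (show e ≤ e + 1 by omega) (Nat.zero_le _)
  obtain ⟨st'', d3, f3⟩ := key (N q.1) 0 (by omega) _ (f₁.trans_nil f2 le_rfl) (by simp)
    (by simp only; rw [Function.update_of_ne (by omega), v₁])
  exact ⟨st'', d₁.seq hr.2 (d2.seq f₁.le d3), f3⟩

theorem Em.replicate {N : σ → ℕ} (hN : Cm b N) (a : B) : Em b fun s => List.replicate (N s) a :=
  (Em.flatMap_range (G := fun _ _ => [a]) hN (Em.single a)).congr fun s => by
    rw [← List.map_eq_flatMap]; simp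

/-- Functions output by register programs are computed by machines within the corresponding
space. -/
theorem Em.exists_machine {F : List A → List B} (hF : Em b F) :
    ∃ M : Machine A B, M.Computes F ∧
      ∃ c, ∀ x, M.WorkSpaceLE x (Nat.log 2 (bd b c x.length) + 2) := by
  obtain ⟨p, hp⟩ := hF id 0 (fun i hi => hi)
  obtain ⟨n, hn⟩ := p.exists_regsBelow
  obtain ⟨c, hc⟩ := hp 0
  have key : ∀ x, ∃ c', (compile n p).RunLE x (Nat.log 2 (bd b c x.length) + 2)
      (compile n p).init c' ∧ (compile n p).step x c' = none ∧ c'.out = F x := by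
    intro x
    obtain ⟨st', d, f⟩ := hc x (fun i hi => absurd hi (Nat.not_lt_zero i)) _ le_rfl .initial
      ⟨fun i hi => absurd hi (Nat.not_lt_zero i), fun _ => Nat.zero_le _⟩
    obtain ⟨c', h1, h2, h3⟩ := compile_run hn d
    exact ⟨c', h1, h2, by rw [h3, f.out]; rfl⟩
  refine ⟨compile n p, fun x => ?_, c, fun x => ?_⟩
  · obtain ⟨c', h1, h2, h3⟩ := key x
    exact ⟨c', h1.reached, h2, h3⟩
  · obtain ⟨c', h1, h2, -⟩ := key x
    exact h1.workSpaceLE (by omega) h2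

theorem Em.isLogspace {F : List A → List B} (hF : Em false F) : IsLogspace F := by
  obtain ⟨M, hM, c, hc⟩ := hF.exists_machine
  -- The logarithm of `(n + 2) ^ c` is at most `(Nat.log 2 n + 2) * c`; with the two extra cells
  -- this is at most `(2 * c + 2) * (Nat.log 2 n + 1)`.
  refine ⟨M, hM, 2 * c + 2, fun x a ha => (hc x a ha).trans ?_⟩
  set n := x.length
  have h1 : n + 2 ≤ 2 ^ (Nat.log 2 n + 2) := by
    have := Nat.lt_pow_succ_log_self (b := 2) (by omega) n
    rw [Nat.succ_eq_add_one] at this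
    have h3 : 2 ≤ 2 ^ (Nat.log 2 n + 1) := by
      calc 2 = 2 ^ 1 := rfl
        _ ≤ _ := Nat.pow_le_pow_right (by omega) (by omega)
    rw [pow_succ]; omega
  have h2 : bd false c n ≤ 2 ^ ((Nat.log 2 n + 2) * c) := by
    rw [pow_mul]; exact Nat.pow_le_pow_left h1 c
  have h3 : Nat.log 2 (bd false c n) ≤ (Nat.log 2 n + 2) * c := by
    calc _ ≤ Nat.log 2 (2 ^ ((Nat.log 2 n + 2) * c)) := Nat.log_mono_right h2
      _ = _ := Nat.log_pow (by omega) _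
  nlinarith [Nat.zero_le (c * Nat.log 2 n), Nat.zero_le (Nat.log 2 n)]

theorem Em.polyspace {F : List A → List B} (hF : Em true F) :
    ∃ M : Machine A B, M.Computes F ∧ ∃ c, ∀ x, M.WorkSpaceLE x ((x.length + 2) ^ c + 2) := by
  obtain ⟨M, hM, c, hc⟩ := hF.exists_machine
  refine ⟨M, hM, c, fun x a ha => (hc x a ha).trans ?_⟩
  rw [bd, Nat.log_pow (by omega)]

end
end MFSearch
namespace MFSearch

/-! ### Weakenings -/

/-- Some of the conjuncts are replaced by TRUE. -/
def Weaker : List Conjunct → List Conjunct → Prop :=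
  List.Forall₂ fun c d => d = c ∨ d = .top

theorem Weaker.refl (l : List Conjunct) : Weaker l l := by
  induction l with
  | nil => exact .nil
  | cons c l ih => exact .cons (Or.inl rfl) ih

theorem Weaker.trans {l₁ l₂ l₃ : List Conjunct} (h : Weaker l₁ l₂) (h' : Weaker l₂ l₃) :
    Weaker l₁ l₃ := by
  induction h generalizing l₃ with
  | nil => exact h'
  | cons h _ ih =>
    cases h' with
    | cons h1 h2 =>
      refine .cons ?_ (ih h2)
      rcases h1 with rfl | rfl
      · exact h
      · exact Or.inr rfl

theorem Weaker.mem {l l' : List Conjunct} (h : Weaker l l') {c : Conjunct} (hc : c ∈ l') :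
    c ∈ l ∨ c = .top := by
  induction h with
  | nil => simp at hc
  | cons h _ ih =>
    rcases List.mem_cons.mp hc with rfl | hc
    · rcases h with rfl | rfl <;> simp
    · rcases ih hc with h | h <;> simp [h]

theorem Weaker.pairwise {l l' : List Conjunct} (h : Weaker l l')
    (hl : l.Pairwise fun c d => c = d → c = .top) :
    l'.Pairwise fun c d => c = d → c = .top := by
  induction h with
  | nil => exact .nil
  | cons h ht ih =>
    rw [List.pairwise_cons] at hl ⊢
    refine ⟨fun d hd hcd => ?_, ih hl.2⟩
    rcases h with rfl | rfl
    · rcases Weaker.mem ht hd with h' | h'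
      · exact hl.1 d h' hcd
      · rw [hcd, h']
    · rfl

theorem Weaker.set_top (l : List Conjunct) (j : ℕ) : Weaker l (l.set j .top) := by
  induction l generalizing j with
  | nil => exact .nil
  | cons a l ih =>
    cases j with
    | zero => exact .cons (Or.inr rfl) (Weaker.refl l)
    | succ j => exact .cons (Or.inl rfl) (ih j)

theorem Weaker.holds {l l' : List Conjunct} (h : Weaker l l') {τ : Valuation}
    (hl : ∀ c ∈ l, c.Holds τ) : ∀ c ∈ l', c.Holds τ := fun c hc => by
  rcases h.mem hc with h | rfl
  · exact hl c h
  · trivial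

/-- Change of the matrix of a formula by replacing some conjuncts by TRUE. -/
def QCNF.weaken (Φ : QCNF) (l : List Conjunct) (h : Weaker Φ.matrix l) : QCNF where
  quants := Φ.quants
  matrix := l
  nodup_vars := Φ.nodup_vars
  nonempty_clauses C hC := by
    rcases h.mem hC with h | h
    · exact Φ.nonempty_clauses C h
    · cases h
  different_clauses := h.pairwise Φ.different_clauses

theorem mem_weakenings {Φ Ψ : QCNF} :
    Ψ ∈ Φ.weakenings ↔ Ψ.quants = Φ.quants ∧ Weaker Φ.matrix Ψ.matrix := by
  constructor
  · intro h
    induction h with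
    | refl => exact ⟨rfl, Weaker.refl _⟩
    | tail _ h2 ih =>
      obtain ⟨h1, j, -, h3⟩ := h2
      exact ⟨h1.trans ih.1, ih.2.trans (h3 ▸ Weaker.set_top _ j)⟩
  · rintro ⟨hq, hm⟩
    have hlen : Φ.matrix.length = Ψ.matrix.length := hm.length_eq
    -- Interpolation between the two matrices: the first `i` conjuncts come from `Ψ`, the others
    -- from `Φ`. Passing from `i` to `i + 1` changes nothing or is one basic weakening.
    have hw : ∀ i, Weaker Φ.matrix (Ψ.matrix.take i ++ Φ.matrix.drop i) := fun i => by
      conv => enter [1]; rw [← List.take_append_drop i Φ.matrix]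
      exact List.rel_append (List.forall₂_take i hm) (Weaker.refl _)
    have key : ∀ i ≤ Φ.matrix.length, Φ.weaken _ (hw i) ∈ Φ.weakenings := by
      intro i
      induction i with
      | zero =>
        intro _
        have : Φ.weaken _ (hw 0) = Φ := by ext1 <;> simp [QCNF.weaken]
        rw [this]; exact .refl
      | succ i ih =>
        intro hi
        have hi' : i < Ψ.matrix.length := by omega
        have e1 : Φ.matrix.drop i = Φ.matrix[i] :: Φ.matrix.drop (i + 1) :=
          List.drop_eq_getElem_cons (by omega)
        have e2 : Ψ.matrix.take (i + 1) = Ψ.matrix.take i ++ [Ψ.matrix[i]] :=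
          (List.take_concat_get' Ψ.matrix i hi').symm
        have hi2 := List.Forall₂.get hm (i := i) (by omega) hi'
        simp only [List.get_eq_getElem] at hi2
        rcases hi2 with h | h
        · have : Φ.weaken _ (hw (i + 1)) = Φ.weaken _ (hw i) := by
            ext1
            · rfl
            · simp only [QCNF.weaken]
              rw [e1, e2, h, List.append_assoc]; rfl
          rw [this]; exact ih (by omega)
        · refine (ih (by omega)).tail ⟨rfl, i, ?_, ?_⟩
          · simp only [QCNF.weaken, List.length_append, List.length_take, List.length_drop]; omega
          · simp only [QCNF.weaken]
            rw [e2, h, List.set_append_right _ _ (by simp)]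
            simp only [List.length_take, Nat.min_eq_left hi'.le, Nat.sub_self, List.append_assoc]
            rw [e1]; rfl
    have hΨ : Φ.weaken _ (hw Φ.matrix.length) = Ψ := by
      ext1
      · exact hq.symm
      · simp only [QCNF.weaken]
        rw [hlen, List.take_length, ← hlen, List.drop_length, List.append_nil]
    exact hΨ ▸ key _ le_rfl

/-! ### Semantics of quantifier prefixes -/

theorem quantify_congr {q : List (Quantifier × Var)} {φ ψ : Valuation → Prop}
    (h : ∀ τ, φ τ → ψ τ) : ∀ {σ}, quantify q φ σ → quantify q ψ σ := by
  induction q with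
  | nil => exact fun {σ} => h σ
  | cons p q ih =>
    obtain ⟨_ | _, v⟩ := p
    · exact fun {σ} hq b => ih (hq b)
    · exact fun {σ} ⟨b, hb⟩ => ⟨b, ih hb⟩

theorem QCNF.holds_of_mem_weakenings {Φ Ψ : QCNF} (h : Ψ ∈ Φ.weakenings) {σ : Valuation}
    (hΦ : Φ.Holds σ) : Ψ.Holds σ := by
  rw [mem_weakenings] at h
  unfold QCNF.Holds
  rw [h.1]
  exact quantify_congr (fun τ => h.2.holds) hΦ

/-! ### The structure of words that encode formulas -/

def Token.isBit : Token → Bool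
  | .bit _ => true
  | _ => false

/-- Tokens of which the clauses consist. -/
def Token.isInner : Token → Bool
  | .bit _ | .lit _ => true
  | _ => false

/-- The name at the beginning of a word. -/
def bitsOf : List Token → Var
  | .bit b :: ts => b :: bitsOf ts
  | _ => []

/-- The literals of the clause at the beginning of a word. -/
def litsOf : List Token → List Literal
  | .lit s :: ts => ⟨s, bitsOf ts⟩ :: litsOf ts
  | .bit _ :: ts => litsOf ts
  | _ => []

def encQuants (qs : List (Quantifier × Var)) : List Token :=
  qs.flatMap fun p => p.1.token :: Var.encode p.2

def encLits (C : List Literal) : List Token := C.flatMap Literal.encode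

def encMatrix (ms : List Conjunct) : List Token := ms.flatMap Conjunct.encode

theorem QCNF.encode_eq (Φ : QCNF) : Φ.encode = encQuants Φ.quants ++ encMatrix Φ.matrix := rfl

@[simp] theorem encQuants_nil : encQuants [] = [] := rfl
@[simp] theorem encQuants_cons (p : Quantifier × Var) (qs) :
    encQuants (p :: qs) = p.1.token :: (Var.encode p.2 ++ encQuants qs) := by simp [encQuants]
@[simp] theorem encLits_nil : encLits [] = [] := rfl
@[simp] theorem encLits_cons (l : Literal) (C) :
    encLits (l :: C) = Token.lit l.positive :: (Var.encode l.var ++ encLits C) := by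
  simp [encLits, Literal.encode]
@[simp] theorem encMatrix_nil : encMatrix [] = [] := rfl
@[simp] theorem encMatrix_top (ms) : encMatrix (.top :: ms) = .top :: encMatrix ms := rfl
@[simp] theorem encMatrix_clause (C ms) :
    encMatrix (.clause C :: ms) = .clause :: (encLits C ++ encMatrix ms) := rfl

theorem isBit_of_mem_encode {v : Var} {t : Token} (h : t ∈ Var.encode v) : t.isBit = true := by
  obtain ⟨b, -, rfl⟩ := List.mem_map.mp h
  rfl

theorem isInner_of_mem_encLits {C : List Literal} {t : Token} (h : t ∈ encLits C) :
    t.isInner = true := by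
  induction C with
  | nil => simp at h
  | cons l C ih =>
    simp only [encLits_cons, List.mem_cons, List.mem_append] at h
    rcases h with rfl | h | h
    · rfl
    · obtain ⟨b, -, rfl⟩ := List.mem_map.mp h
      rfl
    · exact ih h

/-- The word does not begin with a token from inside a clause. -/
def Stops : List Token → Prop
  | t :: _ => t.isInner = false
  | [] => True

theorem stops_encMatrix (ms : List Conjunct) : Stops (encMatrix ms) := by
  rcases ms with _ | ⟨_ | C, ms⟩ <;> simp [Stops, Token.isInner]

theorem stops_encode (qs : List (Quantifier × Var)) (ms : List Conjunct) :
    Stops (encQuants qs ++ encMatrix ms) := by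
  rcases qs with _ | ⟨⟨_ | _, v⟩, qs⟩
  · exact stops_encMatrix ms
  all_goals simp [Stops, Quantifier.token, Token.isInner]

theorem bitsOf_append (v : Var) {ts : List Token} (h : ∀ b ts', ts ≠ .bit b :: ts') :
    bitsOf (Var.encode v ++ ts) = v := by
  induction v with
  | nil =>
    change bitsOf ts = []
    unfold bitsOf
    split
    · exact absurd rfl (h _ _)
    · rfl
  | cons b v ih =>
    change b :: bitsOf (Var.encode v ++ ts) = b :: v
    rw [ih]

theorem Stops.ne_bit {ts : List Token} (h : Stops ts) (b : Bool) (ts' : List Token) :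
    ts ≠ .bit b :: ts' := by
  rintro rfl; simp [Stops, Token.isInner] at h

theorem encLits_append_ne_bit {ts : List Token} (h : Stops ts) (C : List Literal) (b : Bool)
    (ts' : List Token) : encLits C ++ ts ≠ .bit b :: ts' := by
  cases C with
  | nil => exact h.ne_bit b ts'
  | cons l C => simp

theorem litsOf_bits_append (v : Var) (ts : List Token) :
    litsOf (Var.encode v ++ ts) = litsOf ts := by
  induction v with
  | nil => rfl
  | cons b v ih => exact ih

theorem litsOf_append (C : List Literal) {ts : List Token} (h : Stops ts) :
    litsOf (encLits C ++ ts) = C := by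
  induction C with
  | nil =>
    change litsOf ts = []
    rcases ts with _ | ⟨t, ts⟩
    · rfl
    · cases t <;> simp_all [Stops, Token.isInner, litsOf]
  | cons l C ih =>
    rw [encLits_cons, List.cons_append, List.append_assoc, litsOf, litsOf_bits_append, ih,
      bitsOf_append _ (encLits_append_ne_bit h C)]

theorem encLits_injective : Function.Injective encLits := fun C D h => by
  have h1 := litsOf_append C (ts := []) trivial
  rw [h, litsOf_append D (ts := []) trivial] at h1
  exact h1.symm

theorem takeWhile_encLits_append (C : List Literal) {ts : List Token} (h : Stops ts) :
    (encLits C ++ ts).takeWhile Token.isInner = encLits C := by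
  rw [List.takeWhile_append_of_pos fun t ht => isInner_of_mem_encLits ht]
  rcases ts with _ | ⟨t, ts⟩
  · simp
  · rw [List.takeWhile_cons_of_neg (by simpa [Stops] using h), List.append_nil]

theorem takeWhile_encode_append (v : Var) {ts : List Token} (h : Stops ts) :
    (Var.encode v ++ ts).takeWhile Token.isInner = Var.encode v := by
  rw [List.takeWhile_append_of_pos fun t ht => by
    obtain ⟨b, -, rfl⟩ := List.mem_map.mp ht; rfl]
  rcases ts with _ | ⟨t, ts⟩
  · simp
  · rw [List.takeWhile_cons_of_neg (by simpa [Stops] using h), List.append_nil]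

theorem takeWhile_isBit (ts : List Token) : ts.takeWhile Token.isBit = (bitsOf ts).map .bit := by
  induction ts with
  | nil => rfl
  | cons t ts ih =>
    cases t
    case bit b => rw [bitsOf, List.map_cons, ← ih]; rfl
    all_goals rfl

/-- The values of `g` at the positions of a word where it is defined. -/
def scan {β : Type} (g : Token → List Token → Option β) : List Token → List β
  | [] => []
  | t :: ts => (g t ts).toList ++ scan g ts

theorem scan_append_of_none {β : Type} {g : Token → List Token → Option β} {l : List Token}
    (h : ∀ t ∈ l, ∀ ts, g t ts = none) (ts : List Token) : scan g (l ++ ts) = scan g ts := by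
  induction l with
  | nil => rfl
  | cons t l ih =>
    rw [List.cons_append, scan, h t (by simp), ih fun t ht => h t (by simp [ht])]
    rfl

theorem mem_scan {β : Type} {g : Token → List Token → Option β} {x : List Token} {v : β} :
    v ∈ scan g x ↔ ∃ p < x.length, ∃ t, x[p]? = some t ∧ g t (x.drop (p + 1)) = some v := by
  induction x with
  | nil => simp [scan]
  | cons t x ih =>
    rw [scan, List.mem_append, ih, Option.mem_toList]
    constructor
    · rintro (h | ⟨p, hp, u, h1, h2⟩)
      · exact ⟨0, by simp, t, rfl, h⟩
      · exact ⟨p + 1, by simpa using hp, u, h1, h2⟩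
    · rintro ⟨_ | p, hp, u, h1, h2⟩
      · simp only [List.getElem?_cons_zero, Option.some.injEq] at h1
        subst h1
        exact Or.inl h2
      · exact Or.inr ⟨p, by simpa using hp, u, h1, h2⟩

/-- Translates a property of the parsed list into bounded quantification over positions of the word,
which register programs can check. -/
theorem nodup_scan {β : Type} {g : Token → List Token → Option β} {x : List Token} :
    (scan g x).Nodup ↔ ∀ p < x.length, ∀ p' < p, ∀ t t', x[p]? = some t → x[p']? = some t' →
      ∀ v, g t (x.drop (p + 1)) = some v → g t' (x.drop (p' + 1)) ≠ some v := by
  induction x with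
  | nil => simp [scan]
  | cons t x ih =>
    rw [scan, List.nodup_append, ih]
    constructor
    · rintro ⟨-, h1, h2⟩ (_ | p) hp p' hp' u u' hu hu' v hv hv'
      · omega
      · rcases p' with _ | p'
        · simp only [List.getElem?_cons_zero, Option.some.injEq] at hu'
          subst hu'
          refine h2 v (by simpa using hv') v ?_ rfl
          exact mem_scan.mpr ⟨p, by simpa using hp, u, hu, hv⟩
        · exact h1 p (by simpa using hp) p' (by omega) u u' hu hu' v hv hv'
    · intro h
      refine ⟨?_, fun p hp p' hp' u u' hu hu' v hv =>
        h (p + 1) (by simpa using hp) (p' + 1) (by omega) u u' hu hu' v hv, ?_⟩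
      · cases g t x <;> simp
      · rintro v hv w hw rfl
        obtain ⟨p, hp, u, hu, hg⟩ := mem_scan.mp hw
        exact h (p + 1) (by simpa using hp) 0 (by omega) u t hu rfl v hg (by simpa using hv)

/-- The name of a variable after a quantifier. -/
def quantName : Token → List Token → Option Var
  | .all, ts | .ex, ts => some (bitsOf ts)
  | _, _ => none

/-- The name of a variable after the sign of a literal. -/
def litName : Token → List Token → Option Var
  | .lit _, ts => some (bitsOf ts)
  | _, _ => none

/-- The clause after the marker of a clause. -/
def clauseBody : Token → List Token → Option (List Token)
  | .clause, ts => some (ts.takeWhile Token.isInner)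
  | _, _ => none

theorem quantName_of_isInner {t : Token} (h : t.isInner = true) (ts) : quantName t ts = none := by
  cases t <;> simp_all [Token.isInner, quantName]

theorem clauseBody_of_isInner {t : Token} (h : t.isInner = true) (ts) :
    clauseBody t ts = none := by
  cases t <;> simp_all [Token.isInner, clauseBody]

theorem isInner_of_isBit {t : Token} (h : t.isBit = true) : t.isInner = true := by
  cases t <;> simp_all [Token.isInner, Token.isBit]

theorem litName_of_isBit {t : Token} (h : t.isBit = true) (ts) : litName t ts = none := by
  cases t <;> simp_all [Token.isBit, litName]

theorem scan_quantName (qs : List (Quantifier × Var)) (ms : List Conjunct) :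
    scan quantName (encQuants qs ++ encMatrix ms) = qs.map Prod.snd := by
  induction qs with
  | nil =>
    change scan quantName (encMatrix ms) = []
    induction ms with
    | nil => rfl
    | cons c ms ih =>
      cases c with
      | top => exact ih
      | clause C =>
        rw [encMatrix_clause, scan, scan_append_of_none fun t ht =>
          quantName_of_isInner (isInner_of_mem_encLits ht), ih]
        rfl
  | cons p qs ih =>
    rw [encQuants_cons, List.cons_append, List.append_assoc, scan, scan_append_of_none fun t ht =>
      quantName_of_isInner (isInner_of_isBit (isBit_of_mem_encode ht)), ih]
    obtain ⟨q, v⟩ := p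
    cases q <;> simp [Quantifier.token, quantName, bitsOf_append v (stops_encode qs ms).ne_bit]

theorem scan_quants_append {β : Type} {g : Token → List Token → Option β}
    (h1 : ∀ ts, g .all ts = none) (h2 : ∀ ts, g .ex ts = none)
    (h3 : ∀ b ts, g (.bit b) ts = none) (qs : List (Quantifier × Var)) (ts : List Token) :
    scan g (encQuants qs ++ ts) = scan g ts := by
  refine scan_append_of_none (fun t ht ts => ?_) ts
  obtain ⟨⟨q, v⟩, -, ht⟩ := List.mem_flatMap.mp ht
  rcases List.mem_cons.mp ht with rfl | ht
  · cases q
    · exact h1 ts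
    · exact h2 ts
  · obtain ⟨b, -, rfl⟩ := List.mem_map.mp ht
    exact h3 b ts

theorem scan_litName (qs : List (Quantifier × Var)) (ms : List Conjunct) (v : Var) :
    v ∈ scan litName (encQuants qs ++ encMatrix ms) ↔
      ∃ C, Conjunct.clause C ∈ ms ∧ ∃ l ∈ C, l.var = v := by
  rw [scan_quants_append (fun _ => rfl) (fun _ => rfl) (fun _ _ => rfl)]
  induction ms with
  | nil => simp [scan]
  | cons c ms ih =>
    cases c with
    | top =>
      change v ∈ scan litName (encMatrix ms) ↔ _
      simp [ih]
    | clause C =>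
      have key : v ∈ scan litName (encLits C ++ encMatrix ms) ↔
          (∃ l ∈ C, l.var = v) ∨ v ∈ scan litName (encMatrix ms) := by
        induction C with
        | nil => simp
        | cons l C ihC =>
          rw [encLits_cons, List.cons_append, List.append_assoc, scan,
            scan_append_of_none fun t ht => litName_of_isBit (isBit_of_mem_encode ht),
            List.mem_append, ihC]
          simp only [litName, bitsOf_append _ (encLits_append_ne_bit (stops_encMatrix ms) C)]
          simp [or_assoc, eq_comm]
      change v ∈ scan litName (encLits C ++ encMatrix ms) ↔ _
      rw [key, ih]
      simp only [List.mem_cons, Conjunct.clause.injEq]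
      constructor
      · rintro (h | ⟨D, h, h'⟩)
        · exact ⟨C, Or.inl rfl, h⟩
        · exact ⟨D, Or.inr h, h'⟩
      · rintro ⟨D, rfl | h, h'⟩
        · exact Or.inl h'
        · exact Or.inr ⟨D, h, h'⟩

/-- TRUE contributes nothing to the scan, which is exactly the exception in the condition on the
right; and since `encLits` is injective, equal clauses can be recognized from the words that encode
them. -/
theorem nodup_scan_clauseBody (qs : List (Quantifier × Var)) (ms : List Conjunct) :
    (scan clauseBody (encQuants qs ++ encMatrix ms)).Nodup ↔
      ms.Pairwise fun c d => c = d → c = .top := by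
  rw [scan_quants_append (fun _ => rfl) (fun _ => rfl) (fun _ _ => rfl)]
  have hmem : ∀ ms D, encLits D ∈ scan clauseBody (encMatrix ms) ↔ Conjunct.clause D ∈ ms := by
    intro ms D
    induction ms with
    | nil => simp [scan]
    | cons c ms ih =>
      cases c with
      | top =>
        change _ ∈ scan clauseBody (encMatrix ms) ↔ _
        simp [ih]
      | clause C =>
        rw [encMatrix_clause, scan, scan_append_of_none fun t ht =>
          clauseBody_of_isInner (isInner_of_mem_encLits ht), List.mem_append, ih]
        simp [clauseBody, takeWhile_encLits_append C (stops_encMatrix ms),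
          encLits_injective.eq_iff]
  induction ms with
  | nil => simp [scan]
  | cons c ms ih =>
    cases c with
    | top =>
      change (scan clauseBody (encMatrix ms)).Nodup ↔ _
      rw [List.pairwise_cons]
      exact ih.trans (by simp)
    | clause C =>
      rw [encMatrix_clause, scan, scan_append_of_none fun t ht =>
          clauseBody_of_isInner (isInner_of_mem_encLits ht), List.pairwise_cons]
      refine Iff.trans ?_ (and_congr_right fun _ => ih)
      simp only [clauseBody, takeWhile_encLits_append C (stops_encMatrix ms), Option.toList_some,
        List.singleton_append, List.nodup_cons, hmem]
      refine and_congr_left fun _ => ?_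
      constructor
      · rintro h d hd rfl
        exact absurd hd h
      · intro h hC
        cases h _ hC rfl

/-! ### Parsing -/

/-- States of the automaton that recognizes the words composed of quantified variables and
conjuncts. -/
inductive ParseState where
  | start
  | quant
  | top
  | clause
  | lit
  | fail

instance : Finite ParseState := by
  have : Function.Injective (fun p : ParseState => match p with
    | .start => (0 : Fin 6) | .quant => 1 | .top => 2 | .clause => 3 | .lit => 4 | .fail => 5) := by
    intro p q h
    cases p <;> cases q <;> simp_all
  exact Finite.of_injective _ this

def ParseState.next : ParseState → Token → ParseState
  | .start, .all | .start, .ex | .quant, .all | .quant, .ex | .quant, .bit _ => .quant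
  | .start, .top | .quant, .top | .top, .top | .lit, .top => .top
  | .start, .clause | .quant, .clause | .top, .clause | .lit, .clause => .clause
  | .clause, .lit _ | .lit, .lit _ | .lit, .bit _ => .lit
  | _, _ => .fail

def ParseState.accepts : ParseState → Prop
  | .clause | .fail => False
  | _ => True

theorem foldl_fail (x : List Token) : x.foldl ParseState.next .fail = .fail := by
  induction x with
  | nil => rfl
  | cons t x ih => cases t <;> exact ih

/-- `x` is a sequence of conjuncts. -/
def IsMatrix (x : List Token) : Prop :=
  ∃ ms : List Conjunct, (∀ C, Conjunct.clause C ∈ ms → C ≠ []) ∧ x = encMatrix ms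

/-- `x` consists of a sequence of quantified variables and a sequence of conjuncts. -/
def IsPrenex (x : List Token) : Prop :=
  ∃ (qs : List (Quantifier × Var)) (ms : List Conjunct),
    (∀ C, Conjunct.clause C ∈ ms → C ≠ []) ∧ x = encQuants qs ++ encMatrix ms

theorem foldl_bits (v : Var) {s : ParseState} (hs : s = .quant ∨ s = .lit) :
    (Var.encode v).foldl ParseState.next s = s := by
  induction v with
  | nil => rfl
  | cons b v ih => rcases hs with rfl | rfl <;> exact ih

theorem foldl_encLits (C : List Literal) : (encLits C).foldl ParseState.next .lit = .lit := by
  induction C with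
  | nil => rfl
  | cons l C ih =>
    rw [encLits_cons, List.foldl_cons, List.foldl_append]
    change List.foldl _ (List.foldl _ ParseState.lit _) _ = _
    rw [foldl_bits l.var (Or.inr rfl), ih]

theorem foldl_encMatrix {ms : List Conjunct} (h : ∀ C, Conjunct.clause C ∈ ms → C ≠ [])
    {s : ParseState} (hs : s ≠ .clause ∧ s ≠ .fail) :
    ((encMatrix ms).foldl ParseState.next s).accepts := by
  induction ms generalizing s with
  | nil => cases s <;> simp_all [ParseState.accepts]
  | cons c ms ih =>
    have ih' := fun {s} => ih (fun C hC => h C (List.mem_cons_of_mem _ hC)) (s := s)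
    cases c with
    | top =>
      rw [encMatrix_top, List.foldl_cons,
        show s.next .top = .top by cases s <;> simp_all [ParseState.next]]
      exact ih' (by simp)
    | clause C =>
      rcases C with _ | ⟨l, C⟩
      · exact absurd rfl (h [] (by simp))
      · rw [encMatrix_clause, List.foldl_cons, List.foldl_append,
          show s.next .clause = .clause by cases s <;> simp_all [ParseState.next],
          encLits_cons, List.foldl_cons, List.foldl_append]
        change (List.foldl _ (List.foldl _ (List.foldl _ ParseState.lit _) _) _).accepts
        rw [foldl_bits _ (Or.inr rfl), foldl_encLits]
        exact ih' (by simp)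

theorem accepts_iff (x : List Token) :
    (x.foldl ParseState.next .start).accepts ↔ IsPrenex x := by
  constructor
  -- For every state, the shape of the words accepted from that state is described, in one
  -- simultaneous induction. In the states `lit` and `quant`, the word starts with the rest of a
  -- name.
  · have key : ∀ x : List Token,
        ((x.foldl ParseState.next .top).accepts → IsMatrix x) ∧
        ((x.foldl ParseState.next .lit).accepts →
          ∃ v C y, IsMatrix y ∧ x = Var.encode v ++ (encLits C ++ y)) ∧
        ((x.foldl ParseState.next .clause).accepts →
          ∃ l C y, IsMatrix y ∧ x = encLits (l :: C) ++ y) ∧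
        ((x.foldl ParseState.next .start).accepts → IsPrenex x) ∧
        ((x.foldl ParseState.next .quant).accepts → ∃ v y, IsPrenex y ∧ x = Var.encode v ++ y) := by
      intro x
      induction x with
      | nil =>
        refine ⟨fun _ => ⟨[], by simp, rfl⟩, fun _ => ⟨[], [], [], ⟨[], by simp, rfl⟩, rfl⟩,
          fun h => h.elim, fun _ => ⟨[], [], by simp, rfl⟩,
          fun _ => ⟨[], [], ⟨[], [], by simp, rfl⟩, rfl⟩⟩
      | cons t x ih =>
        obtain ⟨i1, i2, i3, i4, i5⟩ := ih
        have fail : ¬ (x.foldl ParseState.next .fail).accepts := by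
          rw [foldl_fail]; exact id
        have mtop : (x.foldl ParseState.next .top).accepts → IsMatrix (.top :: x) := fun h => by
          obtain ⟨ms, h1, rfl⟩ := i1 h
          exact ⟨.top :: ms, by simpa using h1, rfl⟩
        have mcl : (x.foldl ParseState.next .clause).accepts → IsMatrix (.clause :: x) := by
          intro h
          obtain ⟨l, C, _, ⟨ms, h1, rfl⟩, rfl⟩ := i3 h
          refine ⟨.clause (l :: C) :: ms, fun D hD => ?_, by simp⟩
          rcases List.mem_cons.mp hD with hD | hD
          · cases hD; simp
          · exact h1 D hD
        have pre : ∀ {y}, IsMatrix y → IsPrenex y := fun ⟨ms, h1, h2⟩ => ⟨[], ms, h1, h2⟩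
        have qu : ∀ q : Quantifier, (x.foldl ParseState.next .quant).accepts →
            IsPrenex (q.token :: x) := by
          intro q h
          obtain ⟨v, _, ⟨qs, ms, h1, rfl⟩, rfl⟩ := i5 h
          exact ⟨(q, v) :: qs, ms, h1, by simp⟩
        have li : ∀ s, (x.foldl ParseState.next .lit).accepts →
            ∃ l C y, IsMatrix y ∧ .lit s :: x = encLits (l :: C) ++ y := by
          intro s h
          obtain ⟨v, C, y, hy, rfl⟩ := i2 h
          exact ⟨⟨s, v⟩, C, y, hy, by simp⟩
        have none_lit : ∀ {y}, IsMatrix y → ∃ v C z, IsMatrix z ∧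
            y = Var.encode v ++ (encLits C ++ z) := fun {y} hy => ⟨[], [], y, hy, rfl⟩
        have none_q : ∀ {y}, IsPrenex y → ∃ v z, IsPrenex z ∧ y = Var.encode v ++ z :=
          fun {y} hy => ⟨[], y, hy, rfl⟩
        cases t with
        | all => exact ⟨fun h => (fail h).elim, fun h => (fail h).elim, fun h => (fail h).elim,
            fun h => qu .all h, fun h => none_q (qu .all h)⟩
        | ex => exact ⟨fun h => (fail h).elim, fun h => (fail h).elim, fun h => (fail h).elim,
            fun h => qu .ex h, fun h => none_q (qu .ex h)⟩
        | bit b =>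
          refine ⟨fun h => (fail h).elim, fun h => ?_, fun h => (fail h).elim,
            fun h => (fail h).elim, fun h => ?_⟩
          · obtain ⟨v, C, y, hy, rfl⟩ := i2 h
            exact ⟨b :: v, C, y, hy, rfl⟩
          · obtain ⟨v, y, hy, rfl⟩ := i5 h
            exact ⟨b :: v, y, hy, rfl⟩
        | lit s =>
          refine ⟨fun h => (fail h).elim, fun h => ?_, fun h => li s h,
            fun h => (fail h).elim, fun h => (fail h).elim⟩
          obtain ⟨l, C, y, hy, h⟩ := li s h
          exact ⟨[], l :: C, y, hy, h⟩
        | clause => exact ⟨fun h => mcl h, fun h => none_lit (mcl h), fun h => (fail h).elim,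
            fun h => pre (mcl h), fun h => none_q (pre (mcl h))⟩
        | top => exact ⟨fun h => mtop h, fun h => none_lit (mtop h), fun h => (fail h).elim,
            fun h => pre (mtop h), fun h => none_q (pre (mtop h))⟩
        | no => exact ⟨fun h => (fail h).elim, fun h => (fail h).elim, fun h => (fail h).elim,
            fun h => (fail h).elim, fun h => (fail h).elim⟩
    exact (key x).2.2.2.1
  · rintro ⟨qs, ms, h, rfl⟩
    have key : ∀ s : ParseState, s = .start ∨ s = .quant →
        ((encQuants qs ++ encMatrix ms).foldl ParseState.next s).accepts := by
      induction qs with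
      | nil => exact fun s hs => foldl_encMatrix h (by rcases hs with rfl | rfl <;> simp)
      | cons p qs ih =>
        intro s hs
        obtain ⟨q, v⟩ := p
        rw [encQuants_cons, List.cons_append, List.foldl_cons, List.append_assoc, List.foldl_append,
          show s.next q.token = .quant by
            rcases hs with rfl | rfl <;> cases q <;> rfl, foldl_bits v (Or.inl rfl)]
        exact ih _ (Or.inr rfl)
    exact key _ (Or.inl rfl)

/-- The word encodes a closed formula. -/
def IsFormula (x : List Token) : Prop :=
  (x.foldl ParseState.next .start).accepts ∧ (scan quantName x).Nodup ∧
    (∀ v ∈ scan litName x, v ∈ scan quantName x) ∧ (scan clauseBody x).Nodup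

theorem isFormula_iff {x : List Token} : IsFormula x ↔ ∃ Φ : QCNF, Φ.Closed ∧ Φ.encode = x := by
  constructor
  · rintro ⟨h1, h2, h3, h4⟩
    obtain ⟨qs, ms, h, rfl⟩ := (accepts_iff x).mp h1
    rw [scan_quantName] at h2 h3
    refine ⟨⟨qs, ms, h2, h, (nodup_scan_clauseBody qs ms).mp h4⟩, fun C hC l hl => ?_, rfl⟩
    exact h3 _ ((scan_litName qs ms _).mpr ⟨C, hC, l, hl, rfl⟩)
  · rintro ⟨Φ, hc, rfl⟩
    rw [QCNF.encode_eq]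
    refine ⟨(accepts_iff _).mpr ⟨_, _, Φ.nonempty_clauses, rfl⟩, ?_, fun v hv => ?_,
      (nodup_scan_clauseBody _ _).mpr Φ.different_clauses⟩
    · rw [scan_quantName]; exact Φ.nodup_vars
    · rw [scan_quantName]
      obtain ⟨C, hC, l, hl, rfl⟩ := (scan_litName _ _ v).mp hv
      exact hc C hC l hl

end MFSearch
namespace MFSearch

/-! ### Evaluation of formulas on positions of the input -/

/-- There is a quantifier at position `u`. -/
def QuantAt (x : List Token) (u : ℕ) : Prop := x[u]? = some .all ∨ x[u]? = some .ex

/-- The variable at the beginning of `ts` has the value `s` under the assignment `a`, a number whose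
bits are the values of the variables quantified at the corresponding positions of `x`. -/
def LitSat (x : List Token) (a : ℕ) (s : Bool) (ts : List Token) : Prop :=
  ∃ u < x.length, QuantAt x u ∧ bitsOf (x.drop (u + 1)) = bitsOf ts ∧ a.testBit u = s

/-- The clause at the beginning of a word is satisfied. -/
def BlockSat (x : List Token) (a : ℕ) : List Token → Prop
  | .lit s :: ts => LitSat x a s ts ∨ BlockSat x a ts
  | .bit _ :: ts => BlockSat x a ts
  | _ => False

/-- All clauses outside the set `S` of positions are satisfied, in a word that begins at
position `c`. -/
def MatrixSat (x : List Token) (S : ℕ → Bool) (a : ℕ) : List Token → ℕ → Prop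
  | [], _ => True
  | t :: ts, c => (t = .clause → S c = false → BlockSat x a ts) ∧ MatrixSat x S a ts (c + 1)

/-- Evaluation of the quantifiers of a word that begins at position `c`. -/
def QEval (φ : ℕ → Prop) : List Token → ℕ → ℕ → Prop
  | [], _, a => φ a
  | .all :: ts, c, a => QEval φ ts (c + 1) a ∧ QEval φ ts (c + 1) (a + 2 ^ c)
  | .ex :: ts, c, a => QEval φ ts (c + 1) a ∨ QEval φ ts (c + 1) (a + 2 ^ c)
  | _ :: ts, c, a => QEval φ ts (c + 1) a

/-- The formula `x` without the clauses at the positions in `S` is true. -/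
def Eval (x : List Token) (S : ℕ → Bool) : Prop := QEval (fun a => MatrixSat x S a x 0) x 0 0

/-- The conjuncts with those at the positions in `S` replaced by TRUE, the first one being at
position `c`. -/
def mask (S : ℕ → Bool) : ℕ → List Conjunct → List Conjunct
  | _, [] => []
  | c, .top :: ms => .top :: mask S (c + 1) ms
  | c, .clause C :: ms =>
    (if S c then .top else .clause C) :: mask S (c + 1 + (encLits C).length) ms

theorem weaker_mask (S : ℕ → Bool) (c : ℕ) (ms : List Conjunct) : Weaker ms (mask S c ms) := by
  induction ms generalizing c with
  | nil => exact .nil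
  | cons m ms ih =>
    cases m with
    | top => exact .cons (Or.inl rfl) (ih _)
    | clause C =>
      refine .cons ?_ (ih _)
      split_ifs <;> simp

theorem mask_mono {S S' : ℕ → Bool} (h : ∀ i, S i = true → S' i = true) (c : ℕ)
    (ms : List Conjunct) : Weaker (mask S c ms) (mask S' c ms) := by
  induction ms generalizing c with
  | nil => exact .nil
  | cons m ms ih =>
    cases m with
    | top => exact .cons (Or.inl rfl) (ih _)
    | clause C =>
      refine .cons ?_ (ih _)
      by_cases h1 : S c = true
      · simp [h1, h c h1]
      · split_ifs <;> simp

theorem mask_congr {S S' : ℕ → Bool} {c : ℕ} (h : ∀ i, c ≤ i → S i = S' i)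
    (ms : List Conjunct) : mask S c ms = mask S' c ms := by
  induction ms generalizing c with
  | nil => rfl
  | cons m ms ih =>
    cases m with
    | top => simp only [mask]; rw [ih fun i hi => h i (by omega)]
    | clause C => simp only [mask]; rw [ih fun i hi => h i (by omega), h c le_rfl]

theorem mask_empty (c : ℕ) (ms : List Conjunct) : mask (fun _ => false) c ms = ms := by
  induction ms generalizing c with
  | nil => rfl
  | cons m ms ih => cases m <;> simp [mask, ih]

/-- A weakening of a masked matrix is trivial or masks a further clause. -/
theorem Weaker.eq_or_exists {S : ℕ → Bool} {c : ℕ} {ms ms' : List Conjunct}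
    (h : Weaker (mask S c ms) ms') : ms' = mask S c ms ∨
      ∃ p, c ≤ p ∧ (encMatrix ms)[p - c]? = some .clause ∧ S p = false ∧
        Weaker (mask (fun i => S i || decide (i = p)) c ms) ms' := by
  induction ms generalizing c ms' with
  | nil => cases h; exact Or.inl rfl
  | cons m ms ih =>
    cases m with
    | top =>
      cases h with
      | cons h1 h2 =>
        have h1 := or_self_iff.mp h1
        subst h1
        rcases ih h2 with rfl | ⟨p, hp, h3, h4, h5⟩
        · exact Or.inl rfl
        · refine Or.inr ⟨p, by omega, ?_, h4, .cons (Or.inl rfl) h5⟩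
          rw [show p - c = p - (c + 1) + 1 by omega]
          exact h3
    | clause C =>
      cases h with
      | @cons _ d _ ds h1 h2 =>
        by_cases hd : d = if S c then Conjunct.top else .clause C
        · rcases ih h2 with rfl | ⟨p, hp, h3, h4, h5⟩
          · exact Or.inl (by rw [hd]; rfl)
          · refine Or.inr ⟨p, by omega, ?_, h4, .cons (Or.inl ?_) h5⟩
            · rw [show p - c = p - (c + 1 + (encLits C).length) + (encLits C).length + 1 by omega]
              rw [encMatrix_clause, List.getElem?_cons_succ,
                List.getElem?_append_right (Nat.le_add_left _ _), Nat.add_sub_cancel]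
              exact h3
            · rw [hd]
              simp [show c ≠ p by omega]
        · have hS : S c = false := by
            by_contra hS
            simp [show S c = true by simpa using hS] at h1 hd
            exact hd h1
          obtain rfl := h1.resolve_left hd
          refine Or.inr ⟨c, le_rfl, by simp, hS, .cons (Or.inl (by simp)) ?_⟩
          rwa [mask_congr (S' := S)]
          intro i hi
          simp [show i ≠ c by omega]

/-- The formula with the clauses at the positions in `S` replaced by TRUE. -/
def QCNF.mask (Φ : QCNF) (S : ℕ → Bool) : QCNF :=
  Φ.weaken _ (weaker_mask S (encQuants Φ.quants).length Φ.matrix)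

theorem QCNF.mask_mem_weakenings (Φ : QCNF) (S : ℕ → Bool) : Φ.mask S ∈ Φ.weakenings :=
  mem_weakenings.mpr ⟨rfl, weaker_mask _ _ _⟩

section eval
variable {x : List Token} {a : ℕ} {τ : Valuation}

theorem blockSat_bits_append (v : Var) (ts : List Token) :
    BlockSat x a (Var.encode v ++ ts) = BlockSat x a ts := by
  induction v with
  | nil => rfl
  | cons b v ih => exact ih

/-- The hypothesis `h` expresses that the number `a` and the valuation `τ` agree on the variables of
the clause, where `a` is consulted at the position of the quantifier that binds the variable. -/
theorem blockSat_append {C : List Literal} {ts : List Token} (hts : Stops ts)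
    (h : ∀ l ∈ C, ∀ s ts', bitsOf ts' = l.var → (LitSat x a s ts' ↔ τ l.var = s)) :
    BlockSat x a (encLits C ++ ts) ↔ ∃ l ∈ C, l.Holds τ := by
  induction C with
  | nil =>
    rcases ts with _ | ⟨t, ts⟩
    · simp [BlockSat]
    · cases t <;> simp_all [Stops, Token.isInner, BlockSat]
  | cons l C ih =>
    rw [encLits_cons, List.cons_append, List.append_assoc, BlockSat, blockSat_bits_append,
      ih fun l hl => h l (List.mem_cons_of_mem _ hl),
      h l List.mem_cons_self _ _ (bitsOf_append _ (encLits_append_ne_bit hts C))]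
    simp [Literal.Holds]

theorem matrixSat_append {S : ℕ → Bool} {l : List Token} (hl : ∀ t ∈ l, t ≠ .clause)
    (ts : List Token) (c : ℕ) :
    MatrixSat x S a (l ++ ts) c ↔ MatrixSat x S a ts (c + l.length) := by
  induction l generalizing c with
  | nil => rfl
  | cons t l ih =>
    rw [List.cons_append, MatrixSat, ih fun t ht => hl t (List.mem_cons_of_mem _ ht),
      List.length_cons, show c + 1 + l.length = c + (l.length + 1) by omega]
    simp [hl t List.mem_cons_self]

theorem matrixSat_encMatrix {S : ℕ → Bool} {ms : List Conjunct} (c : ℕ)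
    (h : ∀ C, Conjunct.clause C ∈ ms → ∀ l ∈ C, ∀ s ts', bitsOf ts' = l.var →
      (LitSat x a s ts' ↔ τ l.var = s)) :
    MatrixSat x S a (encMatrix ms) c ↔ ∀ d ∈ mask S c ms, d.Holds τ := by
  induction ms generalizing c with
  | nil => simp [MatrixSat, mask]
  | cons m ms ih =>
    have ih' := fun c => ih c fun C hC => h C (List.mem_cons_of_mem _ hC)
    cases m with
    | top =>
      rw [encMatrix_top, MatrixSat, ih']
      simp [mask, Conjunct.Holds]
    | clause C =>
      rw [encMatrix_clause, MatrixSat, blockSat_append (stops_encMatrix ms)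
        (h C List.mem_cons_self), matrixSat_append, ih']
      · by_cases hS : S c = true
        · simp [mask, hS, Conjunct.Holds]
        · simp [mask, hS, Conjunct.Holds]
      · rintro _ ht rfl
        simpa [Token.isInner] using isInner_of_mem_encLits ht

theorem ne_clause_of_mem_encQuants {qs : List (Quantifier × Var)} {t : Token}
    (h : t ∈ encQuants qs) : t ≠ .clause := by
  obtain ⟨⟨q, v⟩, -, ht⟩ := List.mem_flatMap.mp h
  rcases List.mem_cons.mp ht with rfl | ht
  · cases q <;> simp [Quantifier.token]
  · obtain ⟨b, -, rfl⟩ := List.mem_map.mp ht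
    simp

theorem QEval_append {φ : ℕ → Prop} {l : List Token} (hl : ∀ t ∈ l, t ≠ .all ∧ t ≠ .ex)
    (ts : List Token) (c a : ℕ) :
    QEval φ (l ++ ts) c a ↔ QEval φ ts (c + l.length) a := by
  induction l generalizing c with
  | nil => rfl
  | cons t l ih =>
    have h1 : QEval φ (t :: (l ++ ts)) c a ↔ QEval φ (l ++ ts) (c + 1) a := by
      cases t <;> simp_all [QEval]
    rw [List.cons_append, h1, ih fun t ht => hl t (List.mem_cons_of_mem _ ht),
      List.length_cons, show c + 1 + l.length = c + (l.length + 1) by omega]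

theorem ne_quant_of_mem_encMatrix {ms : List Conjunct} {t : Token} (h : t ∈ encMatrix ms) :
    t ≠ .all ∧ t ≠ .ex := by
  obtain ⟨c, -, ht⟩ := List.mem_flatMap.mp h
  cases c with
  | top => simp [Conjunct.encode] at ht; subst ht; simp
  | clause C =>
    rcases List.mem_cons.mp ht with rfl | ht
    · simp
    · have := isInner_of_mem_encLits ht
      constructor <;> rintro rfl <;> simp [Token.isInner] at this

end eval

theorem testBit_add_two_pow {a c : ℕ} (ha : a < 2 ^ c) (b : Bool) :
    (a + cond b (2 ^ c) 0).testBit c = b := by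
  cases b
  · simpa using Nat.testBit_lt_two_pow ha
  · simp [Nat.add_comm a, Nat.testBit_two_pow_add_eq, Nat.testBit_lt_two_pow ha]

theorem testBit_add_two_pow_of_lt {a c u : ℕ} (hu : u < c) (b : Bool) :
    (a + cond b (2 ^ c) 0).testBit u = a.testBit u := by
  cases b
  · simp
  · simp [Nat.add_comm a, Nat.testBit_two_pow_add_gt hu]

/-- Induction over the prefix that remains after `pre`. The valuation agrees with the bits of `a` at
the quantifiers already passed, and `a < 2 ^ pre.length` says that later bits are still `0`, so that
adding `2 ^ c` sets bit `c`. As the quantified names are different, a new value does not disturb the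
earlier ones. -/
theorem quantify_iff_QEval {φ : ℕ → Prop} {Φ : Valuation → Prop} {ms : List Conjunct}
    {x : List Token}
    (hnodup : ∀ u u', u' < u → QuantAt x u → QuantAt x u' →
      bitsOf (x.drop (u + 1)) ≠ bitsOf (x.drop (u' + 1)))
    (hφ : ∀ σ a, (∀ u, QuantAt x u → σ (bitsOf (x.drop (u + 1))) = a.testBit u) → (Φ σ ↔ φ a))
    (qs : List (Quantifier × Var)) :
    ∀ (pre : List Token) (σ : Valuation) (a : ℕ), x = pre ++ (encQuants qs ++ encMatrix ms) →
      a < 2 ^ pre.length →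
      (∀ u < pre.length, QuantAt x u → σ (bitsOf (x.drop (u + 1))) = a.testBit u) →
      (quantify qs Φ σ ↔ QEval φ (encQuants qs ++ encMatrix ms) pre.length a) := by
  induction qs with
  | nil =>
    intro pre σ a hx _ h
    have h1 := QEval_append (φ := φ) (l := encMatrix ms) (fun t ht => ne_quant_of_mem_encMatrix ht)
      [] pre.length a
    rw [List.append_nil] at h1
    refine Iff.trans (hφ σ a fun u hu => ?_) h1.symm
    rcases lt_or_ge u pre.length with hlt | hge
    · exact h u hlt hu
    · exfalso
      rw [QuantAt, hx, List.getElem?_append_right hge] at hu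
      rcases hu with hu | hu
      · exact (ne_quant_of_mem_encMatrix (List.mem_of_getElem? hu)).1 rfl
      · exact (ne_quant_of_mem_encMatrix (List.mem_of_getElem? hu)).2 rfl
  | cons p qs ih =>
    obtain ⟨q, v⟩ := p
    intro pre σ a hx ha h
    set c := pre.length with hc
    rw [encQuants_cons, List.cons_append, List.append_assoc] at hx ⊢
    simp only at hx ⊢
    have hx' : x = (pre ++ q.token :: Var.encode v) ++ (encQuants qs ++ encMatrix ms) := by
      rw [hx]; simp
    have hlen : (pre ++ q.token :: Var.encode v).length = c + 1 + (Var.encode v).length := by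
      simp [hc]; omega
    have hqc : QuantAt x c := by
      rw [QuantAt, hx, List.getElem?_append_right (by omega), hc, Nat.sub_self]
      cases q <;> simp [Quantifier.token]
    have hname : bitsOf (x.drop (c + 1)) = v := by
      rw [hx, List.drop_append, List.drop_eq_nil_of_le (by omega), hc]
      simpa using bitsOf_append v (stops_encode qs ms).ne_bit
    have step : ∀ b, quantify qs Φ (Function.update σ v b) ↔
        QEval φ (Var.encode v ++ (encQuants qs ++ encMatrix ms)) (c + 1)
          (a + cond b (2 ^ c) 0) := by
      intro b
      rw [QEval_append (fun t ht => ?_), ← hlen]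
      · refine ih _ _ _ hx' ?_ fun u hu hqu => ?_
        · rw [hlen]
          calc a + cond b (2 ^ c) 0 < 2 ^ c + 2 ^ c := by cases b <;> simp <;> omega
            _ = 2 ^ (c + 1) := by rw [pow_succ]; omega
            _ ≤ _ := Nat.pow_le_pow_right (by omega) (by omega)
        · rcases lt_trichotomy u c with huc | rfl | huc
          · rw [Function.update_of_ne, h u huc hqu, testBit_add_two_pow_of_lt huc]
            rw [← hname]
            exact fun h' => hnodup c u huc hqc hqu h'.symm
          · rw [hname, Function.update_self, testBit_add_two_pow ha]
          · exfalso
            rw [hlen] at hu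
            rw [QuantAt, hx, List.getElem?_append_right (by omega),
              show u - pre.length = u - c - 1 + 1 by omega, List.getElem?_cons_succ,
              List.getElem?_append_left (by omega)] at hqu
            rcases hqu with hqu | hqu
            · simpa [Token.isBit] using isBit_of_mem_encode (List.mem_of_getElem? hqu)
            · simpa [Token.isBit] using isBit_of_mem_encode (List.mem_of_getElem? hqu)
      · have := isBit_of_mem_encode ht
        constructor <;> rintro rfl <;> simp [Token.isBit] at this
    cases q with
    | all =>
      have h1 := step false
      have h2 := step true
      simp only [cond_false, cond_true, add_zero] at h1 h2
      simp only [quantify, Quantifier.token, QEval, Bool.forall_bool, h1, h2]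
    | ex =>
      have h1 := step false
      have h2 := step true
      simp only [cond_false, cond_true, add_zero] at h1 h2
      simp only [quantify, Quantifier.token, QEval, Bool.exists_bool, h1, h2]

theorem quantName_eq_some {x : List Token} {u : ℕ} {v : Var} :
    (∃ t, x[u]? = some t ∧ quantName t (x.drop (u + 1)) = some v) ↔
      QuantAt x u ∧ bitsOf (x.drop (u + 1)) = v := by
  constructor
  · rintro ⟨t, h1, h2⟩
    cases t <;> simp_all [quantName, QuantAt]
  · rintro ⟨h | h, h2⟩
    · exact ⟨_, h, by simpa [quantName] using h2⟩
    · exact ⟨_, h, by simpa [quantName] using h2⟩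

theorem QuantAt.lt_length {x : List Token} {u : ℕ} (h : QuantAt x u) : u < x.length := by
  rcases h with h | h <;> exact (List.getElem?_eq_some_iff.mp h).1

/-- The bridge between the semantics of formulas and the evaluation on positions. Closedness
provides a quantifier position for every literal; in particular the valuation `σ` plays no role. -/
theorem holds_mask_iff {Φ : QCNF} (hΦ : Φ.Closed) (S : ℕ → Bool) (σ : Valuation) :
    (Φ.mask S).Holds σ ↔ Eval Φ.encode S := by
  set x := Φ.encode with hx
  have hn : (scan quantName x).Nodup := by
    rw [hx, QCNF.encode_eq, scan_quantName]; exact Φ.nodup_vars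
  have hnodup : ∀ u u', u' < u → QuantAt x u → QuantAt x u' →
      bitsOf (x.drop (u + 1)) ≠ bitsOf (x.drop (u' + 1)) := by
    intro u u' huu h h' heq
    obtain ⟨t, h1, h2⟩ := quantName_eq_some.mpr ⟨h, rfl⟩
    obtain ⟨t', h1', h2'⟩ := quantName_eq_some.mpr ⟨h', heq.symm⟩
    exact nodup_scan.mp hn u h.lt_length u' huu t t' h1 h1' _ h2 h2'
  refine quantify_iff_QEval hnodup (fun τ a hτ => ?_) Φ.quants [] σ 0 rfl (by simp) (by simp)
  change _ ↔ MatrixSat x S a (encQuants Φ.quants ++ encMatrix Φ.matrix) 0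
  rw [matrixSat_append (fun t ht => ne_clause_of_mem_encQuants ht), Nat.zero_add]
  refine (matrixSat_encMatrix _ fun C hC l hl s ts' hts => ?_).symm
  constructor
  · rintro ⟨u, -, hu, h1, h2⟩
    rw [← hts, ← h1, hτ u hu, h2]
  · intro h
    have hmem : l.var ∈ scan quantName x := by
      rw [hx, QCNF.encode_eq, scan_quantName]; exact hΦ C hC l hl
    obtain ⟨u, hu, ht⟩ := mem_scan.mp hmem
    obtain ⟨hq, hname⟩ := quantName_eq_some.mp ht
    exact ⟨u, hu, hq, hname.trans hts.symm, by rw [← hτ u hq, hname, h]⟩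

theorem isFalse_mask_iff {Φ : QCNF} (hΦ : Φ.Closed) (S : ℕ → Bool) :
    (Φ.mask S).IsFalse ↔ ¬ Eval Φ.encode S := by
  simp [QCNF.IsFalse, holds_mask_iff hΦ]

theorem QCNF.mask_empty (Φ : QCNF) : Φ.mask (fun _ => false) = Φ := by
  ext1
  · rfl
  · exact MFSearch.mask_empty _ _

/-! ### The greedy weakening -/

open Classical in
/-- The set of clauses that are removed by the greedy algorithm from the first `i` positions, as a
number. -/
noncomputable def greedy (x : List Token) : ℕ → ℕ
  | 0 => 0
  | i + 1 => if x[i]? = some .clause ∧ ¬ Eval x (greedy x i + 2 ^ i).testBit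
      then greedy x i + 2 ^ i else greedy x i

theorem greedy_lt (x : List Token) (i : ℕ) : greedy x i < 2 ^ i := by
  induction i with
  | zero => simp [greedy]
  | succ i ih =>
    rw [greedy, pow_succ]
    split_ifs <;> omega

theorem greedy_testBit_succ (x : List Token) (i j : ℕ) (h : (greedy x i).testBit j = true) :
    (greedy x (i + 1)).testBit j = true := by
  have hj : j < i := by
    by_contra hj
    rw [Nat.testBit_lt_two_pow ((greedy_lt x i).trans_le
      (Nat.pow_le_pow_right (by omega) (not_lt.mp hj)))] at h
    cases h
  rw [greedy]
  split_ifs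
  · simpa [h] using testBit_add_two_pow_of_lt (a := greedy x i) hj true
  · exact h

theorem greedy_testBit_mono (x : List Token) {i k : ℕ} (hik : i ≤ k) (j : ℕ)
    (h : (greedy x i).testBit j = true) : (greedy x k).testBit j = true := by
  induction hik with
  | refl => exact h
  | step _ ih => exact greedy_testBit_succ x _ j ih

/-- The greedy process keeps the formula false. If a further clause `p` could be removed, compare
with stage `p`: there the removal of `p` made the formula true, and the set removed in the end is
even larger. -/
theorem isMF_greedy {Φ : QCNF} (hΦ : Φ.Closed) (hf : Φ.IsFalse) :
    Φ.mask (greedy Φ.encode Φ.encode.length).testBit ∈ Φ.MF := by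
  set x := Φ.encode with hx
  have hfalse : ∀ i, ¬ Eval x (greedy x i).testBit := by
    intro i
    induction i with
    | zero =>
      have h1 : (greedy x 0).testBit = fun _ => false := by funext j; simp [greedy]
      rw [h1, ← isFalse_mask_iff hΦ, QCNF.mask_empty]
      exact hf
    | succ i ih =>
      rw [greedy]
      split_ifs with h
      · exact h.2
      · exact ih
  refine ⟨⟨(isFalse_mask_iff hΦ _).mpr (hfalse _), fun Ψ hΨ hΨf => ?_⟩, Φ.mask_mem_weakenings _⟩
  obtain ⟨hq, hw⟩ := mem_weakenings.mp hΨ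
  rcases Weaker.eq_or_exists hw with h | ⟨p, hp, hcl, hS, hw'⟩
  · ext1
    · exact hq
    · exact h
  · exfalso
    have hxp : x[p]? = some .clause := by
      rw [hx, QCNF.encode_eq, List.getElem?_append_right hp]; exact hcl
    have hpn : p < x.length := (List.getElem?_eq_some_iff.mp hxp).1
    have hnot : ¬ (¬ Eval x (greedy x p + 2 ^ p).testBit) := by
      intro h
      have h1 : greedy x (p + 1) = greedy x p + 2 ^ p := by rw [greedy, if_pos ⟨hxp, h⟩]
      have h2 : (greedy x (p + 1)).testBit p = true := by
        rw [h1]; exact testBit_add_two_pow (greedy_lt x p) true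
      rw [greedy_testBit_mono x hpn p h2] at hS
      cases hS
    have hE := not_not.mp hnot
    -- `Ψ` lacks all clauses removed before stage `p`, and also `p`; so it is a weakening of a
    -- formula that `hE` shows to be true.
    refine hΨf (fun _ => true) (QCNF.holds_of_mem_weakenings
      (Φ := Φ.mask (greedy x p + 2 ^ p).testBit)
      (mem_weakenings.mpr ⟨hq, Weaker.trans (mask_mono (fun i hi => ?_) _ _) hw'⟩)
      ((holds_mask_iff hΦ _ _).mpr hE))
    rcases lt_trichotomy i p with h | rfl | h
    · have := testBit_add_two_pow_of_lt (a := greedy x p) h true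
      rw [cond_true] at this
      rw [greedy_testBit_mono x hpn.le i (this ▸ hi)]
      rfl
    · simp
    · exfalso
      rw [Nat.testBit_lt_two_pow] at hi
      · cases hi
      · have h1 := greedy_lt x p
        have h2 : 2 ^ (p + 1) ≤ 2 ^ i := Nat.pow_le_pow_right (by omega) h
        rw [pow_succ] at h2
        omega

/-! ### Evaluation by backtracking -/

/-- Backtracking may continue at position `u` of the assignment `a` when the matrix has the
value `b`. -/
def Resumes (x : List Token) (b : Prop) (a u : ℕ) : Prop :=
  ((b ∧ x[u]? = some .all) ∨ (¬ b ∧ x[u]? = some .ex)) ∧ a.testBit u = false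

open Classical in
/-- A step of backtracking. The states `0` and `1` are final, and `a + 2` stands for the
assignment `a`. -/
noncomputable def backtrack (x : List Token) (φ : ℕ → Prop) (s : ℕ) : ℕ :=
  if s < 2 then s else
    let u := Nat.findGreatest (fun u => 0 < u ∧ Resumes x (φ (s - 2)) (s - 2) (u - 1)) x.length
    if u = 0 then ind (φ (s - 2)) else (s - 2) % 2 ^ (u - 1) + 2 ^ (u - 1) + 2

theorem backtrack_le {x : List Token} {φ : ℕ → Prop} {s : ℕ} (hs : s ≤ 2 ^ x.length + 2) :
    backtrack x φ s ≤ 2 ^ x.length + 2 := by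
  classical
  rw [backtrack]
  split_ifs with h
  · exact hs
  · extract_lets u
    split_ifs with hu
    · exact (ind_le _).trans (by omega)
    · have h1 : u ≤ x.length := Nat.findGreatest_le _
      have h2 : 2 ^ (u - 1 + 1) ≤ 2 ^ x.length := Nat.pow_le_pow_right (by omega) (by omega)
      have h3 := Nat.mod_lt (s - 2) (show 0 < 2 ^ (u - 1) by positivity)
      rw [pow_succ] at h2
      omega

theorem backtrack_resume {x : List Token} {φ : ℕ → Prop} {a u : ℕ} (hu : u < x.length)
    (h : Resumes x (φ a) a u) (h' : ∀ v > u, ¬ Resumes x (φ a) a v) :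
    backtrack x φ (a + 2) = a % 2 ^ u + 2 ^ u + 2 := by
  classical
  have : Nat.findGreatest (fun u => 0 < u ∧ Resumes x (φ a) a (u - 1)) x.length = u + 1 := by
    rw [Nat.findGreatest_eq_iff]
    refine ⟨hu, fun _ => ⟨by omega, by simpa using h⟩, fun k hk _ hk' => ?_⟩
    exact h' (k - 1) (by omega) hk'.2
  simp [backtrack, this]

theorem backtrack_final {x : List Token} {φ : ℕ → Prop} {a : ℕ}
    (h' : ∀ v, ¬ Resumes x (φ a) a v) : backtrack x φ (a + 2) = ind (φ a) := by
  classical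
  have : Nat.findGreatest (fun u => 0 < u ∧ Resumes x (φ a) a (u - 1)) x.length = 0 := by
    rw [Nat.findGreatest_eq_zero_iff]
    exact fun k _ _ hk => h' _ hk.2
  simp [backtrack, this]

/-- `a` is the node of the evaluation tree reached before position `c`, and `ts` is the rest of the
word. Backtracking from the leftmost leaf below the node reaches a leaf `a'` below it whose matrix
value is the value of the whole subtree, and no quantifier inside the subtree wants to be resumed
there. What happens next is thus decided by the quantifiers before `c`, and no stack is needed. -/
theorem exists_backtrack (x : List Token) (φ : ℕ → Prop) (ts : List Token) :
    ∀ c a, x.drop c = ts → a < 2 ^ c → ∃ k < 2 ^ ts.length, ∃ a',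
      (backtrack x φ)^[k] (a + 2) = a' + 2 ∧ a' % 2 ^ c = a ∧ (φ a' ↔ QEval φ ts c a) ∧
      ∀ u ≥ c, ¬ Resumes x (φ a') a' u := by
  induction ts with
  | nil =>
    intro c a hx ha
    refine ⟨0, by simp, a, rfl, Nat.mod_eq_of_lt ha, Iff.rfl, fun u hu h => ?_⟩
    have : x.length ≤ u := (List.drop_eq_nil_iff.mp hx).trans hu
    simp [Resumes, List.getElem?_eq_none this] at h
  | cons t ts ih =>
    intro c a hx ha
    have hc : x[c]? = some t := by
      have := congrArg List.head? hx
      simpa [List.head?_drop] using this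
    have hcn : c < x.length := (List.getElem?_eq_some_iff.mp hc).1
    have hdrop : x.drop (c + 1) = ts := by
      rw [← List.tail_drop, hx]; rfl
    have ha1 : a < 2 ^ (c + 1) := by rw [pow_succ]; omega
    have ha2 : a + 2 ^ c < 2 ^ (c + 1) := by rw [pow_succ]; omega
    have mod1 : ∀ a', a' % 2 ^ (c + 1) = a → a' % 2 ^ c = a ∧ a'.testBit c = false := by
      intro a' h
      have h1 := mod_two_pow_add_one a' c
      cases hb : a'.testBit c
      · simp [hb] at h1; exact ⟨by omega, rfl⟩
      · simp [hb] at h1; omega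
    have mod2 : ∀ a', a' % 2 ^ (c + 1) = a + 2 ^ c → a' % 2 ^ c = a ∧ a'.testBit c = true := by
      intro a' h
      have h1 := mod_two_pow_add_one a' c
      have h2 := Nat.mod_lt a' (show 0 < 2 ^ c by positivity)
      cases hb : a'.testBit c
      · simp [hb] at h1; omega
      · simp [hb] at h1; exact ⟨by omega, rfl⟩
    have split : ∀ {P : ℕ → Prop}, ¬ P c → (∀ u ≥ c + 1, ¬ P u) → ∀ u ≥ c, ¬ P u := by
      intro P h0 h1 u hu
      rcases Nat.eq_or_lt_of_le hu with rfl | hu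
      · exact h0
      · exact h1 u hu
    obtain ⟨k₁, hk₁, a₁, r₁, m₁, v₁, n₁⟩ := ih (c + 1) a hdrop ha1
    have first : t ≠ .all → t ≠ .ex → ∃ k < 2 ^ (t :: ts).length, ∃ a',
        (backtrack x φ)^[k] (a + 2) = a' + 2 ∧ a' % 2 ^ c = a ∧ (φ a' ↔ QEval φ (t :: ts) c a) ∧
        ∀ u ≥ c, ¬ Resumes x (φ a') a' u := by
      intro h1 h2
      refine ⟨k₁, by rw [List.length_cons, pow_succ]; omega, a₁, r₁, (mod1 _ m₁).1, ?_,
        split (by simp [Resumes, hc, h1, h2]) n₁⟩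
      rw [v₁]
      cases t <;> simp_all [QEval]
    -- The branch with bit `0` ends in `a₁`. The next step resumes at `c`: it sets bit `c` and
    -- clears the later bits, which is the start of the branch with bit `1`. Two branches with fewer
    -- than `2 ^ ts.length` steps each, and one step in between, stay below twice that number.
    have second : Resumes x (φ a₁) a₁ c → ∃ k < 2 ^ (t :: ts).length, ∃ a',
        (backtrack x φ)^[k] (a + 2) = a' + 2 ∧ a' % 2 ^ c = a ∧
        (φ a' ↔ QEval φ ts (c + 1) (a + 2 ^ c)) ∧ a'.testBit c = true ∧
        ∀ u ≥ c + 1, ¬ Resumes x (φ a') a' u := by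
      intro hres
      obtain ⟨k₂, hk₂, a₂, r₂, m₂, v₂, n₂⟩ := ih (c + 1) (a + 2 ^ c) hdrop ha2
      refine ⟨k₂ + (1 + k₁), by rw [List.length_cons, pow_succ]; omega, a₂, ?_, (mod2 _ m₂).1, v₂,
        (mod2 _ m₂).2, n₂⟩
      rw [Function.iterate_add_apply, Function.iterate_add_apply, r₁, Function.iterate_one,
        backtrack_resume hcn hres n₁, (mod1 _ m₁).1, r₂]
    cases t with
    | all =>
      by_cases hφ : φ a₁
      · obtain ⟨k, hk, a', r, m, v, tb, n⟩ := second ⟨Or.inl ⟨hφ, hc⟩, (mod1 _ m₁).2⟩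
        refine ⟨k, hk, a', r, m, ?_, split (by simp [Resumes, tb]) n⟩
        exact v.trans ⟨fun h => ⟨v₁.mp hφ, h⟩, fun h => h.2⟩
      · refine ⟨k₁, by rw [List.length_cons, pow_succ]; omega, a₁, r₁, (mod1 _ m₁).1, ?_,
          split (by simp [Resumes, hc, hφ]) n₁⟩
        exact ⟨fun h => absurd h hφ, fun h => absurd (v₁.mpr h.1) hφ⟩
    | ex =>
      by_cases hφ : φ a₁
      · refine ⟨k₁, by rw [List.length_cons, pow_succ]; omega, a₁, r₁, (mod1 _ m₁).1, ?_,
          split (by simp [Resumes, hc, hφ]) n₁⟩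
        exact ⟨fun _ => Or.inl (v₁.mp hφ), fun _ => hφ⟩
      · obtain ⟨k, hk, a', r, m, v, tb, n⟩ := second ⟨Or.inr ⟨hφ, hc⟩, (mod1 _ m₁).2⟩
        refine ⟨k, hk, a', r, m, ?_, split (by simp [Resumes, tb]) n⟩
        exact v.trans ⟨Or.inr, fun h => h.resolve_left fun h => hφ (v₁.mpr h)⟩
    | _ => exact first (by simp) (by simp)

/-- At the root there is nothing left to resume, so the step after the last leaf yields the truth
value, which is then a fixed point. The exact number of steps is therefore immaterial. -/
theorem iterate_backtrack (x : List Token) (φ : ℕ → Prop) :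
    (backtrack x φ)^[2 ^ x.length] 2 = ind (QEval φ x 0 0) := by
  obtain ⟨k, hk, a', r, -, v, n⟩ := exists_backtrack x φ x 0 0 rfl (by simp)
  have hfix : backtrack x φ (ind (φ a')) = ind (φ a') := by
    have : ind (φ a') < 2 := by have := ind_le (φ a'); omega
    rw [backtrack, if_pos this]
  obtain ⟨m, hm⟩ : ∃ m, 2 ^ x.length = m + (1 + k) := ⟨2 ^ x.length - (1 + k), by omega⟩
  rw [zero_add] at r
  rw [hm, Function.iterate_add_apply, Function.iterate_add_apply, r, Function.iterate_one,
    backtrack_final fun u => n u (Nat.zero_le u), Function.iterate_fixed hfix, propext v]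

/-! ### The answer -/

def Token.isClause : Token → Bool
  | .clause => true
  | _ => false

/-- The word `ts` at position `c`, with the clauses at the positions in `S` replaced by TRUE. -/
def maskWord (S : ℕ → Bool) : List Token → ℕ → List Token
  | [], _ => []
  | t :: ts, c => (if t.isInner then [] else if t.isClause && S c then [.top]
      else t :: ts.takeWhile Token.isInner) ++ maskWord S ts (c + 1)

theorem maskWord_append {S : ℕ → Bool} {l : List Token} (hl : ∀ t ∈ l, t.isInner = true)
    (ts : List Token) (c : ℕ) : maskWord S (l ++ ts) c = maskWord S ts (c + l.length) := by
  induction l generalizing c with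
  | nil => rfl
  | cons t l ih =>
    rw [List.cons_append, maskWord, ih fun t ht => hl t (List.mem_cons_of_mem _ ht),
      List.length_cons, show c + 1 + l.length = c + (l.length + 1) by omega]
    simp [hl t List.mem_cons_self]

theorem maskWord_encMatrix (S : ℕ → Bool) (ms : List Conjunct) (c : ℕ) :
    maskWord S (encMatrix ms) c = encMatrix (mask S c ms) := by
  induction ms generalizing c with
  | nil => rfl
  | cons m ms ih =>
    cases m with
    | top =>
      have h0 : (encMatrix ms).takeWhile Token.isInner = [] :=
        takeWhile_encLits_append [] (stops_encMatrix ms)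
      rw [encMatrix_top, maskWord, ih, mask, encMatrix_top, h0]
      simp [Token.isInner, Token.isClause]
    | clause C =>
      rw [encMatrix_clause, maskWord, maskWord_append (fun t ht => isInner_of_mem_encLits ht), ih,
        mask, takeWhile_encLits_append C (stops_encMatrix ms)]
      cases h : S c <;> simp [Token.isInner, Token.isClause]

theorem maskWord_encode (S : ℕ → Bool) (Φ : QCNF) :
    maskWord S Φ.encode 0 = (Φ.mask S).encode := by
  have key : ∀ (qs : List (Quantifier × Var)) c,
      maskWord S (encQuants qs ++ encMatrix Φ.matrix) c =
      encQuants qs ++ encMatrix (MFSearch.mask S (c + (encQuants qs).length) Φ.matrix) := by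
    intro qs
    induction qs with
    | nil => exact fun c => maskWord_encMatrix S _ c
    | cons p qs ih =>
      intro c
      obtain ⟨q, v⟩ := p
      rw [encQuants_cons, List.cons_append, List.append_assoc, maskWord,
        maskWord_append (fun t ht => isInner_of_isBit (isBit_of_mem_encode ht)), ih,
        takeWhile_encode_append v (stops_encode qs _), List.length_cons, List.length_append,
        show c + 1 + (Var.encode v).length + (encQuants qs).length =
          c + ((Var.encode v).length + (encQuants qs).length + 1) by omega]
      cases q <;> simp [Quantifier.token, Token.isInner, Token.isClause]
  have := key Φ.quants 0
  rw [Nat.zero_add] at this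
  exact this

open Classical in
/-- The solution of the MF search problem found by the greedy algorithm. -/
noncomputable def answer (x : List Token) : List Token :=
  if IsFormula x ∧ ¬ Eval x (fun _ => false) then
    maskWord (greedy x x.length).testBit x 0
  else [.no]

theorem mfSearch_answer (x : List Token) : mfSearch x (answer x) := by
  have hiff : (IsFormula x ∧ ¬ Eval x (fun _ => false)) ↔
      ∃ Φ : QCNF, Φ.Closed ∧ Φ.encode = x ∧ Φ.IsFalse := by
    constructor
    · rintro ⟨h1, h2⟩
      obtain ⟨Φ, hc, rfl⟩ := isFormula_iff.mp h1
      rw [← isFalse_mask_iff hc, QCNF.mask_empty] at h2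
      exact ⟨Φ, hc, rfl, h2⟩
    · rintro ⟨Φ, hc, rfl, hf⟩
      refine ⟨isFormula_iff.mpr ⟨Φ, hc, rfl⟩, ?_⟩
      rwa [← isFalse_mask_iff hc, QCNF.mask_empty]
  rw [answer]
  split_ifs with h
  · obtain ⟨Φ, hc, rfl, hf⟩ := hiff.mp h
    exact Or.inl ⟨Φ, hc, rfl, hf, _, isMF_greedy hc hf, maskWord_encode _ _⟩
  · exact Or.inr ⟨fun h' => h (hiff.mpr h'), rfl⟩

theorem Weaker.length_le {l l' : List Conjunct} (h : Weaker l l') :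
    (encMatrix l').length ≤ (encMatrix l).length := by
  induction h with
  | nil => rfl
  | @cons c d l l' h _ ih =>
    rcases h with rfl | rfl
    · simp only [encMatrix, List.flatMap_cons, List.length_append] at ih ⊢
      omega
    · cases c <;> simp only [encMatrix_top, encMatrix_clause, List.length_cons, List.length_append]
        <;> omega

/-- Replacing a clause by TRUE does not lengthen the word. The additional `1` is for the answer `no`
on the empty input. -/
theorem length_le_of_mfSearch {x y : List Token} (h : mfSearch x y) : y.length ≤ x.length + 1 := by
  rcases h with ⟨Φ, -, rfl, -, Ψ, hΨ, rfl⟩ | ⟨-, rfl⟩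
  · obtain ⟨h1, h2⟩ := mem_weakenings.mp hΨ.2
    rw [QCNF.encode_eq, QCNF.encode_eq, h1, List.length_append, List.length_append]
    have := h2.length_le
    omega
  · simp

end MFSearch
namespace MFSearch

/-! ### The search problem is in FPSPACE -/

instance : Finite Token := by
  refine Finite.of_injective (β := Fin 7 × Bool) (fun
    | .all => (0, true)
    | .ex => (1, true)
    | .bit b => (2, b)
    | .lit s => (3, s)
    | .clause => (4, true)
    | .top => (5, true)
    | .no => (6, true)) ?_
  intro t t' h
  cases t <;> cases t' <;> simp_all

/-- The witness `k` is the common length of the two prefixes: the words agree before `k`, and both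
stop there. This makes equality of names and of clauses a bounded condition on positions. -/
theorem takeWhile_eq_takeWhile_iff {α : Type} (T : α → Bool) (l l' : List α) :
    l.takeWhile T = l'.takeWhile T ↔ ∃ k < l.length + 1,
      (∀ i < k, l[i]? = l'[i]? ∧ l[i]?.any T = true) ∧
      l[k]?.any T = false ∧ l'[k]?.any T = false := by
  induction l generalizing l' with
  | nil =>
    constructor
    · intro h
      refine ⟨0, by simp, by simp, by simp, ?_⟩
      cases l' with
      | nil => rfl
      | cons a l' =>
        by_contra hc
        rw [List.takeWhile_cons_of_pos (by simpa using hc)] at h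
        cases h
    · rintro ⟨k, hk, -, -, h⟩
      obtain rfl : k = 0 := by simpa using hk
      cases l' with
      | nil => rfl
      | cons a l' => rw [List.takeWhile_cons_of_neg (by simpa using h)]; rfl
  | cons a l ih =>
    by_cases ha : T a = true
    · rw [List.takeWhile_cons_of_pos ha]
      cases l' with
      | nil =>
        refine iff_of_false (by simp) ?_
        rintro ⟨_ | k, -, h1, h2, -⟩
        · simp [ha] at h2
        · simpa using (h1 0 (by omega)).1
      | cons a' l' =>
        by_cases ha' : T a' = true
        · rw [List.takeWhile_cons_of_pos ha', List.cons.injEq, ih]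
          constructor
          · rintro ⟨rfl, k, hk, h1, h2⟩
            refine ⟨k + 1, by simpa using hk, ?_, by simpa using h2⟩
            rintro (_ | i) hi
            · simp [ha]
            · simpa using h1 i (by omega)
          · rintro ⟨_ | k, hk, h1, h2⟩
            · simp [ha] at h2
            · refine ⟨by simpa using (h1 0 (by omega)).1, k, by simpa using hk, fun i hi => ?_,
                by simpa using h2⟩
              simpa using h1 (i + 1) (by omega)
        · rw [List.takeWhile_cons_of_neg ha']
          refine iff_of_false (by simp) ?_
          rintro ⟨_ | k, -, h1, h2, -⟩
          · simp [ha] at h2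
          · have := h1 0 (by omega)
            simp only [List.getElem?_cons_zero, Option.some.injEq, Option.any_some] at this
            exact ha' (this.1 ▸ this.2)
    · rw [List.takeWhile_cons_of_neg ha]
      cases l' with
      | nil =>
        refine iff_of_true rfl ⟨0, by simp, by simp, by simpa using ha, by simp⟩
      | cons a' l' =>
        by_cases ha' : T a' = true
        · rw [List.takeWhile_cons_of_pos ha']
          refine iff_of_false (by simp) ?_
          rintro ⟨_ | k, -, h1, -, h3⟩
          · simp [ha'] at h3
          · simpa [ha] using (h1 0 (by omega)).2
        · rw [List.takeWhile_cons_of_neg ha']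
          exact iff_of_true rfl ⟨0, by simp, by simp, by simpa using ha, by simpa using ha'⟩

section
open Ctx
variable {A : Type} {σ : Type} [Ctx A σ] {b : Bool}

theorem CmP.of_finite {α : Type} [Finite α] {F : σ → α} (hF : CmF b F) (P : α → Prop) :
    CmP b fun s => P (F s) := CmP.cases (P := fun a _ => P a) hF fun _ => .const _

theorem CmP.takeWhile_eq [Finite A] (T : A → Bool) {F G : σ → ℕ} (hF : Cm b F) (hG : Cm b G) :
    CmP b fun s => ((inp s).drop (F s)).takeWhile T = ((inp s).drop (G s)).takeWhile T := by
  have hs : ∀ {τ : Type} [Ctx A τ] {F G : τ → ℕ}, Cm b F → Cm b G →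
      CmF b fun s : τ => (inp s)[F s + G s]? := fun hF hG => CmF.getElem? (hF.add hG)
  refine ((CmP.bex (P := fun s k => (∀ i < k, (inp s)[F s + i]? = (inp s)[G s + i]? ∧
      (inp s)[F s + i]?.any T = true) ∧
      (inp s)[F s + k]?.any T = false ∧ (inp s)[G s + k]?.any T = false)
    ((Cm.length.sub hF).add (.const 1)) (.and (.ball
      (P := fun q i => (inp q)[F q.1 + i]? = (inp q)[G q.1 + i]? ∧ (inp q)[F q.1 + i]?.any T = true)
      Cm.snd (.and ?_ ?_)) (.and ?_ ?_))).congr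
    fun s => ?_)
  · exact CmP.of_finite ((hs hF.fst.fst Cm.snd).pair (hs hG.fst.fst Cm.snd)) fun p => p.1 = p.2
  · exact CmP.of_finite (hs hF.fst.fst Cm.snd) fun o => o.any T = true
  · exact CmP.of_finite (hs hF.fst Cm.snd) fun o => o.any T = false
  · exact CmP.of_finite (hs hG.fst Cm.snd) fun o => o.any T = false
  · simp only [takeWhile_eq_takeWhile_iff, List.getElem?_drop, List.length_drop]

end

theorem bitsOf_eq_iff (ts ts' : List Token) :
    bitsOf ts = bitsOf ts' ↔ ts.takeWhile Token.isBit = ts'.takeWhile Token.isBit := by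
  rw [takeWhile_isBit, takeWhile_isBit, List.map_inj_right fun _ _ h => by cases h; rfl]

/-- Unfolds the recursion into a search for a true literal at a position `r` that is reached from
`p` without leaving the clause. -/
theorem blockSat_drop_iff {x : List Token} {a p : ℕ} : BlockSat x a (x.drop p) ↔
    ∃ r < x.length, p ≤ r ∧ (∀ j < r, p ≤ j → x[j]?.any Token.isInner = true) ∧
      ∃ s, x[r]? = some (.lit s) ∧ LitSat x a s (x.drop (r + 1)) := by
  generalize h : x.drop p = ts
  induction ts generalizing p with
  | nil =>
    have := List.drop_eq_nil_iff.mp h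
    simp only [BlockSat, false_iff]
    rintro ⟨r, h1, h2, -⟩
    omega
  | cons t ts ih =>
    have hp : p < x.length := by
      by_contra hc
      rw [List.drop_eq_nil_iff.mpr (by omega)] at h
      cases h
    rw [List.drop_eq_getElem_cons hp, List.cons.injEq] at h
    obtain ⟨h1, h2⟩ := h
    have ih := ih h2
    have hxp : x[p]? = some t := by rw [List.getElem?_eq_getElem hp, h1]
    have step : t.isInner = true → ((∃ r < x.length, p ≤ r ∧
        (∀ j < r, p ≤ j → x[j]?.any Token.isInner = true) ∧
        ∃ s, x[r]? = some (.lit s) ∧ LitSat x a s (x.drop (r + 1))) ↔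
        (∃ s, t = .lit s ∧ LitSat x a s ts) ∨ BlockSat x a ts) := by
      intro ht
      rw [ih]
      constructor
      · rintro ⟨r, hr, hpr, hj, s, hs, hl⟩
        rcases hpr.eq_or_lt with rfl | hpr
        · refine Or.inl ⟨s, by rw [hxp] at hs; simpa using hs, h2 ▸ hl⟩
        · exact Or.inr ⟨r, hr, hpr, fun j h3 h4 => hj j h3 (by omega), s, hs, hl⟩
      · rintro (⟨s, rfl, hl⟩ | ⟨r, hr, hpr, hj, s, hs, hl⟩)
        · exact ⟨p, hp, le_rfl, fun j h3 h4 => by omega, s, hxp, by rwa [h2]⟩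
        · refine ⟨r, hr, by omega, fun j h3 h4 => ?_, s, hs, hl⟩
          rcases h4.eq_or_lt with rfl | h4
          · simpa [hxp] using ht
          · exact hj j h3 h4
    by_cases ht : t.isInner = true
    · rw [step ht]
      cases t <;> simp_all [BlockSat, Token.isInner]
    · refine iff_of_false (by cases t <;> simp_all [BlockSat, Token.isInner]) ?_
      rintro ⟨r, hr, hpr, hj, s, hs, hl⟩
      rcases hpr.eq_or_lt with rfl | hpr
      · rw [hxp] at hs
        cases hs
        exact ht rfl
      · have := hj p hpr le_rfl
        rw [hxp] at this
        exact ht this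

theorem matrixSat_iff {x : List Token} {S : ℕ → Bool} {a : ℕ} : MatrixSat x S a x 0 ↔
    ∀ p < x.length, x[p]? = some .clause → S p = false → BlockSat x a (x.drop (p + 1)) := by
  have key : ∀ (ts : List Token) c, MatrixSat x S a ts c ↔
      ∀ p < ts.length, ts[p]? = some .clause → S (c + p) = false →
        BlockSat x a (ts.drop (p + 1)) := by
    intro ts
    induction ts with
    | nil => simp [MatrixSat]
    | cons t ts ih =>
      intro c
      rw [MatrixSat, ih]
      constructor
      · rintro ⟨h1, h2⟩ (_ | p) hp ht hS
        · exact h1 (by simpa using ht) (by simpa using hS)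
        · exact h2 p (by simpa using hp) (by simpa using ht) 
            (by rwa [show c + 1 + p = c + (p + 1) by omega])
      · refine fun h => ⟨fun ht hS => h 0 (by simp) (by simp [ht]) hS, fun p hp ht hS => ?_⟩
        exact h (p + 1) (by simpa using hp) (by simpa using ht)
          (by rwa [show c + (p + 1) = c + 1 + p by omega])
  simpa using key x 0

section
open Ctx
variable {σ : Type} [Ctx Token σ] {b : Bool}

theorem CmP.bitsOf_eq {F G : σ → ℕ} (hF : Cm b F) (hG : Cm b G) :
    CmP b fun s => bitsOf ((inp s).drop (F s)) = bitsOf ((inp s).drop (G s)) :=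
  (CmP.takeWhile_eq Token.isBit hF hG).congr fun _ => bitsOf_eq_iff _ _

theorem CmP.quantAt {F : σ → ℕ} (hF : Cm b F) : CmP b fun s => QuantAt (inp s) (F s) :=
  .or (CmF.getElem? hF _) (CmF.getElem? hF _)

theorem CmP.testBit_eq {F G : σ → ℕ} (hF : Cm b F) (hG : Cm b G) (v : Bool) :
    CmP b fun s => (F s).testBit (G s) = v := by
  cases v
  · exact (CmP.testBit hF hG).not.congr fun s => by simp
  · exact CmP.testBit hF hG

theorem CmP.litSat {F G : σ → ℕ} (hF : Cm b F) (hG : Cm b G) (v : Bool) :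
    CmP b fun s => LitSat (inp s) (F s) v ((inp s).drop (G s)) :=
  CmP.bex (P := fun s u => QuantAt (inp s) u ∧ bitsOf ((inp s).drop (u + 1)) =
    bitsOf ((inp s).drop (G s)) ∧ (F s).testBit u = v) Cm.length
    (.and (.quantAt Cm.snd) (.and (.bitsOf_eq (Cm.snd.add (.const 1)) hG.fst)
      (.testBit_eq hF.fst Cm.snd v)))

theorem CmP.blockSat {F G : σ → ℕ} (hF : Cm b F) (hG : Cm b G) :
    CmP b fun s => BlockSat (inp s) (F s) ((inp s).drop (G s)) := by
  have hs : ∀ {τ : Type} [Ctx Token τ] {F G : τ → ℕ}, Cm b F → Cm b G → ∀ v,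
      CmP b fun s => (inp s)[G s]? = some (.lit v) ∧
        LitSat (inp s) (F s) v ((inp s).drop (G s + 1)) := fun hF hG v =>
    .and (CmF.getElem? hG _) (.litSat hF (hG.add (.const 1)) v)
  refine (CmP.bex (P := fun s r => G s ≤ r ∧ (∀ j < r, G s ≤ j →
      (inp s)[j]?.any Token.isInner = true) ∧
      ((inp s)[r]? = some (.lit false) ∧ LitSat (inp s) (F s) false ((inp s).drop (r + 1)) ∨
        (inp s)[r]? = some (.lit true) ∧ LitSat (inp s) (F s) true ((inp s).drop (r + 1))))
    Cm.length (.and (.of_le hG.fst Cm.snd)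
    (.and (.ball (P := fun q j => G q.1 ≤ j → (inp q)[j]?.any Token.isInner = true) Cm.snd
      (.imp (.of_le hG.fst.fst Cm.snd)
        (CmP.of_finite (CmF.getElem? Cm.snd) fun o => o.any Token.isInner = true)))
      (.or (hs hF.fst Cm.snd false) (hs hF.fst Cm.snd true))))).congr fun s => ?_
  rw [blockSat_drop_iff]
  simp only [Bool.exists_bool]

theorem CmP.matrixSat {K F : σ → ℕ} (hK : Cm b K) (hF : Cm b F) :
    CmP b fun s => MatrixSat (inp s) (K s).testBit (F s) (inp s) 0 :=
  (CmP.ball (P := fun s p => (inp s)[p]? = some .clause → (K s).testBit p = false →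
    BlockSat (inp s) (F s) ((inp s).drop (p + 1))) Cm.length
    (.imp (CmF.getElem? Cm.snd _) (.imp (.testBit_eq hK.fst Cm.snd _)
      (.blockSat hF.fst (Cm.snd.add (.const 1)))))).congr fun _ => matrixSat_iff

theorem Cm.two_pow_pred {F : σ → ℕ} (hF : Cm true F) (hle : ∀ s, F s ≤ (Ctx.inp s).length) :
    Cm true fun s => 2 ^ (F s - 1) :=
  (Cm.two_pow hF.pred).congr fun s => by rw [Nat.min_eq_left ((Nat.sub_le _ _).trans (hle s))]

theorem Cm.backtrack {K F : σ → ℕ} (hK : Cm true K) (hF : Cm true F) : Cm true fun s =>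
    MFSearch.backtrack (Ctx.inp s)
      (fun a => MatrixSat (Ctx.inp s) (K s).testBit a (Ctx.inp s) 0) (F s) := by
  classical
  have hM : CmP true fun s => MatrixSat (Ctx.inp s) (K s).testBit (F s - 2) (Ctx.inp s) 0 :=
    .matrixSat hK (hF.sub (.const 2))
  have hu : Cm true fun s => Nat.findGreatest (fun u => 0 < u ∧ Resumes (Ctx.inp s)
      (MatrixSat (Ctx.inp s) (K s).testBit (F s - 2) (Ctx.inp s) 0) (F s - 2) (u - 1))
      (Ctx.inp s).length :=
    Cm.findGreatest (P := fun s u => 0 < u ∧ Resumes (Ctx.inp s)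
      (MatrixSat (Ctx.inp s) (K s).testBit (F s - 2) (Ctx.inp s) 0) (F s - 2) (u - 1)) Cm.length
      (.and (.of_lt (.const 0) Cm.snd) (.and (.or (.and hM.fst (CmF.getElem? Cm.snd.pred _))
        (.and hM.fst.not (CmF.getElem? Cm.snd.pred _)))
        (.testBit_eq (hF.sub (.const 2)).fst Cm.snd.pred false)))
  have h2 := Cm.two_pow_pred hu fun s => Nat.findGreatest_le _
  exact Cm.ite (.of_lt hF (.const 2)) hF (Cm.ite (.of_eq hu (.const 0)) hM
    ((((hF.sub (.const 2)).mod h2).add h2).add (.const 2)))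

theorem Cm.two_pow_length : Cm true fun s : σ => 2 ^ (Ctx.inp s).length :=
  (Cm.two_pow Cm.length).congr fun s => by rw [Nat.min_self]

theorem iterate_eq_natRec {α : Type} (f : α → α) (a : α) (n : ℕ) :
    f^[n] a = Nat.rec a (fun _ a => f a) n := by
  induction n with
  | zero => rfl
  | succ n ih => rw [Function.iterate_succ_apply', ih]

/-- The truth value is the state of backtracking after `2 ^ |x|` rounds. States and round numbers
are exponentially bounded, that is, they have polynomially many digits. -/
theorem CmP.eval {K : σ → ℕ} (hK : Cm true K) :
    CmP true fun s => Eval (Ctx.inp s) (K s).testBit := by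
  refine (Cm.iter (N := fun s => 2 ^ (Ctx.inp s).length) (I := fun _ => 2)
    (M := fun s => 2 ^ (Ctx.inp s).length + 2)
    (G := fun s _ a => MFSearch.backtrack (Ctx.inp s)
      (fun a => MatrixSat (Ctx.inp s) (K s).testBit a (Ctx.inp s) 0) a) Cm.two_pow_length (.const 2)
    (Cm.backtrack hK.fst.fst Cm.snd) (Bdd.two_pow_length.add (.const 2)) fun s i _ => ?_).congr
    fun s => ?_
  · induction i with
    | zero => exact Nat.le_add_left _ _
    | succ i ih => exact backtrack_le (ih (by omega))
  · rw [← iterate_eq_natRec, iterate_backtrack]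
    rfl

theorem Cm.greedy {F : σ → ℕ} (hF : Cm true F) (hle : ∀ s, F s ≤ (Ctx.inp s).length) :
    Cm true fun s => MFSearch.greedy (Ctx.inp s) (F s) := by
  classical
  -- The exponent is cut off at the length of the word as `Cm.two_pow` demands. Beyond that length
  -- there are no clauses, so the recursion is unchanged.
  have hrec : ∀ x i, MFSearch.greedy x i = Nat.rec 0 (fun i K => if x[i]? = some .clause ∧
      ¬ Eval x (K + 2 ^ Min.min i x.length).testBit then K + 2 ^ Min.min i x.length else K) i := by
    intro x i
    induction i with
    | zero => rfl
    | succ i ih =>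
      simp only [MFSearch.greedy, ← ih]
      by_cases hi : i < x.length
      · rw [Nat.min_eq_left hi.le]
      · simp [List.getElem?_eq_none (not_lt.mp hi)]
  refine (Cm.iter (I := fun _ => 0) (M := fun s => 2 ^ (Ctx.inp s).length)
    (G := fun s i K => if (Ctx.inp s)[i]? = some .clause ∧
      ¬ Eval (Ctx.inp s) (K + 2 ^ Min.min i (Ctx.inp s).length).testBit then
        K + 2 ^ Min.min i (Ctx.inp s).length else K)
    hF (.const 0) ?_ Bdd.two_pow_length fun s i hi => ?_).congr fun s => hrec _ _
  · have h2 : Cm true fun q : (σ × ℕ) × ℕ => q.2 + 2 ^ Min.min q.1.2 (Ctx.inp q).length :=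
      Cm.snd.add (Cm.two_pow Cm.snd.fst)
    exact Cm.ite (.and (CmF.getElem? Cm.snd.fst _) (CmP.eval h2).not) h2 Cm.snd
  · rw [← hrec]
    exact (greedy_lt _ _).le.trans (Nat.pow_le_pow_right (by omega) (hi.trans (hle s)))


theorem CmP.isFormula : CmP b fun s : σ => IsFormula (Ctx.inp s) := by
  have h1 : CmP b fun s : σ => ((Ctx.inp s).foldl ParseState.next .start).accepts :=
    (CmP.of_finite (CmF.foldl ParseState.next .start Cm.length)
      fun q => q.accepts).congr fun s => by rw [List.take_length]
  have h2 : CmP b fun s : σ => (scan quantName (Ctx.inp s)).Nodup := by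
    refine (CmP.ball (P := fun s p => ∀ p' < p, QuantAt (Ctx.inp s) p → QuantAt (Ctx.inp s) p' →
      ¬ bitsOf ((Ctx.inp s).drop (p + 1)) = bitsOf ((Ctx.inp s).drop (p' + 1))) Cm.length
      (.ball (P := fun (q : σ × ℕ) p' => QuantAt (Ctx.inp q) q.2 → QuantAt (Ctx.inp q) p' →
      ¬ bitsOf ((Ctx.inp q).drop (q.2 + 1)) = bitsOf ((Ctx.inp q).drop (p' + 1))) Cm.snd
      (.imp (.quantAt Cm.snd.fst) (.imp (.quantAt Cm.snd) (CmP.not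
        (.bitsOf_eq (Cm.snd.fst.add (.const 1)) (Cm.snd.add (.const 1)))))))).congr fun s => ?_
    rw [nodup_scan]
    refine forall_congr' fun p => forall_congr' fun _ => forall_congr' fun p' =>
      forall_congr' fun _ => ⟨fun h hq hq' heq => ?_, fun h t t' ht ht' v hv hv' => ?_⟩
    · obtain ⟨t, h1, h2⟩ := quantName_eq_some.mpr ⟨hq, rfl⟩
      obtain ⟨t', h1', h2'⟩ := quantName_eq_some.mpr ⟨hq', rfl⟩
      exact h t t' h1 h1' _ h2 (heq ▸ h2')
    · obtain ⟨h1, h2⟩ := quantName_eq_some.mp ⟨t, ht, hv⟩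
      obtain ⟨h1', h2'⟩ := quantName_eq_some.mp ⟨t', ht', hv'⟩
      exact h h1 h1' (h2.trans h2'.symm)
  have h3 : CmP b fun s : σ => ∀ v ∈ scan litName (Ctx.inp s), v ∈ scan quantName (Ctx.inp s) := by
    refine (CmP.ball (P := fun s p => (Ctx.inp s)[p]? = some (.lit false) ∨
      (Ctx.inp s)[p]? = some (.lit true) → ∃ u < (Ctx.inp s).length, QuantAt (Ctx.inp s) u ∧
        bitsOf ((Ctx.inp s).drop (u + 1)) = bitsOf ((Ctx.inp s).drop (p + 1))) Cm.length
      (.imp (.or (CmF.getElem? Cm.snd _) (CmF.getElem? Cm.snd _))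
        (.bex (P := fun (q : σ × ℕ) u => QuantAt (Ctx.inp q) u ∧
          bitsOf ((Ctx.inp q).drop (u + 1)) = bitsOf ((Ctx.inp q).drop (q.2 + 1))) Cm.length
          (.and (.quantAt Cm.snd) (.bitsOf_eq (Cm.snd.add (.const 1))
            (Cm.snd.fst.add (.const 1))))))).congr fun s => ?_
    constructor
    · intro h p hp hl
      obtain ⟨u, hu, t, ht, hv⟩ := mem_scan.mp (h (bitsOf ((Ctx.inp s).drop (p + 1)))
        (mem_scan.mpr ⟨p, hp, by rcases hl with hl | hl <;> exact ⟨_, hl, rfl⟩⟩))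
      exact ⟨u, hu, quantName_eq_some.mp ⟨t, ht, hv⟩⟩
    · intro h v hv
      obtain ⟨p, hp, t, ht, hv⟩ := mem_scan.mp hv
      cases t <;> cases hv
      case mpr.lit.refl c =>
        obtain ⟨u, hu, hq⟩ := h p hp (by cases c <;> simp [ht])
        exact mem_scan.mpr ⟨u, hu, quantName_eq_some.mpr hq⟩
  have h4 : CmP b fun s : σ => (scan clauseBody (Ctx.inp s)).Nodup := by
    refine (CmP.ball (P := fun s p => ∀ p' < p, (Ctx.inp s)[p]? = some Token.clause →
      (Ctx.inp s)[p']? = some .clause → ¬ ((Ctx.inp s).drop (p + 1)).takeWhile Token.isInner =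
        ((Ctx.inp s).drop (p' + 1)).takeWhile Token.isInner) Cm.length
      (.ball (P := fun (q : σ × ℕ) p' => (Ctx.inp q)[q.2]? = some .clause →
        (Ctx.inp q)[p']? = some .clause → ¬ ((Ctx.inp q).drop (q.2 + 1)).takeWhile Token.isInner =
        ((Ctx.inp q).drop (p' + 1)).takeWhile Token.isInner) Cm.snd
      (.imp (CmF.getElem? Cm.snd.fst _) (.imp (CmF.getElem? Cm.snd _) (CmP.not
        (.takeWhile_eq _ (Cm.snd.fst.add (.const 1)) (Cm.snd.add (.const 1)))))))).congr
        fun s => ?_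
    rw [nodup_scan]
    refine forall_congr' fun p => forall_congr' fun _ => forall_congr' fun p' =>
      forall_congr' fun _ => ⟨fun h hq hq' heq => ?_, fun h t t' ht ht' v hv hv' => ?_⟩
    · exact h _ _ hq hq' _ rfl (congrArg some heq.symm)
    · cases t <;> try cases hv
      cases t' <;> try cases hv'
      exact h ht ht' (Option.some.inj hv').symm
  exact .and h1 (.and h2 (.and h3 h4))

theorem takeWhile_eq_flatMap {α : Type} (T : α → Bool) (l : List α) :
    l.takeWhile T = (List.range l.length).flatMap fun j =>
      if ∀ i < j + 1, l[i]?.any T = true then l[j]?.toList else [] := by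
  induction l with
  | nil => rfl
  | cons a l ih =>
    rw [List.length_cons, List.range_succ_eq_map, List.flatMap_cons, List.flatMap_map]
    by_cases ha : T a = true
    · rw [List.takeWhile_cons_of_pos ha, ih]
      simp only [Nat.forall_lt_succ_left' (n := _ + 1)]
      simp [ha]
    · rw [List.takeWhile_cons_of_neg ha]
      simp
      exact ⟨by simpa using ha, fun j _ h => absurd (h 0 (by omega)) (by simpa using ha)⟩

theorem Em.takeWhile {A : Type} [Finite A] {σ : Type} [Ctx A σ] (T : A → Bool) {F : σ → ℕ}
    (hF : Cm b F) : Em b fun s => ((Ctx.inp s).drop (F s)).takeWhile T := by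
  classical
  refine (Em.flatMap_range (G := fun s j => if ∀ i < j + 1, (Ctx.inp s)[F s + i]?.any T = true then
    (Ctx.inp s)[F s + j]?.toList else []) (Cm.length.sub hF) (Em.ite (CmP.ball
      (P := fun q i => (Ctx.inp q)[F q.1 + i]?.any T = true) (Cm.snd.add (.const 1))
      (CmP.of_finite (CmF.getElem? (hF.fst.fst.add Cm.snd)) fun o => o.any T = true))
      (Em.cases (G := fun o _ => o.toList) (CmF.getElem? (hF.fst.add Cm.snd)) fun o => Em.const _)
      Em.nil)).congr fun s => ?_
  rw [takeWhile_eq_flatMap, List.length_drop]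
  simp only [List.getElem?_drop]

theorem maskWord_eq_flatMap (S : ℕ → Bool) (ts : List Token) (c : ℕ) :
    maskWord S ts c = (List.range ts.length).flatMap fun p => match ts[p]? with
      | none => []
      | some t => if t.isInner then [] else if t.isClause && S (c + p) then [.top]
        else t :: (ts.drop (p + 1)).takeWhile Token.isInner := by
  induction ts generalizing c with
  | nil => rfl
  | cons t ts ih =>
    rw [List.length_cons, List.range_succ_eq_map, List.flatMap_cons, List.flatMap_map, maskWord, ih]
    simp [add_assoc, add_comm 1]

theorem Em.answer : Em true answer := by
  classical
  have h0 : CmP true fun x : List Token => Eval x fun _ => false :=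
    (CmP.eval (Cm.const 0)).congr fun s => by
      rw [show (fun _ => false) = Nat.testBit 0 by funext i; simp]; rfl
  have hg : Cm true fun x : List Token => MFSearch.greedy x x.length :=
    Cm.greedy (σ := List Token) Cm.length fun _ => le_rfl
  refine Em.ite (.and CmP.isFormula h0.not) ?_ (Em.single _)
  refine (Em.flatMap_range (σ := List Token) (N := List.length) (G := fun x p => match x[p]? with
      | none => []
      | some t => if t.isInner then [] else
          if t.isClause ∧ (MFSearch.greedy x x.length).testBit p = true then [.top]
          else t :: (x.drop (p + 1)).takeWhile Token.isInner) Cm.length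
    (Em.cases (F := fun q : List Token × ℕ => q.1[q.2]?) (CmF.getElem? (σ := List Token × ℕ) Cm.snd)
      (G := fun o q => match o with
        | none => []
        | some t => if t.isInner then [] else
          if t.isClause ∧ (MFSearch.greedy q.1 q.1.length).testBit q.2 = true then [.top]
          else t :: (q.1.drop (q.2 + 1)).takeWhile Token.isInner) fun o => ?_)).congr fun x => ?_
  · cases o with
    | none => exact Em.nil
    | some t =>
      exact Em.ite (.const _) Em.nil (Em.ite (.and (.const _) (.testBit hg.fst Cm.snd))
        (Em.single _) ((Em.takeWhile Token.isInner (σ := List Token × ℕ) (Cm.snd.add (.const 1))).cons t))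
  · rw [maskWord_eq_flatMap]
    simp

theorem isFPSPACE_mfSearch : IsFPSPACE mfSearch := by
  obtain ⟨M, hM, c, hc⟩ := Em.answer.polyspace
  refine ⟨(Polynomial.X + 2) ^ c + 2 + (Polynomial.X + 1), fun x y h => ?_,
    MFSearch.answer, M, hM, mfSearch_answer, fun x => ⟨_, hc x, ?_⟩⟩
  · have := length_le_of_mfSearch h
    simp
    omega
  · have := length_le_of_mfSearch (mfSearch_answer x)
    simp
    omega

theorem isComputable_answer : IsComputable MFSearch.answer :=
  let ⟨M, hM, _⟩ := Em.answer.polyspace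
  ⟨M, hM⟩

end
end MFSearch
namespace MFSearch

/-! ### The quantifier game over numbered variables -/

/-- The `i`-th variable. -/
def varName (i : ℕ) : Var := List.replicate i true

theorem varName_injective : Function.Injective varName := fun i j h => by
  simpa [varName] using congrArg List.length h

/-- Semantics of the quantification of `n` variables from number `s` on, with the quantifiers
given by `Q`. -/
def nquantify (Q : ℕ → Quantifier) (φ : (ℕ → Bool) → Prop) : ℕ → ℕ → (ℕ → Bool) → Prop
  | 0, _, a => φ a
  | n + 1, s, a => match Q s with
    | .all => ∀ b, nquantify Q φ n (s + 1) (Function.update a s b)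
    | .ex => ∃ b, nquantify Q φ n (s + 1) (Function.update a s b)

theorem quantify_varName (Q : ℕ → Quantifier) (φ : (ℕ → Bool) → Prop) (n s : ℕ) (σ : Valuation) :
    quantify ((List.range' s n).map fun i => (Q i, varName i)) (fun τ => φ fun i => τ (varName i)) σ
      ↔ nquantify Q φ n s fun i => σ (varName i) := by
  induction n generalizing s σ with
  | zero => rfl
  | succ n ih =>
    have hu : ∀ b, (fun i => Function.update σ (varName s) b (varName i)) =
        Function.update (fun i => σ (varName i)) s b := fun b => by
      funext i
      by_cases h : i = s
      · simp [h]
      · simp [h, varName_injective.ne h]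
    rw [List.range'_succ, List.map_cons, nquantify]
    cases Q s
    · simp only [quantify, ih, hu]
    · simp only [quantify, ih, hu]

/-- A run of `n` existential quantifiers amounts to a single choice of an assignment that differs
from `a` at most on those `n` variables. -/
theorem nquantify_ex {Q : ℕ → Quantifier} {φ : (ℕ → Bool) → Prop} {n s : ℕ} (k : ℕ)
    (hQ : ∀ i, s ≤ i → i < s + n → Q i = .ex) {a : ℕ → Bool} :
    nquantify Q φ (n + k) s a ↔
      ∃ a', (∀ i, i < s ∨ s + n ≤ i → a' i = a i) ∧ nquantify Q φ k (s + n) a' := by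
  induction n generalizing s a with
  | zero =>
    rw [Nat.zero_add, Nat.add_zero]
    refine ⟨fun h => ⟨a, fun _ _ => rfl, h⟩, ?_⟩
    rintro ⟨a', h1, h2⟩
    rwa [show a = a' from funext fun i => (h1 i (by omega)).symm]
  | succ n ih =>
    rw [show n + 1 + k = n + k + 1 by omega, nquantify, hQ s le_rfl (by omega)]
    rw [show s + (n + 1) = s + 1 + n by omega]
    refine (exists_congr fun b => ih fun i h1 h2 => hQ i (by omega) (by omega)).trans ?_
    constructor
    · rintro ⟨b, a', h1, h2⟩
      refine ⟨a', fun i hi => ?_, h2⟩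
      rw [h1 i (by omega), Function.update_of_ne (by omega)]
    · rintro ⟨a', h1, h2⟩
      refine ⟨a' s, a', fun i hi => ?_, h2⟩
      by_cases h : i = s
      · rw [h, Function.update_self]
      · rw [Function.update_of_ne h, h1 i (by omega)]

/-- The first variable of block `t`: the blocks, of `1 + 3 * W` variables each, come after a first
variable and `m` selectors. -/
def base (m W t : ℕ) : ℕ := 1 + m + t * (1 + 3 * W)

theorem base_succ (m W t : ℕ) : base m W (t + 1) = base m W t + 1 + 3 * W := by
  unfold base; ring

theorem base_mono (m W : ℕ) {t t' : ℕ} (h : t ≤ t') : base m W t ≤ base m W t' :=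
  Nat.add_le_add_left (Nat.mul_le_mul_right _ h) _

/-- Bit `i` of the left end of the interval in block `t`. -/
def lower (m W t i : ℕ) : ℕ := base m W t + 1 + i
/-- Bit `i` of the right end of the interval in block `t`. -/
def upper (m W t i : ℕ) : ℕ := base m W t + 1 + W + i
/-- Bit `i` of the middle of the interval in block `t`. -/
def middle (m W t i : ℕ) : ℕ := base m W t + 1 + 2 * W + i

section game
variable (m W : ℕ)

/-- The rest of the game when `n` blocks, from block `t` on, remain. -/
def Play (φ : (ℕ → Bool) → Prop) : ℕ → ℕ → (ℕ → Bool) → Prop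
  | 0, _, a => φ a
  | n + 1, t, a => ∀ b, ∃ a', (∀ i < base m W t, a' i = a i) ∧ a' (base m W t) = b ∧
      (∀ i, base m W (t + 1) ≤ i → a' i = a i) ∧ Play φ n (t + 1) a'

/-- The quantifiers: the first variable and the first one of every block are universal. -/
def quantOf (i : ℕ) : Quantifier :=
  if i = 0 ∨ (m < i ∧ (i - 1 - m) % (1 + 3 * W) = 0) then .all else .ex

theorem quantOf_base (t : ℕ) : quantOf m W (base m W t) = .all := by
  rw [quantOf, if_pos]
  refine Or.inr ⟨by unfold base; omega, ?_⟩
  rw [show base m W t - 1 - m = t * (1 + 3 * W) by unfold base; omega, Nat.mul_mod_left]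

theorem quantOf_block {t i : ℕ} (h1 : base m W t < i) (h2 : i < base m W (t + 1)) :
    quantOf m W i = .ex := by
  rw [quantOf, if_neg]
  rw [base_succ] at h2
  obtain ⟨j, rfl⟩ : ∃ j, i = 1 + m + t * (1 + 3 * W) + j := ⟨i - base m W t, by
    unfold base at *; omega⟩
  have hj : 0 < j ∧ j < 1 + 3 * W := by unfold base at *; omega
  rw [show 1 + m + t * (1 + 3 * W) + j - 1 - m = j + t * (1 + 3 * W) by omega,
    Nat.add_mul_mod_self_right, Nat.mod_eq_of_lt hj.2]
  omega

variable {m W}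

theorem nquantify_iff_play {φ : (ℕ → Bool) → Prop} {n t : ℕ} {a : ℕ → Bool} :
    nquantify (quantOf m W) φ (n * (1 + 3 * W)) (base m W t) a ↔ Play m W φ n t a := by
  induction n generalizing t a with
  | zero => rw [Nat.zero_mul]; rfl
  | succ n ih =>
    rw [show (n + 1) * (1 + 3 * W) = 3 * W + n * (1 + 3 * W) + 1 by ring, nquantify,
      quantOf_base, Play]
    simp only
    refine forall_congr' fun b => ?_
    rw [nquantify_ex _ fun i h1 h2 => quantOf_block m W (t := t) (by omega)
      (by rw [base_succ]; omega), ← base_succ]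
    refine exists_congr fun a' => ?_
    rw [ih, ← and_assoc, ← and_assoc]
    refine and_congr_left fun _ => ?_
    constructor
    · intro h
      refine ⟨⟨fun i hi => ?_, ?_⟩, fun i hi => ?_⟩
      · rw [h i (by omega), Function.update_of_ne (by omega)]
      · rw [h _ (by omega), Function.update_self]
      · have := base_succ m W t
        rw [h i (by omega), Function.update_of_ne (by omega)]
    · rintro ⟨⟨h1, h2⟩, h3⟩ i hi
      by_cases h : i = base m W t
      · rw [h, h2, Function.update_self]
      · rw [Function.update_of_ne h]
        rcases hi with hi | hi
        · exact h1 i (by omega)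
        · exact h3 i hi

theorem nquantify_iff {φ : (ℕ → Bool) → Prop} {n : ℕ} {a : ℕ → Bool} :
    nquantify (quantOf m W) φ (base m W n) 0 a ↔ ∀ b, ∃ a' : ℕ → Bool, a' 0 = b ∧
      (∀ i, m < i → a' i = a i) ∧ Play m W φ n 0 a' := by
  rw [show base m W n = m + n * (1 + 3 * W) + 1 by unfold base; omega, nquantify]
  have h0 : quantOf m W 0 = .all := by simp [quantOf]
  rw [h0]
  simp only
  refine forall_congr' fun b => ?_
  rw [nquantify_ex _ fun i h1 h2 => by rw [quantOf, if_neg]; omega]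
  refine exists_congr fun a' => ?_
  rw [← and_assoc, show 0 + 1 + m = base m W 0 by simp [base], nquantify_iff_play]
  refine and_congr_left fun _ => ?_
  have hb : base m W 0 = 1 + m := by simp [base]
  rw [hb]
  constructor
  · intro h
    refine ⟨by rw [h 0 (by omega), Function.update_self], fun i hi => ?_⟩
    rw [h i (by omega), Function.update_of_ne (by omega)]
  · rintro ⟨h1, h2⟩ i hi
    by_cases h : i = 0
    · rw [h, h1, Function.update_self]
    · rw [Function.update_of_ne h, h2 i (by omega)]

theorem Play.of_forall {φ : (ℕ → Bool) → Prop} {n t : ℕ} {a : ℕ → Bool}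
    (h : ∀ a', (∀ i < base m W t, a' i = a i) → φ a') : Play m W φ n t a := by
  induction n generalizing t a with
  | zero => exact h a fun _ _ => rfl
  | succ n ih =>
    intro b
    have hs := base_succ m W t
    refine ⟨Function.update a (base m W t) b, fun i hi => Function.update_of_ne (by omega) _ _,
      Function.update_self _ _ _, fun i hi => Function.update_of_ne (by omega) _ _,
      ih fun a' h' => h a' fun i hi => ?_⟩
    rw [h' i (by omega), Function.update_of_ne (by omega)]

/-- A won game has at least one won final position. It serves to read off constraints that involve
only variables already assigned. -/
theorem Play.exists {φ : (ℕ → Bool) → Prop} {n t : ℕ} {a : ℕ → Bool} (h : Play m W φ n t a) :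
    ∃ a', (∀ i < base m W t, a' i = a i) ∧ φ a' := by
  induction n generalizing t a with
  | zero => exact ⟨a, fun _ _ => rfl, h⟩
  | succ n ih =>
    obtain ⟨a', h1, -, -, h2⟩ := h true
    obtain ⟨a'', h3, h4⟩ := ih h2
    have hs := base_succ m W t
    exact ⟨a'', fun i hi => (h3 i (by omega)).trans (h1 i hi), h4⟩

/-- Transfer of a strategy to another position and another winning condition. -/
theorem Play.transfer {φ φ' : (ℕ → Bool) → Prop} {n t : ℕ} {a c : ℕ → Bool}
    (h : ∀ a' c' : ℕ → Bool, (∀ i < base m W t, a' i = a i ∧ c' i = c i) →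
      (∀ i, base m W t ≤ i → a' i = c' i) → φ a' → φ' c')
    (hac : ∀ i, base m W t ≤ i → a i = c i) (hp : Play m W φ n t a) : Play m W φ' n t c := by
  induction n generalizing t a c with
  | zero => exact h a c (fun _ _ => ⟨rfl, rfl⟩) hac hp
  | succ n ih =>
    intro b
    obtain ⟨a', h1, h2, h3, h4⟩ := hp b
    have hs := base_succ m W t
    refine ⟨fun i => if i < base m W t then c i else a' i, fun i hi => if_pos hi,
      (if_neg (by omega)).trans h2, fun i hi => ?_,
      ih (fun a'' c'' h5 h6 => ?_) (fun i hi => ?_) h4⟩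
    · exact (if_neg (by omega)).trans ((h3 i hi).trans (hac i (by omega)))
    · refine h a'' c'' (fun i hi => ?_) fun i hi => ?_
      · obtain ⟨h7, h8⟩ := h5 i (by omega)
        rw [h7, h8, if_pos hi]
        exact ⟨h1 i hi, rfl⟩
      · by_cases h9 : i < base m W (t + 1)
        · obtain ⟨h7, h8⟩ := h5 i h9
          rw [h7, h8, if_neg (by omega)]
        · exact h6 i (by omega)
    · exact (if_neg (by omega)).symm

/-- The interval of block `t + 1` is a half of the interval of block `t`. -/
def Link (m W t : ℕ) (a : ℕ → Bool) : Prop := ∀ i < W,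
  (a (base m W (t + 1)) = false → a (lower m W (t + 1) i) = a (lower m W t i) ∧
    a (upper m W (t + 1) i) = a (middle m W t i)) ∧
  (a (base m W (t + 1)) = true → a (lower m W (t + 1) i) = a (middle m W t i) ∧
    a (upper m W (t + 1) i) = a (upper m W t i))

theorem Link.congr {t : ℕ} {a c : ℕ → Bool} (h : Link m W t a)
    (hac : ∀ i < base m W (t + 2), c i = a i) : Link m W t c := by
  intro i hi
  have h1 := base_succ m W t
  have h2 : base m W (t + 2) = _ := base_succ m W (t + 1)
  rw [hac _ (by omega), hac (lower _ _ _ _) (by unfold lower; omega),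
    hac (lower _ _ _ _) (by unfold lower; omega), hac (upper _ _ _ _) (by unfold upper; omega),
    hac (upper _ _ _ _) (by unfold upper; omega), hac (middle _ _ _ _) (by unfold middle; omega)]
  exact h i hi

variable {K : ℕ} {e : ℕ → ℕ → Bool} {Step : (ℕ → Bool) → (ℕ → Bool) → Prop}

/-- The game is sound. Both halves of the interval must be defensible: the first forces the middle
to be `e (j + 2 ^ n)`, and with this as its left end the second forces the right end. -/
theorem Play.upper_eq {φ : (ℕ → Bool) → Prop}
    (hstep : ∀ j u v, (∀ i < W, u i = e j i) → Step u v → ∀ i < W, v i = e (j + 1) i)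
    (hφ : ∀ a, φ a → (∀ t < K, Link m W t a) ∧
      Step (fun i => a (lower m W K i)) fun i => a (upper m W K i)) :
    ∀ n t (a : ℕ → Bool) j, n + t = K → Play m W φ n (t + 1) a →
      (∀ i < W, a (lower m W t i) = e j i) → ∀ i < W, a (upper m W t i) = e (j + 2 ^ n) i := by
  intro n
  induction n with
  | zero =>
    intro t a j hn hp hl
    obtain rfl : t = K := by omega
    exact hstep j _ _ hl (hφ a hp).2
  | succ n ih =>
    intro t a j hn hp hl
    have h1 := base_succ m W t
    have h2 := base_succ m W (t + 1)
    have key : ∀ b j', (∀ i < W, cond b (a (middle m W t i)) (a (lower m W t i)) = e j' i) →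
        ∀ i < W, cond b (a (upper m W t i)) (a (middle m W t i)) = e (j' + 2 ^ n) i := by
      intro b j' hj
      obtain ⟨a', ha, hb, -, hp'⟩ := hp b
      -- The link concerns only blocks up to `t + 1`, which are fixed at this point; so it holds
      -- here because it holds in some won final position.
      have hlink : Link m W t a' := by
        obtain ⟨c, hc, hφc⟩ := hp'.exists
        exact ((hφ c hφc).1 t (by omega)).congr fun i hi => (hc i hi).symm
      have ha1 : ∀ i < W, a' (lower m W t i) = a (lower m W t i) := fun i hi =>
        ha _ (by unfold lower; omega)
      have ha2 : ∀ i < W, a' (upper m W t i) = a (upper m W t i) := fun i hi =>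
        ha _ (by unfold upper; omega)
      have ha3 : ∀ i < W, a' (middle m W t i) = a (middle m W t i) := fun i hi =>
        ha _ (by unfold middle; omega)
      have := ih (t + 1) a' j' (by omega) hp' fun i hi => by
        rw [← hj i hi]
        cases b
        · rw [((hlink i hi).1 hb).1, ha1 i hi]; rfl
        · rw [((hlink i hi).2 hb).1, ha3 i hi]; rfl
      intro i hi
      rw [← this i hi]
      cases b
      · rw [((hlink i hi).1 hb).2, ha3 i hi]; rfl
      · rw [((hlink i hi).2 hb).2, ha2 i hi]; rfl
    rw [pow_succ, mul_two, ← add_assoc]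
    -- The first half, by `key false`, supplies the value at the middle from which the second half
    -- starts.
    exact key true _ (key false j hl)

/-- The assignment `a` before block `t`, continued honestly. -/
def honest (m W : ℕ) (e : ℕ → ℕ → Bool) (t : ℕ) (a : ℕ → Bool) (b : Bool) (j k l i : ℕ) : Bool :=
  if i < base m W t then a i else if i = base m W t then b else
  if i < base m W t + 1 + W then e j (i - (base m W t + 1)) else
  if i < base m W t + 1 + 2 * W then e k (i - (base m W t + 1 + W)) else
  if i < base m W (t + 1) then e l (i - (base m W t + 1 + 2 * W)) else a i

section honest
variable {t : ℕ} {a : ℕ → Bool} {b : Bool} {j k l i : ℕ}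

theorem honest_of_lt (hi : i < base m W t) : honest m W e t a b j k l i = a i := if_pos hi

theorem honest_of_ge (hi : base m W (t + 1) ≤ i) : honest m W e t a b j k l i = a i := by
  have := base_succ m W t
  unfold honest
  rw [if_neg (by omega), if_neg (by omega), if_neg (by omega), if_neg (by omega),
    if_neg (by omega)]

theorem honest_base : honest m W e t a b j k l (base m W t) = b := by simp [honest]

theorem honest_lower (hi : i < W) : honest m W e t a b j k l (lower m W t i) = e j i := by
  unfold honest lower
  rw [if_neg (by omega), if_neg (by omega), if_pos (by omega), Nat.add_sub_cancel_left]

theorem honest_upper (hi : i < W) : honest m W e t a b j k l (upper m W t i) = e k i := by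
  unfold honest upper
  rw [if_neg (by omega), if_neg (by omega), if_neg (by omega), if_pos (by omega),
    Nat.add_sub_cancel_left]

theorem honest_middle (hi : i < W) : honest m W e t a b j k l (middle m W t i) = e l i := by
  have := base_succ m W t
  unfold honest middle
  rw [if_neg (by omega), if_neg (by omega), if_neg (by omega), if_neg (by omega),
    if_pos (by omega), Nat.add_sub_cancel_left]

end honest

/-- The game is complete. The existential player fills each block with the true vectors at the ends
and the middle of the half chosen by the opponent, so all links hold and the last interval is one
step. -/
theorem Play.of_honest {φ : (ℕ → Bool) → Prop} {a₀ : ℕ → Bool}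
    (hstep : ∀ j u v, (∀ i < W, u i = e j i) → (∀ i < W, v i = e (j + 1) i) → Step u v)
    (hφ : ∀ a, (∀ i < base m W 1, a i = a₀ i) → (∀ t < K, Link m W t a) →
      Step (fun i => a (lower m W K i)) (fun i => a (upper m W K i)) → φ a) :
    ∀ n t (a : ℕ → Bool) j, n + t = K → (∀ i < base m W 1, a i = a₀ i) →
      (∀ t' < t, Link m W t' a) → (∀ i < W, a (lower m W t i) = e j i) →
      (∀ i < W, a (upper m W t i) = e (j + 2 ^ n) i) →
      (∀ i < W, a (middle m W t i) = e (j + 2 ^ (n - 1)) i) → Play m W φ n (t + 1) a := by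
  intro n
  induction n with
  | zero =>
    intro t a j hn ha hlink hl hu _
    obtain rfl : t = K := by omega
    exact hφ a ha hlink (hstep j _ _ hl hu)
  | succ n ih =>
    intro t a j hn ha hlink hl hu hm b
    have h0 := base_mono m W (show 1 ≤ t + 1 by omega)
    have h1 := base_succ m W t
    set j' := cond b (j + 2 ^ n) j with hj
    -- For `n = 0` the interval has no middle; the exponent `0 - 1` is then a default that no link
    -- looks at.
    set a' := honest m W e (t + 1) a b j' (j' + 2 ^ n) (j' + 2 ^ (n - 1)) with ha'
    have hlt : ∀ i < base m W (t + 1), a' i = a i := fun i hi => honest_of_lt hi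
    refine ⟨a', hlt, honest_base, fun i hi => honest_of_ge hi, ih (t + 1) a' j' (by omega)
      (fun i hi => (hlt i (by omega)).trans (ha i hi)) (fun t' ht' => ?_)
      (fun i hi => honest_lower hi) (fun i hi => honest_upper hi) fun i hi => honest_middle hi⟩
    rcases Nat.lt_succ_iff_lt_or_eq.mp ht' with ht' | rfl
    · exact (hlink t' ht').congr fun i hi =>
        hlt i (hi.trans_le (base_mono m W (by omega)))
    · intro i hi
      rw [ha', honest_base, honest_lower hi, honest_upper hi,
        honest_of_lt (by unfold lower; omega), honest_of_lt (by unfold middle; omega),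
        honest_of_lt (by unfold upper; omega), hl i hi, hu i hi, hm i hi]
      constructor
      · intro hb
        rw [hj, hb]
        exact ⟨rfl, rfl⟩
      · intro hb
        rw [hj, hb, pow_succ, mul_two, ← add_assoc]
        exact ⟨rfl, rfl⟩

end game
end MFSearch
namespace MFSearch

/-! ### Formulas whose minimal false weakenings spell out the end of a deterministic computation -/

/-- The clause, over numbered variables, is satisfied. -/
def ClauseSat (a : ℕ → Bool) (C : List (Bool × ℕ)) : Prop := ∃ l ∈ C, a l.2 = l.1

/-- A computation, given by bit vectors `e 0, e 1, …` of length `W`, together with clauses that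
describe the first vector, the transition, and the halving of intervals. The bits numbered
`out 0, …, out (m - 1)` of the vector `e (2 ^ K)` are the result. -/
structure Computation where
  m : ℕ
  W : ℕ
  K : ℕ
  N : ℕ
  out : ℕ → ℕ
  core : ℕ → List (Bool × ℕ)
  e : ℕ → ℕ → Bool
  Step : (ℕ → Bool) → (ℕ → Bool) → Prop
  out_lt : ∀ k < m, out k < W
  step_iff : ∀ j u v, (∀ i < W, u i = e j i) → (Step u v ↔ ∀ i < W, v i = e (j + 1) i)
  core_iff : ∀ a : ℕ → Bool, (∀ j < N, ClauseSat a (core j)) ↔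
    (∀ i < W, a (lower m W 0 i) = e 0 i) ∧ (∀ t < K, Link m W t a) ∧
      Step (fun i => a (lower m W K i)) fun i => a (upper m W K i)
  core_var : ∀ j < N, ∀ l ∈ core j, m < l.2 ∧ l.2 < base m W (K + 1)

namespace Computation
variable (G : Computation)

/-- For `i = 2 * k + β`, the clause which says that selection of `k` and first choice `β` require
bit `k` of the result to be `β`. For `i = 2 * m`, the clause which says that something is selected.
Then come the clauses that describe the computation. -/
def body (i : ℕ) : List (Bool × ℕ) :=
  if i < 2 * G.m then
    [(false, 1 + i / 2), (i % 2 == 0, base G.m G.W 0),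
      (i % 2 == 1, upper G.m G.W 0 (G.out (i / 2)))]
  else if i = 2 * G.m then (List.range G.m).map fun k => (true, 1 + k)
  else G.core (i - (2 * G.m + 1))

/-- Clause number `i`. -/
def clause (i : ℕ) : List (Bool × ℕ) := G.body i ++ List.replicate (i + 1) (true, 0)

/-- The number of the clauses. -/
def size : ℕ := 2 * G.m + 1 + G.N

/-- The clauses in `S` are satisfied. -/
def Sat (S : ℕ → Bool) (a : ℕ → Bool) : Prop := ∀ i < G.size, S i = true → ClauseSat a (G.clause i)

/-- Bit `k` of the result. -/
def result (k : ℕ) : Bool := G.e (2 ^ G.K) (G.out k)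

variable {G} {S : ℕ → Bool} {a : ℕ → Bool}

/-- Every clause contains variable `0` positively, and this variable is universal and comes first.
Hence only its value `false` matters, and the padding leaves the game unchanged. The varying number
of copies serves to make the clauses different. -/
theorem sat_of_true (h : a 0 = true) : G.Sat S a := fun i _ _ =>
  ⟨(true, 0), by simp [clause], h⟩

theorem clauseSat_clause (h : a 0 = false) (i : ℕ) :
    ClauseSat a (G.clause i) ↔ ClauseSat a (G.body i) := by
  simp only [ClauseSat, clause, List.mem_append, or_and_right, exists_or, List.mem_replicate]
  refine or_iff_left ?_
  rintro ⟨_, ⟨_, rfl⟩, h'⟩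
  rw [h] at h'
  cases h'

theorem sat_iff (h : a 0 = false) : G.Sat S a ↔
    (∀ k < G.m, ∀ b : Bool, S (2 * k + b.toNat) = true → a (1 + k) = true →
      a (base G.m G.W 0) = b → a (upper G.m G.W 0 (G.out k)) = b) ∧
    (S (2 * G.m) = true → ∃ k < G.m, a (1 + k) = true) ∧
    ∀ j < G.N, S (2 * G.m + 1 + j) = true → ClauseSat a (G.core j) := by
  have h1 : ∀ k < G.m, ∀ b : Bool, ClauseSat a (G.body (2 * k + b.toNat)) ↔
      (a (1 + k) = true → a (base G.m G.W 0) = b → a (upper G.m G.W 0 (G.out k)) = b) := by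
    intro k hk b
    have hb : b.toNat < 2 := by cases b <;> simp
    rw [body, if_pos (by omega), show (2 * k + b.toNat) / 2 = k by omega,
      show (2 * k + b.toNat) % 2 = b.toNat by omega]
    simp only [ClauseSat, List.mem_cons, List.not_mem_nil, or_false, exists_eq_or_imp,
      exists_eq_left]
    cases b <;> cases a (1 + k) <;> cases a (base G.m G.W 0) <;> simp
  have h2 : ClauseSat a (G.body (2 * G.m)) ↔ ∃ k < G.m, a (1 + k) = true := by
    simp [body, ClauseSat]
  have h3 : ∀ j, ClauseSat a (G.body (2 * G.m + 1 + j)) ↔ ClauseSat a (G.core j) := by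
    intro j
    rw [body, if_neg (by omega), if_neg (by omega), Nat.add_sub_cancel_left]
  simp only [Sat, clauseSat_clause h, size]
  constructor
  · intro hs
    refine ⟨fun k hk b hS => (h1 k hk b).mp (hs _ ?_ hS), fun hS => h2.mp (hs _ (by omega) hS),
      fun j hj hS => (h3 j).mp (hs _ (by omega) hS)⟩
    have hb : b.toNat < 2 := by cases b <;> simp
    omega
  · rintro ⟨g1, g2, g3⟩ i hi hS
    rcases lt_trichotomy i (2 * G.m) with hm | rfl | hm
    · obtain ⟨b, hb⟩ : ∃ b : Bool, i = 2 * (i / 2) + b.toNat := by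
        rcases Nat.mod_two_eq_zero_or_one i with h | h
        · exact ⟨false, by simp only [Bool.toNat_false]; omega⟩
        · exact ⟨true, by simp only [Bool.toNat_true]; omega⟩
      rw [hb] at hS ⊢
      exact (h1 _ (by omega) b).mpr (g1 _ (by omega) b hS)
    · exact h2.mpr (g2 hS)
    · obtain ⟨j, rfl⟩ : ∃ j, i = 2 * G.m + 1 + j := ⟨i - (2 * G.m + 1), by omega⟩
      exact (h3 j).mpr (g3 j (by omega) hS)

/-- The existential player wins. -/
def Wins (G : Computation) (S : ℕ → Bool) (a : ℕ → Bool) : Prop :=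
  nquantify (quantOf G.m G.W) (G.Sat S) (base G.m G.W (G.K + 1)) 0 a

/-- If the opponent sets variable `0` to `true`, all clauses hold and any play wins; so only the
value `false` has to be considered. -/
theorem wins_iff : G.Wins S a ↔ ∃ a' : ℕ → Bool, a' 0 = false ∧
    (∀ i, G.m < i → a' i = a i) ∧ Play G.m G.W (G.Sat S) (G.K + 1) 0 a' := by
  rw [Wins, nquantify_iff]
  refine ⟨fun h => h false, fun h => ?_⟩
  rintro (_ | _)
  · exact h
  · refine ⟨Function.update a 0 true, Function.update_self _ _ _, fun i hi =>
      Function.update_of_ne (by omega) _ _, Play.of_forall fun a' ha' => sat_of_true ?_⟩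
    rw [ha' 0 (by unfold base; omega), Function.update_self]

theorem lt_base {i : ℕ} (hi : i ≤ G.m) (t : ℕ) : i < base G.m G.W t := by
  unfold base; omega

/-- Honest play after the first choice `b`. -/
theorem play_honest {b : Bool} (h0 : a 0 = false)
    (h1 : S (2 * G.m) = true → ∃ k < G.m, a (1 + k) = true)
    (h2 : ∀ k < G.m, a (1 + k) = true → S (2 * k + b.toNat) = true → G.result k = b) :
    ∃ a' : ℕ → Bool, (∀ i < base G.m G.W 0, a' i = a i) ∧ a' (base G.m G.W 0) = b ∧
      (∀ i, base G.m G.W 1 ≤ i → a' i = a i) ∧ Play G.m G.W (G.Sat S) G.K 1 a' := by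
  refine ⟨honest G.m G.W G.e 0 a b 0 (0 + 2 ^ G.K) (0 + 2 ^ (G.K - 1)), fun i hi => honest_of_lt hi,
    honest_base, fun i hi => honest_of_ge hi, Play.of_honest (K := G.K) (e := G.e) (Step := G.Step)
    (fun j u v hu hv => (G.step_iff j u v hu).mpr hv) (fun c hc hlink hstep => ?_) G.K 0 _ 0 rfl
    (fun _ _ => rfl) (fun t ht => absurd ht (Nat.not_lt_zero t)) (fun i hi => honest_lower hi)
    (fun i hi => honest_upper hi) fun i hi => honest_middle hi⟩
  have hb := base_succ G.m G.W 0
  have h01 : base G.m G.W (0 + 1) = base G.m G.W 1 := rfl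
  have hlt : ∀ i ≤ G.m, c i = a i := fun i hi => by
    rw [hc i (lt_base hi 1), honest_of_lt (lt_base hi 0)]
  rw [sat_iff ((hlt 0 (Nat.zero_le _)).trans h0)]
  refine ⟨fun k hk b' hS hak hcb => ?_, fun hS => ?_, fun j hj _ => ?_⟩
  · rw [hc _ (by omega), honest_base] at hcb
    subst hcb
    have hk' := G.out_lt k hk
    rw [hc _ (by unfold upper; omega), honest_upper hk', Nat.zero_add]
    exact h2 k hk ((hlt _ (by omega)).symm.trans hak) hS
  · obtain ⟨k, hk, hak⟩ := h1 hS
    exact ⟨k, hk, (hlt _ (by omega)).trans hak⟩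
  · refine (G.core_iff c).mpr ⟨fun i hi => ?_, hlink, hstep⟩ j hj
    rw [hc _ (by unfold lower; omega), honest_lower hi]

/-- The clause numbered `2 * m` forces the selection of some `k`. This happens before the bit of
block `0` is chosen, so the opponent can choose the negation of bit `k` of the result. The clause of
this pair then contradicts `Play.upper_eq`. -/
theorem not_wins (a : ℕ → Bool) : ¬ G.Wins (fun _ => true) a := by
  rw [wins_iff]
  rintro ⟨a', h0, -, hp⟩
  have hcore : ∀ c : ℕ → Bool, c 0 = false → G.Sat (fun _ => true) c →
      (∀ i < G.W, c (lower G.m G.W 0 i) = G.e 0 i) ∧ (∀ t < G.K, Link G.m G.W t c) ∧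
      G.Step (fun i => c (lower G.m G.W G.K i)) fun i => c (upper G.m G.W G.K i) := fun c hc hs =>
    (G.core_iff c).mp fun j hj => ((sat_iff hc).mp hs).2.2 j hj rfl
  obtain ⟨c, hc, hs⟩ := hp.exists
  obtain ⟨k, hk, hck⟩ := ((sat_iff ((hc 0 (lt_base (Nat.zero_le _) 0)).trans h0)).mp hs).2.1 rfl
  rw [hc _ (lt_base (by omega) 0)] at hck
  -- The opponent asks for the wrong value of the selected bit.
  obtain ⟨a'', h1, h2, -, hp'⟩ := hp (!G.result k)
  rw [Nat.zero_add] at hp'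
  have hb := base_succ G.m G.W 0
  have h01 : base G.m G.W (0 + 1) = base G.m G.W 1 := rfl
  have h0'' : a'' 0 = false := (h1 0 (lt_base (Nat.zero_le _) 0)).trans h0
  have hk' := G.out_lt k hk
  obtain ⟨c, hc, hs⟩ := hp'.exists
  have hc0 : c 0 = false := (hc 0 (lt_base (Nat.zero_le _) 1)).trans h0''
  have hup := Play.upper_eq (K := G.K) (e := G.e) (Step := G.Step) 
    (φ := fun a => a 0 = false ∧ G.Sat (fun _ => true) a)
    (fun j u v hu hv => (G.step_iff j u v hu).mp hv) (fun a ha => (hcore a ha.1 ha.2).2)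
    G.K 0 a'' 0 rfl (hp'.transfer (fun d d' h3 h4 hd => ?_) fun _ _ => rfl) (fun i hi => by
      rw [← (hcore c hc0 hs).1 i hi, hc _ (by unfold lower; omega)]) _ hk'
  · have := ((sat_iff hc0).mp hs).1 k hk (!G.result k) rfl
      (by rw [hc _ (lt_base (by omega) 1), h1 _ (lt_base (by omega) 0), hck])
      (by rw [hc _ (by omega), h2])
    rw [hc _ (by unfold upper; omega), hup, Nat.zero_add, result] at this
    revert this
    cases G.e (2 ^ G.K) (G.out k) <;> simp
  · obtain rfl : d = d' := funext fun i => by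
      by_cases h : i < base G.m G.W 1
      · exact (h3 i h).1.trans (h3 i h).2.symm
      · exact h4 i (by omega)
    exact ⟨(h3 0 (lt_base (Nat.zero_le _) 1)).1.trans h0'', hd⟩

/-- With the selection `s` and honest play, the only clauses that could fail are those of selected
indices with a wrong bit, and the hypotheses say that none of these is left. -/
theorem wins_of_honest {s : ℕ → Bool}
    (h1 : S (2 * G.m) = true → ∃ k < G.m, s k = true)
    (h2 : ∀ k < G.m, s k = true → ∀ b : Bool, S (2 * k + b.toNat) = true → G.result k = b) :
    G.Wins S a := by
  rw [wins_iff]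
  refine ⟨fun i => if i = 0 then false else if i ≤ G.m then s (i - 1) else a i, rfl, fun i hi => ?_,
    fun b => play_honest rfl (fun h => ?_) fun k hk hs => h2 k hk ?_ b⟩
  · simp only [show i ≠ 0 by omega, if_false, show ¬ i ≤ G.m by omega]
  · obtain ⟨k, hk, hs⟩ := h1 h
    exact ⟨k, hk, by simpa [show 1 + k ≤ G.m by omega] using hs⟩
  · simpa [show 1 + k ≤ G.m by omega] using hs

/-- If the clause that forces a selection is missing, selecting nothing wins. If the clause of `k`
with the wrong bit is missing, selecting `k` alone wins. -/
theorem mem_of_not_wins (h : ¬ G.Wins S a) : S (2 * G.m) = true ∧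
    ∀ k < G.m, S (2 * k + (!G.result k).toNat) = true := by
  constructor
  · by_contra hS
    exact h (wins_of_honest (s := fun _ => false) (fun h => absurd h hS) fun _ _ h => by cases h)
  · intro k hk
    by_contra hS
    refine h (wins_of_honest (s := fun j => decide (j = k)) (fun _ => ⟨k, hk, by simp⟩) ?_)
    intro j hj hjk b hb
    obtain rfl : j = k := by simpa using hjk
    by_contra hne
    apply hS
    rwa [show (!G.result j) = b by revert hne; cases G.result j <;> cases b <;> simp]

/-- Redundancy of the clause for `k` with the right bit. If the given strategy does not select `k`,
this clause holds anyway. Otherwise the new strategy selects `k` alone: against the right bit it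
plays honestly, against the wrong bit it follows the old strategy, and there the clause in question
holds because of the chosen bit. The constraints of the computation do not mention selectors, so
they survive the change of selection. -/
theorem wins_of_wins {k : ℕ} (hk : k < G.m) {S' : ℕ → Bool}
    (hS : ∀ i, i ≠ 2 * k + (G.result k).toNat → S' i = S i) (h : G.Wins S' a) : G.Wins S a := by
  rw [wins_iff] at h
  obtain ⟨a', h0, ha', hp⟩ := h
  have hb := base_succ G.m G.W 0
  have h01 : base G.m G.W (0 + 1) = base G.m G.W 1 := rfl
  have hne : ∀ j, ∀ b : Bool, j ≠ k ∨ b ≠ G.result k →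
      S' (2 * j + b.toNat) = S (2 * j + b.toNat) := by
    intro j b hjb
    refine hS _ fun heq => ?_
    revert heq hjb
    cases b <;> cases G.result k <;> simp <;> omega
  have hr : (G.result k).toNat < 2 := by cases G.result k <;> simp
  by_cases hak : a' (1 + k) = true
  · rw [wins_iff]
    refine ⟨fun i => if i = 0 then false else if i ≤ G.m then decide (i = 1 + k) else a i, rfl,
      fun i hi => ?_, fun b => ?_⟩
    · simp only [show i ≠ 0 by omega, if_false, show ¬ i ≤ G.m by omega]
    -- The selection was made before `b`, but the play after `b` may depend on it.
    by_cases hbr : b = G.result k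
    · refine play_honest rfl (fun _ => ⟨k, hk, by simp; omega⟩) fun j hj hjk _ => ?_
      obtain rfl : j = k := by simpa [show 1 + j ≤ G.m by omega] using hjk
      exact hbr.symm
    · obtain ⟨a'', h1, h2, h3, hp'⟩ := hp b
      rw [Nat.zero_add] at hp'
      refine ⟨fun i => if i = 0 then false else if i ≤ G.m then decide (i = 1 + k) else a'' i,
        fun i hi => ?_, ?_, fun i hi => ?_, hp'.transfer (fun c c' hc hcc hs => ?_) fun i hi => ?_⟩
      · have : base G.m G.W 0 = 1 + G.m := by simp [base]
        dsimp only
        split_ifs <;> first | rfl | omega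
      · have : base G.m G.W 0 = 1 + G.m := by simp [base]
        simp only [show base G.m G.W 0 ≠ 0 by omega, if_false, h2,
          show ¬ base G.m G.W 0 ≤ G.m by omega]
      · have := lt_base (G := G) le_rfl 1
        simp only [show i ≠ 0 by omega, if_false, show ¬ i ≤ G.m by omega]
        rw [h3 i hi, ha' i (by omega)]
      · have hc0 : c 0 = false := by
          rw [(hc 0 (lt_base (Nat.zero_le _) 1)).1, h1 0 (lt_base (Nat.zero_le _) 0), h0]
        have hc0' : c' 0 = false := by rw [(hc 0 (lt_base (Nat.zero_le _) 1)).2]; rfl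
        have hcm : ∀ i, G.m < i → c' i = c i := fun i hi => by
          by_cases h : i < base G.m G.W 1
          · rw [(hc i h).1, (hc i h).2]
            simp only [show i ≠ 0 by omega, if_false, show ¬ i ≤ G.m by omega]
          · exact (hcc i (by omega)).symm
        have hck : ∀ j < G.m, c' (1 + j) = decide (j = k) := fun j hj => by
          rw [(hc _ (lt_base (by omega) 1)).2]
          simp [show 1 + j ≤ G.m by omega]
        rw [sat_iff hc0']
        obtain ⟨g1, g2, g3⟩ := (sat_iff hc0).mp hs
        refine ⟨fun j hj b' hSj hcj hcb => ?_, fun _ => ⟨k, hk, by simp [hck k hk]⟩,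
          fun j hj hSj => ?_⟩
        · rw [hck j hj] at hcj
          obtain rfl : j = k := by simpa using hcj
          rw [hcm _ (lt_base le_rfl 0)] at hcb
          have hbb : b' = b := by
            rw [← hcb, (hc _ (by omega)).1, h2]
          subst hbb
          rw [hcm _ (by unfold upper; have := lt_base (G := G) le_rfl 0; omega)]
          refine g1 j hj b' ((hne j b' (Or.inr hbr)).trans hSj) ?_ hcb
          rw [(hc _ (lt_base (by omega) 1)).1, h1 _ (lt_base (by omega) 0), hak]
        · obtain ⟨l, hl, hcl⟩ := g3 j hj ((hS _ (by omega)).trans hSj)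
          exact ⟨l, hl, by rw [hcm _ (G.core_var j hj l hl).1, hcl]⟩
      · have := lt_base (G := G) le_rfl 1
        simp only [show i ≠ 0 by omega, if_false, show ¬ i ≤ G.m by omega]
  · rw [wins_iff]
    refine ⟨a', h0, ha', hp.transfer (fun c c' hc hcc hs => ?_) fun _ _ => rfl⟩
    obtain rfl : c = c' := funext fun i => by
      by_cases h : i < base G.m G.W 0
      · exact (hc i h).1.trans (hc i h).2.symm
      · exact hcc i (by omega)
    have hc0 : c 0 = false := (hc 0 (lt_base (Nat.zero_le _) 0)).1.trans h0
    rw [sat_iff hc0] at hs ⊢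
    refine ⟨fun j hj b hSj hcj => ?_, fun h => hs.2.1 ((hS _ (by omega)).trans h), fun j hj h =>
      hs.2.2 j hj ((hS _ (by omega)).trans h)⟩
    refine hs.1 j hj b ((hne j b (Or.inl ?_)).trans hSj) hcj
    rintro rfl
    rw [(hc _ (lt_base (by omega) 0)).1] at hcj
    exact hak hcj

end Computation
end MFSearch
-- Unique readability of the encoding, and the QCNF of a computation.
namespace MFSearch

theorem encMatrix_injective : Function.Injective encMatrix := by
  intro ms
  induction ms with
  | nil =>
    rintro (_ | ⟨_ | C, ms'⟩) h
    · rfl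
    · simp at h
    · simp at h
  | cons c ms ih =>
    rintro (_ | ⟨c', ms'⟩) h
    · cases c <;> simp at h
    cases c with
    | top =>
      cases c' with
      | top => rw [ih (List.cons.inj h).2]
      | clause C => simp at h
    | clause C =>
      cases c' with
      | top => simp at h
      | clause C' =>
        simp only [encMatrix_clause, List.cons.injEq, true_and] at h
        have hC : C = C' := by
          rw [← litsOf_append C (stops_encMatrix ms), h, litsOf_append C' (stops_encMatrix ms')]
        subst hC
        rw [ih (List.append_cancel_left h)]

theorem QCNF.encode_injective : Function.Injective QCNF.encode := by
  have key : ∀ qs qs' ms ms', encQuants qs ++ encMatrix ms = encQuants qs' ++ encMatrix ms' →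
      qs = qs' ∧ ms = ms' := by
    have hne : ∀ p qs ts ms, encMatrix ms ≠ encQuants (p :: qs) ++ ts := by
      intro p qs ts ms h
      have := ne_quant_of_mem_encMatrix (ms := ms) (t := p.1.token) (by rw [h]; simp)
      obtain ⟨_ | _, v⟩ := p <;> simp [Quantifier.token] at this
    intro qs
    induction qs with
    | nil =>
      rintro (_ | ⟨p, qs'⟩) ms ms' h
      · exact ⟨rfl, encMatrix_injective h⟩
      · exact absurd h (hne _ _ _ _)
    | cons p qs ih =>
      rintro (_ | ⟨p', qs'⟩) ms ms' h
      · exact absurd h.symm (hne _ _ _ _)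
      · obtain ⟨q, v⟩ := p
        obtain ⟨q', v'⟩ := p'
        simp only [encQuants_cons, List.cons_append, List.append_assoc, List.cons.injEq] at h
        obtain ⟨h1, h2⟩ := h
        have hq : q = q' := by cases q <;> cases q' <;> simp_all [Quantifier.token]
        have hv : v = v' := by
          rw [← bitsOf_append v (stops_encode qs ms).ne_bit, h2,
            bitsOf_append v' (stops_encode qs' ms').ne_bit]
        subst hq hv
        obtain ⟨rfl, rfl⟩ := ih _ _ _ (List.append_cancel_left h2)
        exact ⟨rfl, rfl⟩
  intro Φ Ψ h
  obtain ⟨h1, h2⟩ := key _ _ _ _ h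
  exact QCNF.ext h1 h2

namespace Computation
variable (G : Computation) (S : ℕ → Bool)

/-- A literal over numbered variables. -/
def lit (l : Bool × ℕ) : Literal := ⟨l.1, varName l.2⟩

theorem lit_injective : Function.Injective lit := fun l l' h => by
  simp only [lit, Literal.mk.injEq] at h
  exact Prod.ext h.1 (varName_injective h.2)

/-- Conjunct number `i` of the formula with the clauses in `S`. -/
def conjunct (i : ℕ) : Conjunct := if S i then .clause ((G.clause i).map lit) else .top

theorem mem_body {i : ℕ} (hi : i < G.size) {l : Bool × ℕ} (hl : l ∈ G.body i) :
    0 < l.2 ∧ l.2 < base G.m G.W (G.K + 1) := by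
  rw [body] at hl
  have hb := base_succ G.m G.W 0
  have h0 := base_mono G.m G.W (show 0 + 1 ≤ G.K + 1 by omega)
  have h1 : base G.m G.W 0 = 1 + G.m := by simp [base]
  split_ifs at hl with h2 h3
  · have := G.out_lt (i / 2) (by omega)
    simp only [List.mem_cons, List.not_mem_nil, or_false] at hl
    rcases hl with rfl | rfl | rfl
    · dsimp only; omega
    · dsimp only; omega
    · unfold upper; dsimp only; omega
  · obtain ⟨k, hk, rfl⟩ := List.mem_map.mp hl
    have := List.mem_range.mp hk
    dsimp only
    omega
  · have := G.core_var (i - (2 * G.m + 1)) (by unfold size at hi; omega) l hl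
    omega

/-- The bodies do not contain variable `0`, so the number of copies of the literal `(true, 0)`
reveals the index of the clause. -/
theorem clause_ne {i j : ℕ} (hij : i < j) (hj : j < G.size) : G.clause i ≠ G.clause j := by
  have hc : ∀ i < G.size, (G.clause i).count (true, 0) = i + 1 := fun i hi => by
    rw [clause, List.count_append, List.count_replicate_self, List.count_eq_zero.mpr, Nat.zero_add]
    exact fun h => absurd (G.mem_body hi h).1 (lt_irrefl _)
  intro h
  have h1 := hc i (hij.trans hj)
  rw [h, hc j hj] at h1
  omega

/-- The formula with the clauses in `S`. -/
def formula : QCNF where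
  quants := (List.range (base G.m G.W (G.K + 1))).map fun i => (quantOf G.m G.W i, varName i)
  matrix := (List.range G.size).map (G.conjunct S)
  nodup_vars := by
    rw [List.map_map]
    exact List.nodup_range.map varName_injective
  nonempty_clauses C hC := by
    obtain ⟨i, -, hi⟩ := List.mem_map.mp hC
    unfold conjunct at hi
    split_ifs at hi
    cases hi
    simp [clause]
  different_clauses := by
    rw [List.pairwise_map]
    refine List.Pairwise.imp_of_mem (fun {i j} _ hj hij h => ?_) List.pairwise_lt_range
    unfold conjunct at h ⊢
    split_ifs at h ⊢
    · exact absurd (lit_injective.list_map (Conjunct.clause.inj h))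
        (G.clause_ne hij (List.mem_range.mp hj))
    · rfl

theorem formula_closed : (G.formula S).Closed := by
  intro C hC l hl
  obtain ⟨i, hi, hC⟩ := List.mem_map.mp hC
  unfold conjunct at hC
  split_ifs at hC
  cases hC
  obtain ⟨l, hl', rfl⟩ := List.mem_map.mp hl
  refine List.mem_map.mpr ⟨_, List.mem_map.mpr ⟨l.2, List.mem_range.mpr ?_, rfl⟩, rfl⟩
  rcases List.mem_append.mp hl' with hl | hl
  · exact (G.mem_body (List.mem_range.mp hi) hl).2
  · obtain ⟨-, rfl⟩ := List.mem_replicate.mp hl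
    exact lt_base (Nat.zero_le _) _

variable {G S}

theorem holds_formula_iff {σ : Valuation} :
    (G.formula S).Holds σ ↔ G.Wins S fun i => σ (varName i) := by
  have key : ∀ τ : Valuation, (∀ c ∈ (G.formula S).matrix, c.Holds τ) ↔
      G.Sat S fun i => τ (varName i) := by
    intro τ
    simp only [formula, List.mem_map, List.mem_range, Sat, forall_exists_index, and_imp,
      forall_apply_eq_imp_iff₂]
    refine forall_congr' fun i => forall_congr' fun _ => ?_
    unfold conjunct
    split_ifs with h
    · simp only [Conjunct.Holds, ClauseSat, List.mem_map, h, forall_true_left,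
        exists_exists_and_eq_and]
      rfl
    · simp [Conjunct.Holds, h]
  rw [Wins, ← quantify_varName, ← List.range_eq_range']
  exact ⟨quantify_congr fun τ => (key τ).mp, quantify_congr fun τ => (key τ).mpr⟩

theorem formula_mem_weakenings {S' : ℕ → Bool} (h : ∀ i, S' i = true → S i = true) :
    G.formula S' ∈ (G.formula S).weakenings := by
  refine mem_weakenings.mpr ⟨rfl, ?_⟩
  simp only [formula, Weaker, List.forall₂_map_left_iff, List.forall₂_map_right_iff]
  refine List.forall₂_same.mpr fun i _ => ?_
  unfold conjunct
  by_cases hi : S' i = true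
  · simp [hi, h i hi]
  · simp [hi]

theorem exists_eq_formula {Ψ : QCNF} (h : Ψ ∈ (G.formula S).weakenings) :
    ∃ S' : ℕ → Bool, Ψ = G.formula S' := by
  classical
  obtain ⟨h1, h2⟩ := mem_weakenings.mp h
  refine ⟨fun i => if Ψ.matrix[i]? = some .top then false else S i, ?_⟩
  ext1
  · exact h1
  · have hlen : G.size = Ψ.matrix.length := by simpa [formula] using h2.length_eq
    refine List.ext_getElem (by simp [formula, hlen]) fun i hi hi' => ?_
    have := List.Forall₂.get h2 (i := i) (by simpa [formula] using hi') hi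
    simp only [List.get_eq_getElem, formula, List.getElem_map, List.getElem_range] at this
    simp only [formula, List.getElem_map, List.getElem_range]
    have hi2 : Ψ.matrix[i]? = some Ψ.matrix[i] := List.getElem?_eq_getElem hi
    unfold conjunct at *
    rcases this with h | h
    · by_cases hS : S i = true
      · simp only [hi2, h, hS]
        simp
      · rw [h]
        simp [hS]
    · simp [hi2, h]

theorem formula_isFalse (G : Computation) : (G.formula fun _ => true).IsFalse :=
  fun _ h => not_wins _ (holds_formula_iff.mp h)

/-- A minimal false weakening determines the result. -/
theorem exists_of_mfSearch {z : List Token} (h : mfSearch (G.formula fun _ => true).encode z) :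
    ∃ S : ℕ → Bool, z = (G.formula S).encode ∧ S (2 * G.m) = true ∧
      ∀ k < G.m, ∀ b, S (2 * k + b.toNat) = true ↔ b ≠ G.result k := by
  rcases h with ⟨Φ, -, henc, -, Ψ, ⟨hMF, hΨ⟩, rfl⟩ | ⟨h, -⟩
  · obtain rfl := QCNF.encode_injective henc
    obtain ⟨S, rfl⟩ := exists_eq_formula hΨ
    have hS : ¬ G.Wins S fun i => false := fun hw =>
      hMF.1 (fun _ => false) (holds_formula_iff.mpr hw)
    obtain ⟨h1, h2⟩ := mem_of_not_wins hS
    refine ⟨S, rfl, h1, fun k hk b => ⟨?_, fun hb => ?_⟩⟩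
    · rintro hSb rfl
      -- A clause with the right bit that is still present could be dropped without making the
      -- formula true, by `wins_of_wins`, against minimality.
      set S' : ℕ → Bool := fun i => S i && decide (i ≠ 2 * k + (G.result k).toNat) with hS'
      have hle : ∀ i, S' i = true → S i = true := fun i hi => (Bool.and_eq_true_iff.mp hi).1
      have hne : G.formula S' ≠ G.formula S := fun heq => by
        have h3 := congrArg (fun Φ => Φ.matrix[2 * k + (G.result k).toNat]?) heq
        have hlt : 2 * k + (G.result k).toNat < G.size := by
          have : (G.result k).toNat < 2 := by cases G.result k <;> simp
          unfold size
          omega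
        simp [formula, hlt, conjunct, hSb, hS'] at h3
      refine hne (hMF.2 _ (formula_mem_weakenings hle) fun σ hσ => ?_)
      refine hMF.1 σ (holds_formula_iff.mpr (wins_of_wins hk (fun i hi => ?_)
        (holds_formula_iff.mp hσ)))
      simp [hS', hi]
    · have := h2 k hk
      rwa [show (!G.result k) = b by revert hb; cases G.result k <;> cases b <;> simp] at this
  · exact absurd ⟨_, G.formula_closed _, rfl, G.formula_isFalse⟩ h

end Computation
end MFSearch
namespace MFSearch

/-- Clauses are numbered by tuples of digits; this provides the clause with prescribed parameters.
-/
theorem exists_digits (D : ℕ) (d : ℕ → ℕ) (hd : ∀ l, d l < D) (k : ℕ) :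
    ∃ n < D ^ k, ∀ l < k, n / D ^ l % D = d l := by
  have hD : 0 < D := (Nat.zero_le _).trans_lt (hd 0)
  induction k with
  | zero => exact ⟨0, by simp, by simp⟩
  | succ k ih =>
    obtain ⟨n, hn, h⟩ := ih
    refine ⟨n + D ^ k * d k, ?_, fun l hl => ?_⟩
    · rw [pow_succ]
      calc n + D ^ k * d k < D ^ k * (d k + 1) := by rw [mul_add_one]; omega
        _ ≤ D ^ k * D := Nat.mul_le_mul_left _ (hd k)
    · rcases Nat.lt_succ_iff_lt_or_eq.mp hl with hl | rfl
      · obtain ⟨r, rfl⟩ := Nat.exists_eq_add_of_lt hl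
        rw [show D ^ (l + r + 1) = D ^ l * (D * D ^ r) by ring, mul_assoc,
          Nat.add_mul_div_left _ _ (pow_pos hD _), mul_assoc, Nat.add_mul_mod_self_left]
        exact h l hl
      · rw [Nat.add_mul_div_left _ _ (pow_pos hD _), Nat.div_eq_of_lt hn, Nat.zero_add,
          Nat.mod_eq_of_lt (hd _)]

namespace Computation

/-- The vectors of a computation that becomes constant are constant after `2 ^ W` steps. -/
theorem e_eq (G : Computation) (hK : G.W ≤ G.K) {h : ℕ}
    (hh : ∀ j ≥ h, ∀ i < G.W, G.e j i = G.e h i) :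
    ∀ i < G.W, G.e (2 ^ G.K) i = G.e h i := by
  -- By `step_iff` a vector determines its successor, so equal vectors have equal futures.
  have hdet : ∀ j j', (∀ i < G.W, G.e j i = G.e j' i) →
      ∀ l, ∀ i < G.W, G.e (j + l) i = G.e (j' + l) i := by
    intro j j' hj l
    induction l with
    | zero => exact hj
    | succ l ih =>
      intro i hi
      have h1 := (G.step_iff (j + l) (G.e (j + l)) (G.e (j + l + 1)) fun _ _ => rfl).mpr
        fun _ _ => rfl
      exact (G.step_iff (j' + l) (G.e (j + l)) (G.e (j + l + 1)) ih).mp h1 i hi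
  -- Among the first `2 ^ W + 1` vectors two coincide, so from `p` on the sequence is periodic with
  -- period `r + 1`.
  obtain ⟨p, q, hpq, heq⟩ := Fintype.exists_ne_map_eq_of_card_lt
    (fun (j : Fin (2 ^ G.W + 1)) (i : Fin G.W) => G.e j i) (by simp)
  wlog hlt : p < q generalizing p q
  · exact this q p hpq.symm heq.symm (lt_of_le_of_ne (not_lt.mp hlt) hpq.symm)
  obtain ⟨r, hr⟩ : ∃ r, q.1 = p.1 + (r + 1) := ⟨q.1 - p.1 - 1, by omega⟩
  have hp := p.2
  have hper : ∀ k l, ∀ i < G.W, G.e (p.1 + l + k * (r + 1)) i = G.e (p.1 + l) i := by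
    intro k
    induction k with
    | zero => simp
    | succ k ih =>
      intro l i hi
      rw [show p.1 + l + (k + 1) * (r + 1) = p.1 + (l + (r + 1)) + k * (r + 1) by ring, ih _ i hi,
        show p.1 + (l + (r + 1)) = q.1 + l by omega]
      exact (hdet p q (fun i hi => congrFun heq ⟨i, hi⟩) l i hi).symm
  intro i hi
  have hle : p.1 ≤ 2 ^ G.K := by
    have := Nat.pow_le_pow_right (n := 2) (by omega) hK
    omega
  obtain ⟨l, hl⟩ := Nat.exists_eq_add_of_le hle
  -- As `p ≤ 2 ^ K`, time `2 ^ K` lies in the periodic part; adding `h` periods leads beyond time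
  -- `h`, where the sequence is constant.
  rw [hl, ← hper h l i hi]
  exact hh _ (by nlinarith) i hi

end Computation

/-! ### Computations of machines -/

instance {A B : Type} (M : Machine A B) : Finite M.Q := M.finQ
instance {A B : Type} (M : Machine A B) : Finite M.Γ := M.finΓ

section
variable {A B : Type} (M : Machine A B) (x : List A) (R : ℕ)

/-- The configuration after `j` steps, or the last one. -/
def Machine.conf : ℕ → M.Cfg
  | 0 => M.init
  | j + 1 => (M.step x (Machine.conf j)).getD (Machine.conf j)

theorem Machine.reached_conf (j : ℕ) : M.Reached x (M.conf x j) := by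
  induction j with
  | zero => exact .refl
  | succ j ih =>
    rw [conf]
    cases h : M.step x (M.conf x j) with
    | none => exact ih
    | some c => exact ih.tail h

variable {M x} in
theorem Machine.Reached.exists_conf {c : M.Cfg} (h : M.Reached x c) : ∃ j, M.conf x j = c := by
  induction h with
  | refl => exact ⟨0, rfl⟩
  | tail _ h ih =>
    obtain ⟨j, rfl⟩ := ih
    exact ⟨j + 1, by rw [conf, h]; rfl⟩

variable {M x} in
theorem Machine.conf_of_halted {h : ℕ} (hh : M.step x (M.conf x h) = none) {j : ℕ} (hj : h ≤ j) :
    M.conf x j = M.conf x h := by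
  induction hj with
  | refl => rfl
  | step _ ih => rw [conf, ih, hh]; rfl

theorem Machine.conf_inHead (j : ℕ) : (M.conf x j).inHead ≤ x.length + 1 := by
  induction j with
  | zero => exact Nat.zero_le _
  | succ j ih =>
    rw [conf, step]
    cases M.δ (M.conf x j).state (inputSymbol x (M.conf x j).inHead)
      ((M.conf x j).tape (M.conf x j).workHead) with
    | none => exact ih
    | some act =>
      cases hm : act.moveIn <;> simp [Move.onInput, hm] <;> omega

theorem Machine.conf_out_mono {j k : ℕ} (h : j ≤ k) :
    (M.conf x j).out.length ≤ (M.conf x k).out.length := by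
  induction h with
  | refl => rfl
  | @step k _ ih =>
    rw [conf, step]
    cases M.δ (M.conf x k).state (inputSymbol x (M.conf x k).inHead)
      ((M.conf x k).tape (M.conf x k).workHead) with
    | none => exact ih
    | some act =>
      simp only [Option.map_some, Option.getD_some, List.length_append]
      omega

variable [Finite B]

/-- Bit `i` of the description of a configuration: the number `i` consists of the kind of the bit,
a position and a symbol. -/
noncomputable def confBit (c : M.Cfg) (i : ℕ) : Bool :=
  match i % R with
  | 0 => encodeFin c.state == i / R % R
  | 1 => c.inHead == i / R % R
  | 2 => c.workHead == i / R % R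
  | 3 => c.out.length == i / R % R
  | 4 => encodeFin (c.tape (i / R % R)) == i / R ^ 2 % R
  | 5 => c.out[i / R % R]?.any fun b => encodeFin b == i / R ^ 2 % R
  | _ => false

/-- The number of a bit. -/
def bitIndex (k a s : ℕ) : ℕ := k + R * a + R ^ 2 * s

/-- Bit `i` after a step, if it was `v` before, and the state, the heads, the length of the output
and the scanned symbol are given by `q`, `j`, `j'`, `o` and `s`. -/
noncomputable def nextBit (q j j' o s i : ℕ) (v : Bool) : Bool :=
  match M.δ (decodeFin M.start q) (inputSymbol x j) (decodeFin M.blank s) with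
  | none => v
  | some act => match i % R with
    | 0 => encodeFin act.next == i / R % R
    | 1 => act.moveIn.onInput x.length j == i / R % R
    | 2 => act.moveWork.onWork j' == i / R % R
    | 3 => o + act.emit.toList.length == i / R % R
    | 4 => if i / R % R = j' then encodeFin act.write == i / R ^ 2 % R else v
    | 5 => if i / R % R = o ∧ act.emit ≠ none then
        act.emit.any fun b => encodeFin b == i / R ^ 2 % R
      else v
    | _ => v

variable {R}

theorem bitIndex_mod {k a s : ℕ} (hk : k < R) : bitIndex R k a s % R = k := by
  rw [bitIndex, show k + R * a + R ^ 2 * s = k + R * (a + R * s) by ring,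
    Nat.add_mul_mod_self_left, Nat.mod_eq_of_lt hk]

theorem bitIndex_div {k a s : ℕ} (hk : k < R) (ha : a < R) : bitIndex R k a s / R % R = a := by
  rw [bitIndex, show k + R * a + R ^ 2 * s = k + R * (a + R * s) by ring,
    Nat.add_mul_div_left _ _ (by omega), Nat.div_eq_of_lt hk, Nat.zero_add,
    Nat.add_mul_mod_self_left, Nat.mod_eq_of_lt ha]

theorem bitIndex_div_sq {k a s : ℕ} (hk : k < R) (ha : a < R) (hs : s < R) :
    bitIndex R k a s / R ^ 2 % R = s := by
  rw [sq, ← Nat.div_div_eq_div_mul, bitIndex,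
    show k + R * a + R ^ 2 * s = k + R * (a + R * s) by ring,
    Nat.add_mul_div_left _ _ (by omega), Nat.div_eq_of_lt hk, Nat.zero_add,
    Nat.add_mul_div_left _ _ (by omega), Nat.div_eq_of_lt ha, Nat.zero_add, Nat.mod_eq_of_lt hs]

theorem bitIndex_lt {k a s : ℕ} (hk : k < R) (ha : a < R) (hs : s < R) :
    bitIndex R k a s < R ^ 3 := by
  have h1 : k + R * a < R ^ 2 := by nlinarith
  have h2 : R ^ 2 * s + R ^ 2 ≤ R ^ 3 := by
    rw [show R ^ 3 = R ^ 2 * R by ring, ← mul_add_one]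
    exact Nat.mul_le_mul_left _ hs
  rw [bitIndex]
  omega

/-- The parts of the configuration are described by numbers below `R`. -/
def Bounded (R : ℕ) (c : M.Cfg) : Prop :=
  encodeFin c.state < R ∧ c.inHead < R ∧ c.workHead < R ∧ c.out.length < R ∧
    ∀ a, encodeFin (c.tape a) < R

variable {M x}

/-- A step is local: the new value of a bit depends on its old value and on the state, the two
heads, the output length and the scanned symbol. This is why the transition is expressed by clauses
with seven literals. -/
theorem nextBit_eq (c : M.Cfg) (i : ℕ) :
    nextBit M x R (encodeFin c.state) c.inHead c.workHead c.out.length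
      (encodeFin (c.tape c.workHead)) i (confBit M R c i) =
    confBit M R ((M.step x c).getD c) i := by
  rw [nextBit, decodeFin_encodeFin, decodeFin_encodeFin, Machine.step]
  cases M.δ c.state (inputSymbol x c.inHead) (c.tape c.workHead) with
  | none => rfl
  | some act =>
    simp only [Option.map_some, Option.getD_some]
    unfold confBit
    generalize i % R = k
    match k with
    | 0 => rfl
    | 1 => rfl
    | 2 => rfl
    | 3 => simp
    | 4 =>
      by_cases h : i / R % R = c.workHead
      · simp [h]
      · simp [h]
    | 5 =>
      cases hb : act.emit with
      | none => simp
      | some b =>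
        rcases lt_trichotomy (i / R % R) c.out.length with h | h | h
        · simp [h.ne, List.getElem?_append_left h]
        · simp [h]
        · simp [h.ne', List.getElem?_eq_none h.le, not_le.mpr h]
    | k + 6 => rfl

/-- The condition on the bits of successive configurations. -/
def StepRel (M : Machine A B) (x : List A) (R : ℕ) (u v : ℕ → Bool) : Prop :=
  ∀ q < R, ∀ j < R, ∀ j' < R, ∀ o < R, ∀ s < R, ∀ i < R ^ 3,
    u (bitIndex R 0 q 0) = true → u (bitIndex R 1 j 0) = true → u (bitIndex R 2 j' 0) = true →
    u (bitIndex R 3 o 0) = true → u (bitIndex R 4 j' s) = true →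
    v i = nextBit M x R q j j' o s i (u i)

/-- When `u` describes a configuration, exactly one tuple of parameters satisfies the premises of
`StepRel`, namely the actual one; all other implications are vacuous. -/
theorem stepRel_iff (hR : 6 ≤ R) {c : M.Cfg} (hc : Bounded M R c) {u v : ℕ → Bool}
    (hu : ∀ i < R ^ 3, u i = confBit M R c i) :
    StepRel M x R u v ↔ ∀ i < R ^ 3, v i = confBit M R ((M.step x c).getD c) i := by
  have h0 : ∀ q < R, u (bitIndex R 0 q 0) = (encodeFin c.state == q) := fun q hq => by
    rw [hu _ (bitIndex_lt (by omega) hq (by omega)), confBit, bitIndex_mod (by omega),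
      bitIndex_div (by omega) hq]; rfl
  have h1 : ∀ q < R, u (bitIndex R 1 q 0) = (c.inHead == q) := fun q hq => by
    rw [hu _ (bitIndex_lt (by omega) hq (by omega)), confBit, bitIndex_mod (by omega),
      bitIndex_div (by omega) hq]; rfl
  have h2 : ∀ q < R, u (bitIndex R 2 q 0) = (c.workHead == q) := fun q hq => by
    rw [hu _ (bitIndex_lt (by omega) hq (by omega)), confBit, bitIndex_mod (by omega),
      bitIndex_div (by omega) hq]; rfl
  have h3 : ∀ q < R, u (bitIndex R 3 q 0) = (c.out.length == q) := fun q hq => by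
    rw [hu _ (bitIndex_lt (by omega) hq (by omega)), confBit, bitIndex_mod (by omega),
      bitIndex_div (by omega) hq]; rfl
  have h4 : ∀ a < R, ∀ s < R, u (bitIndex R 4 a s) = (encodeFin (c.tape a) == s) :=
    fun a ha s hs => by
      rw [hu _ (bitIndex_lt (by omega) ha hs), confBit, bitIndex_mod (by omega),
        bitIndex_div (by omega) ha, bitIndex_div_sq (by omega) ha hs]; rfl
  obtain ⟨b0, b1, b2, b3, b4⟩ := hc
  constructor
  · intro h i hi
    rw [← nextBit_eq, ← hu i hi]
    refine h _ b0 _ b1 _ b2 _ b3 _ (b4 _) i hi ?_ ?_ ?_ ?_ ?_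
    · rw [h0 _ b0]; exact beq_self_eq_true _
    · rw [h1 _ b1]; exact beq_self_eq_true _
    · rw [h2 _ b2]; exact beq_self_eq_true _
    · rw [h3 _ b3]; exact beq_self_eq_true _
    · rw [h4 _ b2 _ (b4 _)]; exact beq_self_eq_true _
  · intro h q hq j hj j' hj' o ho s hs i hi g0 g1 g2 g3 g4
    rw [h0 q hq, beq_iff_eq] at g0
    rw [h1 j hj, beq_iff_eq] at g1
    rw [h2 j' hj', beq_iff_eq] at g2
    rw [h3 o ho, beq_iff_eq] at g3
    rw [h4 j' hj' s hs, beq_iff_eq] at g4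
    subst g0 g1 g2 g3 g4
    rw [h i hi, hu i hi, nextBit_eq]

/-- A clause of the condition `Link`. -/
def linkClause (m W t i : ℕ) (b side c : Bool) : List (Bool × ℕ) :=
  [(!b, base m W (t + 1)), (c, if side then upper m W (t + 1) i else lower m W (t + 1) i),
    (!c, if b = side then (if side then upper m W t i else lower m W t i) else middle m W t i)]

/-- Each equality of two bits becomes two implications: `b` is the chosen half, `side` the end of
the interval, `c` the direction. The end on the side of the chosen half is inherited, the other one
is the old middle. -/
theorem link_iff {m W t : ℕ} {a : ℕ → Bool} :
    Link m W t a ↔ ∀ i < W, ∀ b side c, ClauseSat a (linkClause m W t i b side c) := by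
  refine forall_congr' fun i => forall_congr' fun _ => ?_
  simp only [linkClause, ClauseSat, List.mem_cons, List.not_mem_nil, or_false, exists_eq_or_imp,
    exists_eq_left, Bool.forall_bool, Bool.false_eq_true, if_true, if_false, Bool.not_true,
    Bool.not_false, reduceCtorEq]
  cases a (base m W (t + 1)) <;> cases a (lower m W (t + 1) i) <;>
    cases a (upper m W (t + 1) i) <;> cases a (lower m W t i) <;> cases a (middle m W t i) <;>
    cases a (upper m W t i) <;> simp

/-- A clause of the condition `StepRel`. -/
noncomputable def stepClause (M : Machine A B) (x : List A) (R m q j j' o s i : ℕ) (v : Bool) :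
    List (Bool × ℕ) :=
  [(false, lower m (R ^ 3) (R ^ 3) (bitIndex R 0 q 0)),
    (false, lower m (R ^ 3) (R ^ 3) (bitIndex R 1 j 0)),
    (false, lower m (R ^ 3) (R ^ 3) (bitIndex R 2 j' 0)),
    (false, lower m (R ^ 3) (R ^ 3) (bitIndex R 3 o 0)),
    (false, lower m (R ^ 3) (R ^ 3) (bitIndex R 4 j' s)),
    (!v, lower m (R ^ 3) (R ^ 3) i),
    (nextBit M x R q j j' o s i v, upper m (R ^ 3) (R ^ 3) i)]

theorem clauseSat_stepClause {m q j j' o s i : ℕ} {a : ℕ → Bool} :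
    (∀ v, ClauseSat a (stepClause M x R m q j j' o s i v)) ↔
    (a (lower m (R ^ 3) (R ^ 3) (bitIndex R 0 q 0)) = true →
      a (lower m (R ^ 3) (R ^ 3) (bitIndex R 1 j 0)) = true →
      a (lower m (R ^ 3) (R ^ 3) (bitIndex R 2 j' 0)) = true →
      a (lower m (R ^ 3) (R ^ 3) (bitIndex R 3 o 0)) = true →
      a (lower m (R ^ 3) (R ^ 3) (bitIndex R 4 j' s)) = true →
      a (upper m (R ^ 3) (R ^ 3) i) =
        nextBit M x R q j j' o s i (a (lower m (R ^ 3) (R ^ 3) i))) := by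
  simp only [stepClause, ClauseSat, List.mem_cons, List.not_mem_nil, or_false, exists_eq_or_imp,
    exists_eq_left]
  generalize a (lower m (R ^ 3) (R ^ 3) i) = w
  cases a (lower m (R ^ 3) (R ^ 3) (bitIndex R 0 q 0)) <;>
    cases a (lower m (R ^ 3) (R ^ 3) (bitIndex R 1 j 0)) <;>
    cases a (lower m (R ^ 3) (R ^ 3) (bitIndex R 2 j' 0)) <;>
    cases a (lower m (R ^ 3) (R ^ 3) (bitIndex R 3 o 0)) <;>
    cases a (lower m (R ^ 3) (R ^ 3) (bitIndex R 4 j' s)) <;> cases w <;> simp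

/-- The clauses that describe the computation of a machine, selected by the digits `d`. -/
noncomputable def machineClause (M : Machine A B) (x : List A) (R m : ℕ) (d : ℕ → ℕ) :
    List (Bool × ℕ) :=
  if d 0 = 0 then [(confBit M R M.init (d 1), lower m (R ^ 3) 0 (d 1))]
  else if d 0 = 1 then
    linkClause m (R ^ 3) (d 1) (d 2) (d 3 % 2 == 1) (d 4 % 2 == 1) (d 5 % 2 == 1)
  else stepClause M x R m (d 1 % R) (d 2 % R) (d 3 % R) (d 4 % R) (d 5 % R) (d 6) (d 7 % 2 == 1)

/-- Every tuple of eight digits yields a valid clause and every required clause occurs. Unused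
digits and reductions modulo `R` or `2` only cause repetitions, which the padding of
`Computation.clause` makes different. -/
theorem machineClause_sat_iff (hR : 6 ≤ R) {m : ℕ} {a : ℕ → Bool} :
    (∀ n < (R ^ 3) ^ 8, ClauseSat a (machineClause M x R m fun l => n / (R ^ 3) ^ l % R ^ 3)) ↔
    (∀ i < R ^ 3, a (lower m (R ^ 3) 0 i) = confBit M R M.init i) ∧
      (∀ t < R ^ 3, Link m (R ^ 3) t a) ∧
      StepRel M x R (fun i => a (lower m (R ^ 3) (R ^ 3) i))
        fun i => a (upper m (R ^ 3) (R ^ 3) i) := by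
  have hRD : R ≤ R ^ 3 := Nat.le_self_pow (by omega) R
  constructor
  · intro h
    -- A required clause is given by the list of its parameters, continued by zeros, and a number
    -- with these digits is looked up.
    have hd : ∀ L : List ℕ, (∀ v ∈ L, v < R ^ 3) →
        ClauseSat a (machineClause M x R m fun l => L.getD l 0) := by
      intro L hL
      obtain ⟨n, hn, h'⟩ := exists_digits (R ^ 3) (fun l => L.getD l 0) (fun l => by
        by_cases hl : l < L.length
        · rw [List.getD_eq_getElem _ _ hl]
          exact hL _ (List.getElem_mem hl)
        · rw [List.getD_eq_default _ _ (not_lt.mp hl)]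
          omega) 8
      have := h n hn
      rw [machineClause] at this ⊢
      simpa only [h' 0 (by omega), h' 1 (by omega), h' 2 (by omega), h' 3 (by omega),
        h' 4 (by omega), h' 5 (by omega), h' 6 (by omega), h' 7 (by omega)] using this
    have hb : ∀ c : Bool, c.toNat < R ^ 3 := fun c => by cases c <;> simp <;> omega
    have hb' : ∀ c : Bool, (c.toNat % 2 == 1) = c := fun c => by cases c <;> rfl
    refine ⟨fun i hi => ?_, fun t ht => link_iff.mpr fun i hi b side c => ?_,
      fun q hq j hj j' hj' o ho s hs i hi => clauseSat_stepClause.mp fun v => ?_⟩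
    · have := hd [0, i] (by simp; omega)
      simpa [machineClause, ClauseSat] using this
    · have := hd [1, t, i, b.toNat, side.toNat, c.toNat] (by simp [hb, ht, hi]; omega)
      rw [machineClause, if_neg (by simp), if_pos (by simp)] at this
      rw [← hb' b, ← hb' side, ← hb' c]
      exact this
    · have := hd [2, q, j, j', o, s, i, v.toNat] (by simp [hb, hi]; omega)
      rw [machineClause, if_neg (by simp), if_neg (by simp)] at this
      rw [← hb' v, ← Nat.mod_eq_of_lt hq, ← Nat.mod_eq_of_lt hj, ← Nat.mod_eq_of_lt hj',
        ← Nat.mod_eq_of_lt ho, ← Nat.mod_eq_of_lt hs]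
      exact this
  · rintro ⟨h1, h2, h3⟩ n -
    have hlt : ∀ l, n / (R ^ 3) ^ l % R ^ 3 < R ^ 3 := fun l => Nat.mod_lt _ (by omega)
    have hlt' : ∀ n, n % R < R := fun n => Nat.mod_lt _ (by omega)
    rw [machineClause]
    split_ifs
    · exact ⟨_, List.mem_singleton.mpr rfl, h1 _ (hlt 1)⟩
    · exact link_iff.mp (h2 _ (hlt 1)) _ (hlt 2) _ _ _
    · exact clauseSat_stepClause.mpr (h3 _ (hlt' _) _ (hlt' _) _ (hlt' _) _ (hlt' _) _ (hlt' _) _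
        (hlt 6)) _

theorem machineClause_var (hR : 6 ≤ R) {m : ℕ} {d : ℕ → ℕ} (hd : ∀ l, d l < R ^ 3)
    {l : Bool × ℕ} (hl : l ∈ machineClause M x R m d) :
    m < l.2 ∧ l.2 < base m (R ^ 3) (R ^ 3 + 1) := by
  have hc : ∀ t ≤ R ^ 3, ∀ i < R ^ 3, (m < base m (R ^ 3) t ∧
      base m (R ^ 3) t < base m (R ^ 3) (R ^ 3 + 1)) ∧
      (m < lower m (R ^ 3) t i ∧ lower m (R ^ 3) t i < base m (R ^ 3) (R ^ 3 + 1)) ∧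
      (m < upper m (R ^ 3) t i ∧ upper m (R ^ 3) t i < base m (R ^ 3) (R ^ 3 + 1)) ∧
      (m < middle m (R ^ 3) t i ∧ middle m (R ^ 3) t i < base m (R ^ 3) (R ^ 3 + 1)) := by
    intro t ht i hi
    have h1 := base_succ m (R ^ 3) t
    have h2 := base_mono m (R ^ 3) (show t + 1 ≤ R ^ 3 + 1 by omega)
    have h3 : m < base m (R ^ 3) t := by unfold base; omega
    unfold lower upper middle
    omega
  have hlt' : ∀ n, n % R < R := fun n => Nat.mod_lt _ (by omega)
  rw [machineClause] at hl
  split_ifs at hl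
  · simp only [List.mem_singleton] at hl
    rw [hl]
    exact (hc 0 (Nat.zero_le _) _ (hd 1)).2.1
  · have h0 := hc _ (hd 1).le _ (hd 2)
    have h1 := hc _ (hd 1) _ (hd 2)
    simp only [linkClause, List.mem_cons, List.not_mem_nil, or_false] at hl
    rcases hl with rfl | rfl | rfl
    · exact h1.1
    · dsimp only
      split_ifs
      · exact h1.2.2.1
      · exact h1.2.1
    · dsimp only
      split_ifs
      · exact h0.2.2.1
      · exact h0.2.1
      · exact h0.2.2.2
  · have hb : ∀ k < 6, ∀ a s, bitIndex R k (a % R) (s % R) < R ^ 3 := fun k hk a s =>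
      bitIndex_lt (by omega) (hlt' a) (hlt' s)
    have hb0 : ∀ k < 6, ∀ a, bitIndex R k (a % R) 0 < R ^ 3 := fun k hk a =>
      bitIndex_lt (by omega) (hlt' a) (by omega)
    simp only [stepClause, List.mem_cons, List.not_mem_nil, or_false] at hl
    rcases hl with rfl | rfl | rfl | rfl | rfl | rfl | rfl
    · exact (hc _ le_rfl _ (hb0 0 (by omega) _)).2.1
    · exact (hc _ le_rfl _ (hb0 1 (by omega) _)).2.1
    · exact (hc _ le_rfl _ (hb0 2 (by omega) _)).2.1
    · exact (hc _ le_rfl _ (hb0 3 (by omega) _)).2.1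
    · exact (hc _ le_rfl _ (hb 4 (by omega) _ _)).2.1
    · exact (hc _ le_rfl _ (hd 6)).2.1
    · exact (hc _ le_rfl _ (hd 6)).2.2.1

/-- The computation of a machine within bounds given by `R`; the result says which letters are in
which positions of the output, where letter number `Nat.card B` is a dummy. -/
noncomputable def machineComputation (M : Machine A B) (x : List A) (R : ℕ) (hR : 6 ≤ R)
    (hB : Nat.card B < R) (hM : ∀ j, Bounded M R (M.conf x j)) : Computation where
  m := R * (Nat.card B + 1)
  W := R ^ 3
  K := R ^ 3
  N := (R ^ 3) ^ 8
  out k := bitIndex R 5 (k / (Nat.card B + 1)) (k % (Nat.card B + 1))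
  core n := machineClause M x R (R * (Nat.card B + 1)) fun l => n / (R ^ 3) ^ l % R ^ 3
  e j := confBit M R (M.conf x j)
  Step := StepRel M x R
  out_lt k hk := bitIndex_lt (by omega) (Nat.div_lt_of_lt_mul (by rwa [mul_comm] at hk))
    ((Nat.mod_lt _ (by omega)).trans_le hB)
  step_iff j _ _ hu := stepRel_iff hR (hM j) hu
  core_iff _ := machineClause_sat_iff hR
  core_var _ _ _ hl := machineClause_var hR (fun _ => Nat.mod_lt _ (by positivity)) hl

end
end MFSearch
-- Polynomial bounds for the computation of a machine.
namespace MFSearch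

theorem Bdd.polynomial {A σ : Type} [Ctx A σ] {b : Bool} (P : Polynomial ℕ) :
    Bdd b fun s : σ => P.eval (Ctx.inp s).length := by
  induction P using Polynomial.induction_on' with
  | add p q hp hq => exact (hp.add hq).mono fun s => by rw [Polynomial.eval_add]
  | monomial n a =>
    have hpow : Bdd b fun s : σ => (Ctx.inp s).length ^ n := by
      induction n with
      | zero => exact (Bdd.const 1).mono fun s => by rw [pow_zero]
      | succ n ih => exact (ih.mul Bdd.length).mono fun s => by rw [pow_succ]
    exact ((Bdd.const a).mul hpow).mono fun s => by rw [Polynomial.eval_monomial]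

section
variable {A B : Type} {M : Machine A B} {x : List A}

/-- Space bounds imply that all configurations are bounded. -/
theorem exists_bounded {f : List A → List B} (hM : M.Computes f) (P : Polynomial ℕ)
    (hP : ∀ x, ∃ s, M.WorkSpaceLE x s ∧ s + (f x).length ≤ P.eval x.length) :
    ∃ c, ∀ x : List A, 6 ≤ (x.length + 2) ^ c ∧ Nat.card B < (x.length + 2) ^ c ∧
      ∀ j, Bounded M ((x.length + 2) ^ c) (M.conf x j) := by
  have hb : Bdd false fun x : List A => P.eval x.length + (x.length + (6 + Nat.card B +
    Nat.card M.Q + Nat.card M.Γ)) := (Bdd.polynomial P).add (Bdd.length.add (Bdd.const _))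
  obtain ⟨c, hc⟩ := hb 0
  refine ⟨c, fun x => ?_⟩
  have hc : P.eval x.length + (x.length + (6 + Nat.card B + Nat.card M.Q + Nat.card M.Γ)) ≤
    (x.length + 2) ^ c := hc x fun i hi => absurd hi (Nat.not_lt_zero i)
  have : 0 < Nat.card M.Q := Nat.card_pos_iff.mpr ⟨⟨M.start⟩, inferInstance⟩
  refine ⟨by omega, by omega, fun j => ⟨(encodeFin_lt _).trans_le (by omega), ?_, ?_, ?_,
    fun a => (encodeFin_lt _).trans_le (by omega)⟩⟩
  · have := M.conf_inHead x j
    omega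
  · obtain ⟨s, hs, hs'⟩ := hP x
    have := hs _ (M.reached_conf x j)
    omega
  · obtain ⟨d, hd, hd', hout⟩ := hM x
    obtain ⟨h, rfl⟩ := hd.exists_conf
    obtain ⟨s, -, hs'⟩ := hP x
    -- The output only grows, so at every moment it is at most as long as the final one.
    have := M.conf_out_mono x (le_max_left j h)
    rw [Machine.conf_of_halted hd' (le_max_right j h), hout] at this
    omega

/-- By `Computation.e_eq`, the vector at time `2 ^ K` is that of the halting configuration. Result
bit `k` asks whether letter number `k % (Nat.card B + 1)` stands at position `k / (Nat.card B + 1)`.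
-/
theorem result_machineComputation [Finite B] {f : List A → List B} (hM : M.Computes f)
    {R : ℕ} (hR : 6 ≤ R) (hB : Nat.card B < R) (hb : ∀ j, Bounded M R (M.conf x j)) {k : ℕ}
    (hk : k < R * (Nat.card B + 1)) : (machineComputation M x R hR hB hb).result k =
      (f x)[k / (Nat.card B + 1)]?.any fun b => encodeFin b == k % (Nat.card B + 1) := by
  obtain ⟨d, hd, hd', hout⟩ := hM x
  obtain ⟨h, rfl⟩ := hd.exists_conf
  rw [Computation.result, Computation.e_eq _ le_rfl (h := h) (fun j hj i _ => ?_) _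
    (Computation.out_lt _ k hk)]
  · have h1 : k / (Nat.card B + 1) < R := Nat.div_lt_of_lt_mul (by rwa [mul_comm] at hk)
    have h2 : k % (Nat.card B + 1) < R := (Nat.mod_lt _ (by omega)).trans_le hB
    change confBit M R (M.conf x h) (bitIndex R 5 _ _) = _
    rw [confBit, bitIndex_mod (by omega), bitIndex_div (by omega) h1,
      bitIndex_div_sq (by omega) h1 h2, hout]
    rfl
  · change confBit M R (M.conf x j) i = confBit M R (M.conf x h) i
    rw [Machine.conf_of_halted hd' hj]

theorem bounded_out_length {f : List A → List B} (hM : M.Computes f) {R : ℕ}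
    (hb : ∀ j, Bounded M R (M.conf x j)) : (f x).length < R := by
  obtain ⟨d, hd, -, hout⟩ := hM x
  obtain ⟨h, rfl⟩ := hd.exists_conf
  rw [← hout]
  exact (hb h).2.2.2.1

end

/-! ### Reading the result off a minimal false weakening -/

section transducer
variable {S T B : Type} (δ : S → T → S) (emit : S → T → List B)

/-- The output of a finite-state transducer. -/
def transduce : S → List T → List B
  | _, [] => []
  | q, t :: ts => emit q t ++ transduce (δ q t) ts

/-- In this form the output is a loop over positions, where the state is recomputed from the prefix
by `CmF.foldl`. -/
theorem transduce_eq_flatMap (q : S) (ts : List T) : transduce δ emit q ts =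
    (List.range ts.length).flatMap fun p => (ts[p]?).elim [] (emit ((ts.take p).foldl δ q)) := by
  induction ts generalizing q with
  | nil => rfl
  | cons t ts ih =>
    rw [List.length_cons, List.range_succ_eq_map, List.flatMap_cons, List.flatMap_map,
      transduce, ih]
    simp

theorem Em.transduce [Finite S] [Finite T] {b : Bool} (q : S) :
    Em b fun ts : List T => transduce δ emit q ts :=
  (Em.flatMap_range (σ := List T) (N := List.length)
    (G := fun ts p => (ts[p]?).elim [] (emit ((ts.take p).foldl δ q))) Cm.length
    (Em.cases (F := fun p : List T × ℕ => (p.1[p.2]?, (p.1.take p.2).foldl δ q))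
      (G := fun o _ => o.1.elim [] (emit o.2))
      ((CmF.getElem? (σ := List T × ℕ) Cm.snd).pair (CmF.foldl (σ := List T × ℕ) δ q Cm.snd))
      fun _ => Em.const _)).congr fun ts => transduce_eq_flatMap δ emit q ts

/-- Behaviour of a transducer on a word: its output and its last state. -/
def Transduces (q : S) (ts : List T) (o : List B) (q' : S) : Prop :=
  transduce δ emit q ts = o ∧ ts.foldl δ q = q'

variable {δ emit}

theorem Transduces.append {q q' q'' : S} {ts ts' : List T} {o o' : List B}
    (h : Transduces δ emit q ts o q') (h' : Transduces δ emit q' ts' o' q'') :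
    Transduces δ emit q (ts ++ ts') (o ++ o') q'' := by
  obtain ⟨rfl, rfl⟩ := h
  obtain ⟨rfl, rfl⟩ := h'
  refine ⟨?_, List.foldl_append⟩
  induction ts generalizing q with
  | nil => rfl
  | cons t ts ih => simp [transduce, ih]

theorem Transduces.cons {q q' : S} {t : T} {ts : List T} {o : List B}
    (h : Transduces δ emit (δ q t) ts o q') : Transduces δ emit q (t :: ts) (emit q t ++ o) q' := by
  obtain ⟨rfl, rfl⟩ := h
  exact ⟨rfl, rfl⟩

theorem Transduces.stay {q : S} {ts : List T} (h : ∀ t ∈ ts, δ q t = q ∧ emit q t = []) :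
    Transduces δ emit q ts [] q := by
  induction ts with
  | nil => exact ⟨rfl, rfl⟩
  | cons t ts ih =>
    obtain ⟨h1, h2⟩ := h t List.mem_cons_self
    have := ih fun t ht => h t (List.mem_cons_of_mem _ ht)
    rw [← h1] at this
    obtain ⟨h3, h4⟩ := Transduces.cons this
    exact ⟨by rw [h3, h2]; rfl, by rw [h4, h1]⟩

end transducer

/-- States of the transducer that reads the result: before or after the first conjunct of the pair
for letter `c`, or after the marker of the first one, or when all pairs have been read. -/
inductive ReadState (n : ℕ) where
  | first (c : Fin (n + 1))
  | marked (c : Fin (n + 1))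
  | second (c : Fin (n + 1))
  | done

instance (n : ℕ) : Finite (ReadState n) := by
  refine Finite.of_injective (β := Fin 4 × Fin (n + 1)) (fun
    | .first c => (0, c)
    | .marked c => (1, c)
    | .second c => (2, c)
    | .done => (3, 0)) ?_
  intro t t' h
  cases t <;> cases t' <;> simp_all

section
variable {A B : Type} {n : ℕ}

/-- Conjuncts come in pairs `(k, false)`, `(k, true)`, and the first one is kept exactly if bit `k`
is `true`. Selector clauses begin with a negative literal. The clause that forces a selection begins
with a positive one and ends the reading. The state counts pairs modulo `n + 1`, which gives the
number of the letter. -/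
def ReadState.next : ReadState n → Token ⊕ A → ReadState n
  | .first c, .inl .clause => .marked c
  | .first c, .inl .top => .second c
  | .marked c, .inl (.lit false) => .second c
  | .marked _, .inl _ => .done
  | .second c, .inl .clause | .second c, .inl .top => .first (Fin.ofNat (n + 1) (c + 1))
  | q, _ => q

def ReadState.emit (letter : ℕ → List B) : ReadState n → Token ⊕ A → List B
  | .marked c, .inl (.lit false) => letter c
  | _, _ => []

variable {letter : ℕ → List B}

/-- The behaviour of the transducer on tokens. -/
abbrev Reads (A : Type) (letter : ℕ → List B) (q : ReadState n) (ts : List Token) (o : List B)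
    (q' : ReadState n) : Prop :=
  Transduces (ReadState.next (A := A)) (ReadState.emit letter) q (ts.map Sum.inl) o q'

theorem Reads.append {q q' q'' : ReadState n} {ts ts' : List Token} {o o' : List B}
    (h : Reads A letter q ts o q') (h' : Reads A letter q' ts' o' q'') :
    Reads A letter q (ts ++ ts') (o ++ o') q'' := by
  rw [Reads, List.map_append]
  exact Transduces.append h h'

theorem reads_skip_first (c : Fin (n + 1)) {ts : List Token}
    (h : ∀ t ∈ ts, t.isClause = false ∧ t ≠ .top) :
    Reads A letter (.first c) ts [] (.first c) :=
  Transduces.stay fun t ht => by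
    obtain ⟨t, ht', rfl⟩ := List.mem_map.mp ht
    have := h t ht'
    cases t <;> simp_all [ReadState.next, ReadState.emit, Token.isClause]

theorem reads_skip_second (c : Fin (n + 1)) {ts : List Token}
    (h : ∀ t ∈ ts, t.isClause = false ∧ t ≠ .top) :
    Reads A letter (.second c) ts [] (.second c) :=
  Transduces.stay fun t ht => by
    obtain ⟨t, ht', rfl⟩ := List.mem_map.mp ht
    have := h t ht'
    cases t <;> simp_all [ReadState.next, ReadState.emit, Token.isClause]

theorem skip_of_isInner {t : Token} (h : t.isInner = true) : t.isClause = false ∧ t ≠ .top := by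
  cases t <;> simp_all [Token.isInner, Token.isClause]

theorem reads_first_top (c : Fin (n + 1)) :
    Reads A letter (.first c) (Conjunct.encode .top) [] (.second c) := ⟨rfl, rfl⟩

theorem reads_first_clause (c : Fin (n + 1)) (v : Var) (C : List Literal) :
    Reads A letter (.first c) (Conjunct.encode (.clause (⟨false, v⟩ :: C))) (letter c)
      (.second c) := by
  have h := reads_skip_second (A := A) (letter := letter) c (ts := Var.encode v ++ encLits C)
    fun t ht => skip_of_isInner <| (List.mem_append.mp ht).elim
      (fun h => isInner_of_isBit (isBit_of_mem_encode h)) isInner_of_mem_encLits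
  have := Transduces.cons (δ := ReadState.next) (emit := ReadState.emit letter)
    (q := .first c) (t := Sum.inl Token.clause) (Transduces.cons (q := ReadState.marked c)
    (t := Sum.inl (Token.lit false)) h)
  rw [List.append_nil] at this
  exact this

theorem reads_second (c : Fin (n + 1)) (d : Conjunct) : Reads A letter (.second c) d.encode []
    (.first (Fin.ofNat (n + 1) (c + 1))) := by
  cases d with
  | top => exact ⟨rfl, rfl⟩
  | clause C =>
    have h := reads_skip_first (A := A) (letter := letter) (Fin.ofNat (n + 1) (c + 1))
      (ts := encLits C) fun t ht => skip_of_isInner (isInner_of_mem_encLits ht)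
    exact Transduces.cons (δ := ReadState.next) (emit := ReadState.emit letter) (q := .second c)
      (t := Sum.inl Token.clause) h

theorem transduce_done (ts : List (Token ⊕ A)) :
    transduce (ReadState.next (n := n)) (ReadState.emit letter) .done ts = [] :=
  (Transduces.stay fun _ _ => ⟨rfl, rfl⟩).1

theorem transduce_last (c : Fin (n + 1)) (v : Var) (C : List Literal) (ts : List (Token ⊕ A)) :
    transduce ReadState.next (ReadState.emit letter) (.first c)
      ((Conjunct.encode (.clause (⟨true, v⟩ :: C))).map Sum.inl ++ ts) = [] :=
  transduce_done _

/-- The pairs of conjuncts for the bits of the result. -/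
theorem reads_pairs (r : ℕ → Bool) (d : ℕ → Conjunct)
    (m : ℕ) (hd : ∀ k < m, (r k = true → ∃ v C, d (2 * k) = .clause (⟨false, v⟩ :: C)) ∧
      (r k = false → d (2 * k) = .top)) : Reads A letter (.first (Fin.ofNat (n + 1) 0))
      (encMatrix ((List.range (2 * m)).map d))
      ((List.range m).flatMap fun k => if r k then letter (k % (n + 1)) else [])
      (.first (Fin.ofNat (n + 1) m)) := by
  induction m with
  | zero => exact ⟨rfl, rfl⟩
  | succ m ih =>
    have h1 : encMatrix ((List.range (2 * (m + 1))).map d) =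
        encMatrix ((List.range (2 * m)).map d) ++
          ((d (2 * m)).encode ++ (d (2 * m + 1)).encode) := by
      rw [show 2 * (m + 1) = 2 * m + 1 + 1 by ring, List.range_succ, List.range_succ]
      simp [encMatrix]
    rw [h1, List.range_succ, List.flatMap_append, List.flatMap_singleton]
    refine (ih fun k hk => hd k (by omega)).append ?_
    have h2 := reads_second (A := A) (letter := letter) (Fin.ofNat (n + 1) m) (d (2 * m + 1))
    have h3 : Fin.ofNat (n + 1) (↑(Fin.ofNat (n + 1) m) + 1) = Fin.ofNat (n + 1) (m + 1) := by
      ext; simp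
    rw [h3] at h2
    obtain ⟨h4, h5⟩ := hd m (by omega)
    split_ifs with h
    · obtain ⟨v, C, h4⟩ := h4 h
      rw [h4]
      have := (reads_first_clause (A := A) (letter := letter) (Fin.ofNat (n + 1) m) v C).append h2
      rw [List.append_nil] at this
      exact this
    · rw [h5 (by simpa using h)]
      exact (reads_first_top _).append h2

end

section
variable {B : Type} [Finite B]

open Classical in
/-- The letter with the given number, as a word. -/
noncomputable def letterWord (B : Type) [Finite B] (c : ℕ) : List B :=
  if h : c < Nat.card B then [(Finite.equivFin B).symm ⟨c, h⟩] else []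

theorem letterWord_encodeFin (b : B) : letterWord B (encodeFin b) = [b] := by
  rw [letterWord, dif_pos (encodeFin_lt b)]
  simp [encodeFin]

theorem flatMap_range_ite {α : Type} (n c : ℕ) (hc : c < n) (l : ℕ → List α) :
    ((List.range n).flatMap fun k => if c == k then l k else []) = l c := by
  induction n with
  | zero => omega
  | succ n ih =>
    rw [List.range_succ, List.flatMap_append, List.flatMap_singleton]
    rcases Nat.lt_succ_iff_lt_or_eq.mp hc with h | rfl
    · rw [ih h, if_neg (by simpa using h.ne), List.append_nil]
    · have : ((List.range c).flatMap fun k => if c == k then l k else []) = [] := by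
        rw [List.flatMap_eq_nil_iff]
        intro k hk
        have := List.mem_range.mp hk
        rw [if_neg (by simpa using this.ne')]
      rw [this, List.nil_append, if_pos (beq_self_eq_true c)]

theorem flatMap_range_mul {α : Type} (R n : ℕ) (hn : 0 < n) (l : ℕ → ℕ → List α) :
    ((List.range (R * n)).flatMap fun k => l (k / n) (k % n)) =
      (List.range R).flatMap fun a => (List.range n).flatMap (l a) := by
  induction R with
  | zero => simp
  | succ R ih =>
    rw [add_mul, one_mul, List.range_add, List.flatMap_append, ih, List.range_succ,
      List.flatMap_append, List.flatMap_singleton, List.flatMap_map]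
    congr 1
    refine List.flatMap_congr fun c hc => ?_
    have := List.mem_range.mp hc
    rw [mul_comm R n, Nat.mul_add_div hn, Nat.div_eq_of_lt this, Nat.mul_add_mod,
      Nat.mod_eq_of_lt this, Nat.add_zero]

theorem flatMap_range_getElem? {α : Type} (l : List α) {R : ℕ} (h : l.length ≤ R) :
    ((List.range R).flatMap fun a => l[a]?.toList) = l := by
  induction l generalizing R with
  | nil => simp
  | cons a l ih =>
    obtain ⟨R, rfl⟩ : ∃ r, R = r + 1 := ⟨R - 1, by simp at h; omega⟩
    rw [List.range_succ_eq_map, List.flatMap_cons, List.flatMap_map]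
    simpa using ih (by simpa using h)

/-- At each position inside the word exactly one letter number passes the test, and the positions
are run through in order; the dummy number `Nat.card B` never passes. -/
theorem flatMap_letterWord (l : List B) {R : ℕ} (h : l.length ≤ R) :
    ((List.range (R * (Nat.card B + 1))).flatMap fun k =>
      if l[k / (Nat.card B + 1)]?.any fun b => encodeFin b == k % (Nat.card B + 1) then
        letterWord B (k % (Nat.card B + 1)) else []) = l := by
  rw [flatMap_range_mul R (Nat.card B + 1) (by omega)
    fun a c => if l[a]?.any fun b => encodeFin b == c then letterWord B c else []]
  conv_rhs => rw [← flatMap_range_getElem? l h]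
  refine List.flatMap_congr fun a _ => ?_
  cases l[a]? with
  | none => simp
  | some b =>
    simp only [Option.any_some, Option.toList_some]
    rw [flatMap_range_ite _ _ ((encodeFin_lt b).trans (Nat.lt_succ_self _)), letterWord_encodeFin]

/-- The function that reads the result off a pair of an answer and an input. -/
noncomputable def readResult (A B : Type) [Finite B] : List (Token ⊕ A) → List B :=
  transduce (ReadState.next (n := Nat.card B)) (ReadState.emit (letterWord B))
    (.first (Fin.ofNat (Nat.card B + 1) 0))

theorem isLogspace_readResult (A B : Type) [Finite A] [Finite B] : IsLogspace (readResult A B) :=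
  (Em.transduce _ _ _).isLogspace

/-- By `Computation.exists_of_mfSearch` the pattern of kept clauses among the first `2 * m` is the
result in complement, and the clause after them is kept and stops the transducer. The copy of the
input behind `z` is ignored. -/
theorem readResult_pairWord {A : Type} {f : List A → List B} {M : Machine A B} {x : List A}
    (hM : M.Computes f) {R : ℕ} (hR : 6 ≤ R) (hB : Nat.card B < R)
    (hb : ∀ j, Bounded M R (M.conf x j)) {z : List Token}
    (hz : mfSearch ((machineComputation M x R hR hB hb).formula fun _ => true).encode z) :
    readResult A B (pairWord z x) = f x := by
  set G := machineComputation M x R hR hB hb with hG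
  obtain ⟨S, rfl, h1, h2⟩ := Computation.exists_of_mfSearch hz
  have hm : G.m = R * (Nat.card B + 1) := rfl
  set r : ℕ → Bool := fun k => S (2 * k) with hr
  obtain ⟨l, hl⟩ : ∃ l, (List.range G.size).map (G.conjunct S) =
      (List.range (2 * G.m)).map (G.conjunct S) ++ (G.conjunct S (2 * G.m) :: l) := by
    refine ⟨((List.range G.N).map fun i => 2 * G.m + 1 + i).map (G.conjunct S), ?_⟩
    rw [Computation.size, List.range_add, List.range_succ]
    simp
  -- The stopping clause starts with a positive literal in any case: with a selector, or for `m = 0`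
  -- with the padding literal.
  obtain ⟨v, C, hlast⟩ : ∃ v C, G.conjunct S (2 * G.m) = .clause (⟨true, v⟩ :: C) := by
    rw [Computation.conjunct, if_pos h1, Computation.clause, Computation.body, if_neg (lt_irrefl _),
      if_pos rfl]
    cases G.m with
    | zero => exact ⟨_, _, rfl⟩
    | succ m => rw [List.range_succ_eq_map]; exact ⟨_, _, rfl⟩
  have hpairs := reads_pairs (n := Nat.card B) (A := A) (letter := letterWord B) r
    (G.conjunct S) G.m fun k hk => by
      constructor
      · intro hS
        rw [Computation.conjunct, if_pos hS, Computation.clause, Computation.body,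
          if_pos (by omega)]
        exact ⟨_, _, rfl⟩
      · intro hS
        rw [Computation.conjunct, if_neg (by simpa [hr] using hS)]
  have hq := reads_skip_first (A := A) (letter := letterWord B) (Fin.ofNat (Nat.card B + 1) 0)
    (ts := encQuants (G.formula S).quants) fun t ht => by
      obtain ⟨⟨_ | _, v⟩, -, ht⟩ := List.mem_flatMap.mp ht
      all_goals
        rcases List.mem_cons.mp ht with rfl | ht
        · simp [Quantifier.token, Token.isClause]
        · exact skip_of_isInner (isInner_of_isBit (isBit_of_mem_encode ht))
  have henc : pairWord (G.formula S).encode x = (encQuants (G.formula S).quants ++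
      encMatrix ((List.range (2 * G.m)).map (G.conjunct S))).map Sum.inl ++
      ((Conjunct.encode (.clause (⟨true, v⟩ :: C))).map Sum.inl ++
        ((encMatrix l).map Sum.inl ++ x.map Sum.inr)) := by
    rw [pairWord, QCNF.encode_eq, show (G.formula S).matrix = _ from hl, hlast]
    simp [encMatrix]
  rw [readResult, henc]
  have := Transduces.append (hq.append hpairs)
    ⟨transduce_last (Fin.ofNat (Nat.card B + 1) G.m) v C
      ((encMatrix l).map Sum.inl ++ x.map Sum.inr), rfl⟩
  rw [this.1, List.nil_append, List.append_nil]
  conv_rhs => rw [← flatMap_letterWord (f x) (bounded_out_length hM hb).le]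
  rw [hm]
  refine List.flatMap_congr fun k hk => ?_
  have hk := List.mem_range.mp hk
  have hres := result_machineComputation hM hR hB hb hk
  rw [← hres]
  have h3 := h2 k hk false
  simp only [Bool.toNat_false, Nat.add_zero] at h3
  -- The clause for `k` with bit `false` is kept exactly if `false` is the wrong value.
  have : r k = G.result k := by
    rw [hr]
    revert h3
    cases G.result k <;> simp
  rw [this]

end
end MFSearch
namespace MFSearch

/-! ### The formula that describes a computation is output in logarithmic space -/

section
variable {A : Type} {σ : Type} [Ctx A σ] {b : Bool}

theorem CmF.cases_finite {α β : Type} [Finite α] {F : σ → α} (hF : CmF b F) {G : α → σ → β}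
    (hG : ∀ a, CmF b (G a)) : CmF b fun s => G (F s) s := fun c =>
  CmP.cases (P := fun a s => G a s = c) hF fun a => hG a c

theorem CmF.beq {F G : σ → ℕ} (hF : Cm b F) (hG : Cm b G) : CmF b fun s => F s == G s := fun c =>
  ((CmP.of_eq hF hG).iff (.const (c = true))).congr fun s => by
    cases c <;> simp

theorem CmF.not {F : σ → Bool} (hF : CmF b F) : CmF b fun s => !F s := hF.map _

/-- Definition by cases on the numbers below `6`. -/
theorem CmF.lt_six {α : Type} {K : σ → ℕ} (hK : Cm b K) {f : ℕ → σ → α}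
    (h6 : ∀ k, f (k + 6) = f 6) (hf : ∀ k ≤ 6, CmF b (f k)) : CmF b fun s => f (K s) s := by
  have hs : ∀ k, CmP b fun s => K s = k := fun k => .of_eq hK (.const k)
  intro a
  refine (CmP.ite (hs 0) (hf 0 (by omega) a) (.ite (hs 1) (hf 1 (by omega) a)
    (.ite (hs 2) (hf 2 (by omega) a) (.ite (hs 3) (hf 3 (by omega) a) (.ite (hs 4)
    (hf 4 (by omega) a) (.ite (hs 5) (hf 5 (by omega) a) (hf 6 (by omega) a))))))).congr
    fun s => ?_
  change f (K s) s = a ↔ _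
  generalize K s = k
  match k with
  | 0 => simp
  | 1 => simp
  | 2 => simp
  | 3 => simp
  | 4 => simp
  | 5 => simp
  | k + 6 => simp [h6]

/-- The clauses `F s` can be output. -/
def EmClause (b : Bool) (F : σ → List (Bool × ℕ)) : Prop :=
  Em b fun s => encLits ((F s).map Computation.lit)

theorem EmClause.nil : EmClause b fun _ : σ => [] := Em.nil

theorem EmClause.append {F G : σ → List (Bool × ℕ)} (hF : EmClause b F) (hG : EmClause b G) :
    EmClause b fun s => F s ++ G s :=
  (Em.append hF hG).congr fun s => by simp [encLits]

theorem encode_varName (i : ℕ) : Var.encode (varName i) = List.replicate i (.bit true) := by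
  simp [Var.encode, varName]

theorem EmClause.single {c : σ → Bool} {v : σ → ℕ} (hc : CmF b c) (hv : Cm b v) :
    EmClause b fun s => [(c s, v s)] :=
  ((Em.cases (G := fun a _ => [Token.lit a]) hc fun a => Em.single _).append
    (Em.replicate hv (Token.bit true))).congr fun s => by
      simp [Computation.lit, encode_varName]

theorem EmClause.cons {c : σ → Bool} {v : σ → ℕ} {F : σ → List (Bool × ℕ)} (hc : CmF b c)
    (hv : Cm b v) (hF : EmClause b F) : EmClause b fun s => (c s, v s) :: F s :=
  (EmClause.single hc hv).append hF

theorem EmClause.ite {P : σ → Prop} [∀ s, Decidable (P s)] (hP : CmP b P)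
    {F G : σ → List (Bool × ℕ)} (hF : EmClause b F) (hG : EmClause b G) :
    EmClause b fun s => if P s then F s else G s :=
  (Em.ite hP hF hG).congr fun s => by
    dsimp only
    split_ifs <;> rfl

theorem EmClause.map_range {N : σ → ℕ} {f : ℕ → Bool × ℕ} (hN : Cm b N)
    (hf : EmClause b fun q : σ × ℕ => [f q.2]) :
    EmClause b fun s => (List.range (N s)).map f :=
  (Em.flatMap_range (G := fun _ k => encLits ([f k].map Computation.lit)) hN hf).congr fun s => by
    rw [List.map_map, encLits, List.flatMap_map]
    simp [encLits]

theorem Cm.base {m W t : σ → ℕ} (hm : Cm b m) (hW : Cm b W) (ht : Cm b t) :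
    Cm b fun s => MFSearch.base (m s) (W s) (t s) :=
  ((Cm.const 1).add hm).add (ht.mul ((Cm.const 1).add ((Cm.const 3).mul hW)))

theorem Cm.lower {m W t i : σ → ℕ} (hm : Cm b m) (hW : Cm b W) (ht : Cm b t) (hi : Cm b i) :
    Cm b fun s => MFSearch.lower (m s) (W s) (t s) (i s) :=
  ((Cm.base hm hW ht).add (.const 1)).add hi

theorem Cm.upper {m W t i : σ → ℕ} (hm : Cm b m) (hW : Cm b W) (ht : Cm b t) (hi : Cm b i) :
    Cm b fun s => MFSearch.upper (m s) (W s) (t s) (i s) :=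
  (((Cm.base hm hW ht).add (.const 1)).add hW).add hi

theorem Cm.middle {m W t i : σ → ℕ} (hm : Cm b m) (hW : Cm b W) (ht : Cm b t) (hi : Cm b i) :
    Cm b fun s => MFSearch.middle (m s) (W s) (t s) (i s) :=
  (((Cm.base hm hW ht).add (.const 1)).add ((Cm.const 2).mul hW)).add hi

theorem Cm.bitIndex {R a t : σ → ℕ} (hR : Cm b R) (k : ℕ) (ha : Cm b a) (ht : Cm b t) :
    Cm b fun s => MFSearch.bitIndex (R s) k (a s) (t s) :=
  ((Cm.const k).add (hR.mul ha)).add ((hR.pow_const 2).mul ht)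

theorem EmClause.linkClause {m W t i : σ → ℕ} (hm : Cm b m) (hW : Cm b W) (ht : Cm b t)
    (hi : Cm b i) {β side c : σ → Bool} (hβ : CmF b β) (hside : CmF b side) (hc : CmF b c) :
    EmClause b fun s => linkClause (m s) (W s) (t s) (i s) (β s) (side s) (c s) := by
  have hP : CmP b fun s => side s = true := hside true
  have ht' := ht.add (.const 1)
  exact .cons hβ.not (.base hm hW ht') (.cons hc (Cm.ite hP (.upper hm hW ht' hi)
    (.lower hm hW ht' hi)) (.cons hc.not (Cm.ite (CmP.of_finite (hβ.pair hside) fun p => p.1 = p.2)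
    (Cm.ite hP (.upper hm hW ht hi) (.lower hm hW ht hi)) (.middle hm hW ht hi)) .nil))

variable {B : Type} [Finite B] (M : Machine A B)

theorem CmF.confBit_init {R i : σ → ℕ} (hR : Cm b R) (hi : Cm b i) :
    CmF b fun s => confBit M (R s) M.init (i s) := by
  have ha := (hi.div hR).mod hR
  refine CmF.lt_six (f := fun k s => match k with
    | 0 => encodeFin M.start == i s / R s % R s
    | 1 => 0 == i s / R s % R s
    | 2 => 0 == i s / R s % R s
    | 3 => 0 == i s / R s % R s
    | 4 => encodeFin M.blank == i s / R s ^ 2 % R s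
    | 5 => false
    | _ => false) (hi.mod hR) (fun _ => rfl) fun k hk => ?_
  interval_cases k
  · exact CmF.beq (.const _) ha
  · exact CmF.beq (.const _) ha
  · exact CmF.beq (.const _) ha
  · exact CmF.beq (.const _) ha
  · exact CmF.beq (.const _) ((hi.div (hR.pow_const 2)).mod hR)
  · exact CmF.const _
  · exact CmF.const _

theorem CmF.nextBit [Finite A] {R q j j' o t i : σ → ℕ} {v : σ → Bool} (hR : Cm b R) (hq : Cm b q)
    (hj : Cm b j) (hj' : Cm b j') (ho : Cm b o) (ht : Cm b t) (hi : Cm b i) (hv : CmF b v) :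
    CmF b fun s =>
      nextBit M (Ctx.inp s) (R s) (q s) (j s) (j' s) (o s) (t s) (i s) (v s) := by
  have ha := (hi.div hR).mod hR
  have hc := (hi.div (hR.pow_const 2)).mod hR
  refine CmF.cases_finite (F := fun s => (decodeFin M.start (q s), inputSymbol (Ctx.inp s) (j s),
    decodeFin M.blank (t s))) (G := fun a s => match M.δ a.1 a.2.1 a.2.2 with
    | none => v s
    | some act => match i s % R s with
      | 0 => encodeFin act.next == i s / R s % R s
      | 1 => act.moveIn.onInput (Ctx.inp s).length (j s) == i s / R s % R s
      | 2 => act.moveWork.onWork (j' s) == i s / R s % R s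
      | 3 => o s + act.emit.toList.length == i s / R s % R s
      | 4 => if i s / R s % R s = j' s then encodeFin act.write == i s / R s ^ 2 % R s else v s
      | 5 => if i s / R s % R s = o s ∧ act.emit ≠ none then
          act.emit.any fun b => encodeFin b == i s / R s ^ 2 % R s else v s
      | _ => v s)
    ((CmF.decode _ hq).pair ((CmF.symbol hj).pair (CmF.decode _ ht))) fun a => ?_
  cases M.δ a.1 a.2.1 a.2.2 with
  | none => exact hv
  | some act =>
    refine CmF.lt_six (f := fun k s => match k with
      | 0 => encodeFin act.next == i s / R s % R s
      | 1 => act.moveIn.onInput (Ctx.inp s).length (j s) == i s / R s % R s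
      | 2 => act.moveWork.onWork (j' s) == i s / R s % R s
      | 3 => o s + act.emit.toList.length == i s / R s % R s
      | 4 => if i s / R s % R s = j' s then encodeFin act.write == i s / R s ^ 2 % R s else v s
      | 5 => if i s / R s % R s = o s ∧ act.emit ≠ none then
          act.emit.any fun b => encodeFin b == i s / R s ^ 2 % R s else v s
      | _ => v s) (hi.mod hR) (fun _ => rfl) fun k hk => ?_
    interval_cases k
    · exact CmF.beq (.const _) ha
    · refine CmF.beq ?_ ha
      cases act.moveIn
      · exact hj.pred
      · exact hj
      · exact (hj.add (.const 1)).min (Cm.length.add (.const 1))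
    · refine CmF.beq ?_ ha
      cases act.moveWork
      · exact hj'.pred
      · exact hj'
      · exact hj'.add (.const 1)
    · exact CmF.beq (ho.add (.const _)) ha
    · exact CmF.ite (.of_eq ha hj') (CmF.beq (.const _) hc) hv
    · refine CmF.ite (.and (.of_eq ha ho) (.const _)) ?_ hv
      cases act.emit with
      | none => exact CmF.const false
      | some b => exact CmF.beq (.const _) hc
    · exact hv

theorem EmClause.stepClause [Finite A] {R m q j j' o t i : σ → ℕ} {v : σ → Bool}
    (hR : Cm b R) (hm : Cm b m) (hq : Cm b q) (hj : Cm b j) (hj' : Cm b j') (ho : Cm b o) (ht : Cm b t) (hi : Cm b i)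
    (hv : CmF b v) : EmClause b fun s =>
      stepClause M (Ctx.inp s) (R s) (m s) (q s) (j s) (j' s) (o s) (t s) (i s) (v s) := by
  have hD := hR.pow_const 3
  have h0 : Cm b fun _ : σ => 0 := .const 0
  exact .cons (.const _) (.lower hm hD hD (.bitIndex hR 0 hq h0))
    (.cons (.const _) (.lower hm hD hD (.bitIndex hR 1 hj h0))
    (.cons (.const _) (.lower hm hD hD (.bitIndex hR 2 hj' h0))
    (.cons (.const _) (.lower hm hD hD (.bitIndex hR 3 ho h0))
    (.cons (.const _) (.lower hm hD hD (.bitIndex hR 4 hj' ht))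
    (.cons hv.not (.lower hm hD hD hi)
    (.cons (.nextBit M hR hq hj hj' ho ht hi hv) (.upper hm hD hD hi) .nil))))))

theorem EmClause.machineClause [Finite A] {R m : σ → ℕ} {d : σ → ℕ → ℕ} (hR : Cm b R) (hm : Cm b m)
    (hd : ∀ l, Cm b fun s => d s l) :
    EmClause b fun s => machineClause M (Ctx.inp s) (R s) (m s) (d s) := by
  have hD := hR.pow_const 3
  have hb : ∀ l, CmF b fun s => d s l % 2 == 1 := fun l => .beq ((hd l).mod (.const 2)) (.const 1)
  have hr : ∀ l, Cm b fun s => d s l % R s := fun l => (hd l).mod hR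
  exact .ite (.of_eq (hd 0) (.const 0)) (.single (.confBit_init M hR (hd 1))
    (.lower hm hD (.const 0) (hd 1))) (.ite (.of_eq (hd 0) (.const 1))
    (.linkClause hm hD (hd 1) (hd 2) (hb 3) (hb 4) (hb 5))
    (.stepClause M hR hm (hr 1) (hr 2) (hr 3) (hr 4) (hr 5) (hd 6) (hb 7)))

/-- All indices, variables and clause numbers are polynomially bounded when `R` is, so they fit into
registers of logarithmic size; the formula is written by nested loops that compute each literal from
its indices. -/
theorem Em.formula [Finite A] {R : List A → ℕ} (hR : Cm false R) {h6 : ∀ x, 6 ≤ R x}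
    {hB : ∀ x, Nat.card B < R x} {hM : ∀ x j, Bounded M (R x) (M.conf x j)} :
    Em false fun x => ((machineComputation M x (R x) (h6 x) (hB x) (hM x)).formula
      fun _ => true).encode := by
  set G := fun x => machineComputation M x (R x) (h6 x) (hB x) (hM x) with hG
  have hm : Cm false fun x => (G x).m := hR.mul (.const (Nat.card B + 1))
  have hW : Cm false fun x => (G x).W := hR.pow_const 3
  have hN : Cm false fun x => (G x).N := hW.pow_const 8
  have hsize : Cm false fun x => (G x).size := (((Cm.const 2).mul hm).add (.const 1)).add hN
  have hq : Em false fun q : List A × ℕ => (quantOf (G q.1).m (G q.1).W q.2).token ::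
      List.replicate q.2 (Token.bit true) := by
    refine (Em.ite (P := fun q : List A × ℕ => q.2 = 0 ∨ ((G q.1).m < q.2 ∧
      (q.2 - 1 - (G q.1).m) % (1 + 3 * (G q.1).W) = 0)) (.or (.of_eq Cm.snd (.const 0)) (.and
      (.of_lt hm.fst Cm.snd) (.of_eq (((Cm.snd.sub (.const 1)).sub hm.fst).mod
      ((Cm.const 1).add ((Cm.const 3).mul hW.fst))) (.const 0)))) (Em.single .all)
      (Em.single .ex)).append (Em.replicate Cm.snd (.bit true)) |>.congr fun q => ?_
    rw [quantOf]
    split_ifs <;> rfl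
  have hbody : EmClause false fun q : List A × ℕ => (G q.1).body q.2 := by
    have hk : Cm false fun q : List A × ℕ => q.2 / 2 := Cm.snd.div (.const 2)
    have hp : Cm false fun q : List A × ℕ => q.2 % 2 := Cm.snd.mod (.const 2)
    have hn : Cm false fun _ : List A × ℕ => Nat.card B + 1 := .const _
    have hi : Cm false fun q : List A × ℕ => q.2 - (2 * (G q.1).m + 1) :=
      Cm.snd.sub (((Cm.const 2).mul hm.fst).add (.const 1))
    exact .ite (.of_lt Cm.snd ((Cm.const 2).mul hm.fst)) (.cons (.const _) ((Cm.const 1).add hk)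
      (.cons (.beq hp (.const 0)) (.base hm.fst hW.fst (.const 0))
      (.cons (.beq hp (.const 1)) (.upper hm.fst hW.fst (.const 0)
        (.bitIndex hR.fst 5 (hk.div hn) (hk.mod hn))) .nil)))
      (.ite (.of_eq Cm.snd ((Cm.const 2).mul hm.fst))
        (.map_range hm.fst (.single (.const _) ((Cm.const 1).add Cm.snd)))
        (.machineClause M hR.fst hm.fst fun l => (hi.div (hW.fst.pow_const l)).mod hW.fst))
  have hclause : Em false fun q : List A × ℕ =>
      Conjunct.encode (.clause (((G q.1).clause q.2).map Computation.lit)) := by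
    refine (Em.cons Token.clause (hbody.append (EmClause.map_range (f := fun _ => (true, 0))
      (Cm.snd.add (.const 1)) (.single (.const _) (.const _))))).congr fun q => ?_
    dsimp only
    rw [Computation.clause, List.map_const', List.length_range]
    rfl
  refine ((Em.flatMap_range (G := fun x i => (quantOf (G x).m (G x).W i).token ::
    List.replicate i (Token.bit true)) (Cm.base hm hW (hW.add (.const 1))) hq).append
    (Em.flatMap_range (G := fun x i =>
      Conjunct.encode (.clause (((G x).clause i).map Computation.lit))) hsize hclause)).congr
    fun x => ?_
  rw [QCNF.encode_eq, encQuants, encMatrix]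
  simp only [Computation.formula, List.flatMap_map, encode_varName]
  rfl

/-- The search problem is hard for FPSPACE. -/
theorem logspaceReducible_mfSearch [Finite A] {R₁ : List A → List B → Prop} (h : IsFPSPACE R₁) :
    LogspaceReducible R₁ mfSearch := by
  obtain ⟨P, -, f, M, hM, hf, hP⟩ := h
  obtain ⟨c, hc⟩ := exists_bounded hM P hP
  refine ⟨_, readResult A B, (Em.formula M (R := fun x => (x.length + 2) ^ c)
    ((Cm.length.add (.const 2)).pow_const c) (h6 := fun x => (hc x).1) (hB := fun x => (hc x).2.1)
    (hM := fun x => (hc x).2.2)).isLogspace, isLogspace_readResult A B,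
    ⟨answer, isComputable_answer, mfSearch_answer⟩, fun x z hz => ?_⟩
  rw [readResult_pairWord hM _ _ _ hz]
  exact hf x

end
end MFSearch
/-- The MF search problem for closed QCNFs is FPSPACE-complete. -/
theorem theorem1 : MFSearch.IsFPSPACEComplete MFSearch.mfSearch :=
  ⟨MFSearch.isFPSPACE_mfSearch, fun _ _ _ _ _ h => MFSearch.logspaceReducible_mfSearch h⟩
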